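/- Let $\mathbf K$ be $\mathbb R$ or $\mathbb C$, let $q\in\mathbf K$ be generic (nonzero and not a root of unity) and let $c\in\mathbf K$, $c\neq 0$. Let $U_q(sl(2))$ be the algebra generated by $X,Y,q^{\pm H}$ with $q^HX=q^2Xq^H$, $Yq^H=q^2q^HY$, $[X,Y]=(q^H-q^{-H})/(q-q^{-1})$ and coproduct $\Delta X=X\otimes 1+q^{-H}\otimes X$, $\Delta Y=1\otimes Y+Y\otimes q^H$, $\Delta q^{\pm H}=q^{\pm H}\otimes q^{\pm H}$, and let $V=\mathrm{Span}(u,v,w)$ be its spin 1 module: $Xu=0$, $Xv=-(q+q^{-1})u$, $Xw=v$, $Yu=-v$, $Yv=(q+q^{-1})w$, $Yw=0$, with $q^H$ acting on $u,v,w$ by $q^2,1,q^{-2}$. Put $v_0=(q^3+q)\,u\otimes w+v\otimes v+(q+q^{-1})\,w\otimes u$ and $v_1=q^2\,u\otimes v-v\otimes u$; these are highest weight elements of the spin 0 and spin 1 components of $V^{\otimes 2}$. The quantum hyperboloid algebra $A=\mathcal A^c_{0,q}$ is the quotient of $T(V)$ by the two-sided ideal generated by $v_0-c$, $v_1$ and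 all elements obtained from them by the action of $U_q(sl(2))$. For $i\ge 0$ let $V_i\subset A$ be the image of the highest component of $V^{\otimes i}$, i.e. of the $U_q(sl(2))$-submodule generated by $u^{\otimes i}$. The left tangent module is the left $A$-module $T(H_q)=(A\otimes V)/A\cdot v_0$, where $v_0$ is viewed in $A\otimes V$. Let $[\,,]_q:V\otimes V\to V$ be a nonzero $U_q(sl(2))$-morphism and $sl(2)_q=(V,[\,,]_q)$. A linear map $\rho:V\to\mathrm{End}(M)$ is a representation of $sl(2)_q$ (with constant $\hbar\in\mathbf K$) if it satisfies the defining relations of the enveloping algebra, namely $v_1-\hbar u=0$ and all relations obtained from it by the action of $U_q(sl(2))$. A (left) quantum anchor is a linear map $\beta:T(H_q)\otimes A\to A$ such that $\beta(a\xi\otimes f)=a\,\beta(\xi\otimes f)$ for $a,f\in A$, $\xi\in T(H_q)$, the operators $\rho_\beta(x)=\beta([1\otimes x]\otimes\cdot)$, $x\in V$, form a representation of $sl(2)_q$ on $A$, and these operators extend the $q$-adjoint operators: $\rho_\beta(x)1=0$ and $\rho_\beta(x)z=[x,z]_q$ in $A$ for $x,z\in V$. (Thus $U^q,V^q,W^q$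 are $\rho_\beta(u),\rho_\beta(v),\rho_\beta(w)$.) **Theorem.** The $q$-adjoint operators $x\mapsto[x,\cdot\,]_q$ form a representation of $sl(2)_q$ on $V$ for some $\hbar\neq 0$. For any $\hbar$ for which they do, a quantum anchor exists. Moreover, there is exactly one quantum anchor $\beta$ such that the operators $\rho_\beta(x)$ map every $V_i$ into itself and, for every $i\geq 1$, do not all vanish on $V_i$. -/

import Mathlib

open scoped TensorProduct

noncomputable section

namespace QuantumAnchor

/-! ### The quantum group `U_q(sl(2))` -/

/-- Generators of `U_q(sl(2))`; `K` and `Kinv` stand for `q^H` and `q^{-H}`. -/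
inductive UqGen
  | X
  | Y
  | K
  | Kinv

/-- A generator, as an element of the free algebra. -/
abbrev gen {𝕜 : Type*} [Field 𝕜] (g : UqGen) : FreeAlgebra 𝕜 UqGen := FreeAlgebra.ι 𝕜 g

/-- The defining relations of `U_q(sl(2))`. -/
inductive UqRel {𝕜 : Type*} [Field 𝕜] (q : 𝕜) :
    FreeAlgebra 𝕜 UqGen → FreeAlgebra 𝕜 UqGen → Prop
  | K_Kinv : UqRel q (gen .K * gen .Kinv) 1
  | Kinv_K : UqRel q (gen .Kinv * gen .K) 1
  | K_X : UqRel q (gen .K * gen .X) (q ^ 2 • (gen .X * gen .K))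
  | Y_K : UqRel q (gen .Y * gen .K) (q ^ 2 • (gen .K * gen .Y))
  | X_Y : UqRel q (gen .X * gen .Y - gen .Y * gen .X)
      ((q - q⁻¹)⁻¹ • (gen .K - gen .Kinv))

/-- The quantum group `U_q(sl(2))`, as an algebra. -/
abbrev Uq {𝕜 : Type*} [Field 𝕜] (q : 𝕜) : Type _ := RingQuot (UqRel q)

/-- A generator, as an element of `U_q(sl(2))`. -/
def Uq.of {𝕜 : Type*} [Field 𝕜] (q : 𝕜) (g : UqGen) : Uq q :=
  RingQuot.mkAlgHom 𝕜 (UqRel q) (gen g)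

section
variable {𝕜 : Type*} [Field 𝕜] (q : 𝕜)

theorem Uq.K_Kinv : Uq.of q .K * Uq.of q .Kinv = 1 := by
  simpa [Uq.of] using RingQuot.mkAlgHom_rel 𝕜 (UqRel.K_Kinv (q := q))

theorem Uq.Kinv_K : Uq.of q .Kinv * Uq.of q .K = 1 := by
  simpa [Uq.of] using RingQuot.mkAlgHom_rel 𝕜 (UqRel.Kinv_K (q := q))

theorem Uq.K_X : Uq.of q .K * Uq.of q .X = q ^ 2 • (Uq.of q .X * Uq.of q .K) := by
  simpa [Uq.of] using RingQuot.mkAlgHom_rel 𝕜 (UqRel.K_X (q := q))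

theorem Uq.Y_K : Uq.of q .Y * Uq.of q .K = q ^ 2 • (Uq.of q .K * Uq.of q .Y) := by
  simpa [Uq.of] using RingQuot.mkAlgHom_rel 𝕜 (UqRel.Y_K (q := q))

theorem Uq.X_Y : Uq.of q .X * Uq.of q .Y - Uq.of q .Y * Uq.of q .X =
    (q - q⁻¹)⁻¹ • (Uq.of q .K - Uq.of q .Kinv) := by
  simpa [Uq.of] using RingQuot.mkAlgHom_rel 𝕜 (UqRel.X_Y (q := q))

theorem Uq.X_Kinv :
    Uq.of q .X * Uq.of q .Kinv = q ^ 2 • (Uq.of q .Kinv * Uq.of q .X) := by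
  calc Uq.of q .X * Uq.of q .Kinv
      = Uq.of q .Kinv * (Uq.of q .K * Uq.of q .X) * Uq.of q .Kinv := by
        rw [← mul_assoc, Uq.Kinv_K, one_mul]
    _ = _ := by
        rw [Uq.K_X, mul_smul_comm, smul_mul_assoc, mul_assoc, mul_assoc, Uq.K_Kinv, mul_one]

theorem Uq.Kinv_Y :
    Uq.of q .Kinv * Uq.of q .Y = q ^ 2 • (Uq.of q .Y * Uq.of q .Kinv) := by
  calc Uq.of q .Kinv * Uq.of q .Y
      = Uq.of q .Kinv * (Uq.of q .Y * Uq.of q .K) * Uq.of q .Kinv := by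
        rw [mul_assoc, mul_assoc, Uq.K_Kinv, mul_one]
    _ = _ := by
        rw [Uq.Y_K, mul_smul_comm, smul_mul_assoc, ← mul_assoc, Uq.Kinv_K, one_mul]

/-- Values of the coproduct on generators:
`Δ X = X ⊗ 1 + q^{-H} ⊗ X`, `Δ Y = 1 ⊗ Y + Y ⊗ q^H`, `Δ q^{±H} = q^{±H} ⊗ q^{±H}`. -/
def Uq.comulGen : UqGen → Uq q ⊗[𝕜] Uq q
  | .X => Uq.of q .X ⊗ₜ 1 + Uq.of q .Kinv ⊗ₜ Uq.of q .X
  | .Y => 1 ⊗ₜ Uq.of q .Y + Uq.of q .Y ⊗ₜ Uq.of q .K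
  | .K => Uq.of q .K ⊗ₜ Uq.of q .K
  | .Kinv => Uq.of q .Kinv ⊗ₜ Uq.of q .Kinv

/-- Values of the counit on generators. -/
def Uq.counitGen : UqGen → 𝕜
  | .X => 0
  | .Y => 0
  | .K => 1
  | .Kinv => 1

/-- The coproduct of `U_q(sl(2))`. -/
def Uq.comulHom : Uq q →ₐ[𝕜] Uq q ⊗[𝕜] Uq q :=
  RingQuot.liftAlgHom 𝕜 ⟨FreeAlgebra.lift 𝕜 (Uq.comulGen q), by
    intro a b h
    have h1 := Uq.K_Kinv q
    have h2 := Uq.Kinv_K q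
    have h3 := Uq.K_X q
    have h4 := Uq.Y_K q
    have h5 := Uq.X_Y q
    have h6 := Uq.X_Kinv q
    have h7 := Uq.Kinv_Y q
    cases h with
    | K_Kinv => simp [Uq.comulGen, h1, Algebra.TensorProduct.one_def]
    | Kinv_K => simp [Uq.comulGen, h2, Algebra.TensorProduct.one_def]
    | K_X =>
      simp [Uq.comulGen, mul_add, add_mul, h1, h2, h3, TensorProduct.smul_tmul']
    | Y_K =>
      simp [Uq.comulGen, mul_add, add_mul, h4, TensorProduct.smul_tmul']
    | X_Y =>
      have e1 : Uq.of q .X * Uq.of q .Y = Uq.of q .Y * Uq.of q .X +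
          (q - q⁻¹)⁻¹ • (Uq.of q .K - Uq.of q .Kinv) := by rw [← h5]; abel
      simp only [map_sub, map_mul, map_smul, FreeAlgebra.lift_ι_apply, Uq.comulGen, mul_add,
        add_mul, Algebra.TensorProduct.tmul_mul_tmul, mul_one, one_mul, e1, h3, h7,
        TensorProduct.tmul_add, TensorProduct.add_tmul, TensorProduct.tmul_sub,
        TensorProduct.sub_tmul, TensorProduct.smul_tmul', TensorProduct.tmul_smul, smul_sub]
      abel⟩

/-- The counit of `U_q(sl(2))`. -/
def Uq.counitHom : Uq q →ₐ[𝕜] 𝕜 :=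
  RingQuot.liftAlgHom 𝕜 ⟨FreeAlgebra.lift 𝕜 Uq.counitGen, by
    intro a b h
    cases h <;> simp [Uq.counitGen]⟩

@[simp] theorem Uq.comulHom_of (g : UqGen) : Uq.comulHom q (Uq.of q g) = Uq.comulGen q g := by
  simp [Uq.comulHom, Uq.of]

@[simp] theorem Uq.counitHom_of (g : UqGen) :
    Uq.counitHom q (Uq.of q g) = Uq.counitGen g := by
  simp [Uq.counitHom, Uq.of]

theorem Uq.hom_ext {B : Type*} [Semiring B] [Algebra 𝕜 B] {f g : Uq q →ₐ[𝕜] B}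
    (h : ∀ x, f (Uq.of q x) = g (Uq.of q x)) : f = g := by
  apply RingQuot.ringQuot_ext'
  ext x
  exact h x

/-- The bialgebra structure of `U_q(sl(2))`. -/
instance Uq.instBialgebra : Bialgebra 𝕜 (Uq q) :=
  Bialgebra.ofAlgHom (Uq.comulHom q) (Uq.counitHom q)
    (by
      apply Uq.hom_ext
      intro x
      cases x <;>
        simp [Uq.comulGen, TensorProduct.tmul_add, TensorProduct.add_tmul,
          Algebra.TensorProduct.one_def, add_assoc])
    (by
      apply Uq.hom_ext
      intro x
      cases x <;> simp [Uq.comulGen, Uq.counitGen])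
    (by
      apply Uq.hom_ext
      intro x
      cases x <;> simp [Uq.comulGen, Uq.counitGen])

/-- The action of `U_q(sl(2))` on a tensor product of two modules, through the coproduct. -/
def tensorRep {M N : Type*} [AddCommGroup M] [Module 𝕜 M] [AddCommGroup N] [Module 𝕜 N]
    (ρ : Uq q →ₐ[𝕜] Module.End 𝕜 M) (σ : Uq q →ₐ[𝕜] Module.End 𝕜 N) :
    Uq q →ₐ[𝕜] Module.End 𝕜 (M ⊗[𝕜] N) :=
  ((Module.endTensorEndAlgHom (R := 𝕜) (S := 𝕜) (A := 𝕜)).comp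
    (Algebra.TensorProduct.map ρ σ)).comp (Bialgebra.comulAlgHom 𝕜 (Uq q))

end

/-! ### The spin 1 module -/

/-- The underlying space of the spin 1 module, with its basis `u, v, w`. -/
abbrev V (𝕜 : Type*) [Field 𝕜] : Type _ := Fin 3 → 𝕜

abbrev u (𝕜 : Type*) [Field 𝕜] : V 𝕜 := Pi.single 0 1
abbrev v (𝕜 : Type*) [Field 𝕜] : V 𝕜 := Pi.single 1 1
abbrev w (𝕜 : Type*) [Field 𝕜] : V 𝕜 := Pi.single 2 1

section
variable {𝕜 : Type*} [Field 𝕜] (q : 𝕜)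

/-- Matrices of the generators in the basis `u, v, w`:
`X u = 0`, `X v = -(q + q⁻¹) u`, `X w = v`; `Y u = -v`, `Y v = (q + q⁻¹) w`, `Y w = 0`;
`q^H u = q² u`, `q^H v = v`, `q^H w = q⁻² w`. -/
def spinOneGen : UqGen → Matrix (Fin 3) (Fin 3) 𝕜
  | .X => !![0, -(q + q⁻¹), 0; 0, 0, 1; 0, 0, 0]
  | .Y => !![0, 0, 0; -1, 0, 0; 0, q + q⁻¹, 0]
  | .K => !![q ^ 2, 0, 0; 0, 1, 0; 0, 0, q⁻¹ ^ 2]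
  | .Kinv => !![q⁻¹ ^ 2, 0, 0; 0, 1, 0; 0, 0, q ^ 2]

/-- A parameter is generic if it is nonzero and not a root of unity. -/
class IsGeneric (q : 𝕜) : Prop where
  ne_zero : q ≠ 0
  pow_ne_one : ∀ n : ℕ, 1 ≤ n → q ^ n ≠ 1

/-- The spin 1 representation of `U_q(sl(2))` on `V`. -/
def spinOne [IsGeneric q] : Uq q →ₐ[𝕜] Module.End 𝕜 (V 𝕜) :=
  (Matrix.toLinAlgEquiv' : Matrix (Fin 3) (Fin 3) 𝕜 ≃ₐ[𝕜] _).toAlgHom.comp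
    (RingQuot.liftAlgHom 𝕜 ⟨FreeAlgebra.lift 𝕜 (spinOneGen q), by
      intro a b h
      have hq : q ≠ 0 := IsGeneric.ne_zero
      have hq2 : q ^ 2 - 1 ≠ 0 :=
        sub_ne_zero.mpr (IsGeneric.pow_ne_one 2 (by norm_num))
      cases h <;> ext i j <;> fin_cases i <;> fin_cases j <;>
        simp [spinOneGen, Matrix.mul_apply, Fin.sum_univ_three] <;> field_simp <;> ring⟩)

/-- The action of `U_q(sl(2))` on the tensor algebra of `V`: `h • 1 = ε(h) 1`,
`h • x = spinOne h x` for `x ∈ V`, and `h • (a b) = ∑ (h₁ • a) (h₂ • b)`, i.e. `a ↦ (h ↦ h • a)`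
is an algebra morphism into the convolution algebra of linear maps `U_q(sl(2)) → T(V)`. -/
def tensorAlgebraAct [IsGeneric q] :
    TensorAlgebra 𝕜 (V 𝕜) →ₐ[𝕜] WithConv (Uq q →ₗ[𝕜] TensorAlgebra 𝕜 (V 𝕜)) :=
  TensorAlgebra.lift 𝕜
    ((WithConv.linearEquiv 𝕜 (Uq q →ₗ[𝕜] TensorAlgebra 𝕜 (V 𝕜))).symm.toLinearMap ∘ₗ
      (LinearMap.llcomp 𝕜 (Uq q) (V 𝕜) (TensorAlgebra 𝕜 (V 𝕜)) (TensorAlgebra.ι 𝕜)) ∘ₗ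
      (spinOne q).toLinearMap.flip)

/-- `act q h t` is the result of acting by `h ∈ U_q(sl(2))` on `t ∈ T(V)`. -/
def act [IsGeneric q] (h : Uq q) (t : TensorAlgebra 𝕜 (V 𝕜)) : TensorAlgebra 𝕜 (V 𝕜) :=
  (tensorAlgebraAct q t).ofConv h

/-- The spanning element of the spin 0 component `V₀ ⊆ V ⊗ V`. -/
def v₀ : V 𝕜 ⊗[𝕜] V 𝕜 :=
  (q ^ 3 + q) • (u 𝕜 ⊗ₜ w 𝕜) + v 𝕜 ⊗ₜ v 𝕜 + (q + q⁻¹) • (w 𝕜 ⊗ₜ u 𝕜)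

/-- The highest weight element of the spin 1 component `V₁ ⊆ V ⊗ V`. -/
def v₁ : V 𝕜 ⊗[𝕜] V 𝕜 := q ^ 2 • (u 𝕜 ⊗ₜ v 𝕜) - v 𝕜 ⊗ₜ u 𝕜

/-- The inclusion of `V ⊗ V` in the tensor algebra. -/
def incl₂ : V 𝕜 ⊗[𝕜] V 𝕜 →ₗ[𝕜] TensorAlgebra 𝕜 (V 𝕜) :=
  TensorProduct.lift ((LinearMap.mul 𝕜 (TensorAlgebra 𝕜 (V 𝕜))).compl₁₂
    (TensorAlgebra.ι 𝕜) (TensorAlgebra.ι 𝕜))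

/-! ### The algebras -/

/-- The relation `v₁ - ħ u` and all those derived from it: the defining relations of the
enveloping algebra of `sl(2)_q`. -/
def envelopingRelations [IsGeneric q] (ħ : 𝕜) : Set (TensorAlgebra 𝕜 (V 𝕜)) :=
  {r | ∃ h : Uq q, r = act q h (incl₂ (v₁ q) - ħ • TensorAlgebra.ι 𝕜 (u 𝕜))}

/-- The relations `v₀ - c`, `v₁ - ħ u` and all those derived from them. -/
def algRelations [IsGeneric q] (ħ c : 𝕜) : Set (TensorAlgebra 𝕜 (V 𝕜)) :=
  {r | ∃ h : Uq q, r = act q h (incl₂ (v₀ q) - algebraMap 𝕜 _ c)} ∪ envelopingRelations q ħ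

/-- The algebra `A_{ħ,q}^c`: the quotient of the tensor algebra of `V` by the two-sided ideal
generated by `algRelations q ħ c`. -/
def Alg [IsGeneric q] (ħ c : 𝕜) : Type _ :=
  RingQuot fun a b : TensorAlgebra 𝕜 (V 𝕜) => a ∈ algRelations q ħ c ∧ b = 0

instance [IsGeneric q] (ħ c : 𝕜) : Ring (Alg q ħ c) := inferInstanceAs (Ring (RingQuot _))

instance [IsGeneric q] (ħ c : 𝕜) : Algebra 𝕜 (Alg q ħ c) :=
  inferInstanceAs (Algebra 𝕜 (RingQuot _))

/-- The algebra `A_{0,q}^c`; for `c ≠ 0` it is the quantum hyperboloid. -/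
abbrev Hyp [IsGeneric q] (c : 𝕜) : Type _ := Alg q 0 c

/-- The projection of `T(V)` onto `A_{0,q}^c`. -/
def proj [IsGeneric q] (c : 𝕜) : TensorAlgebra 𝕜 (V 𝕜) →ₐ[𝕜] Hyp q c :=
  RingQuot.mkAlgHom 𝕜 fun a b : TensorAlgebra 𝕜 (V 𝕜) => a ∈ algRelations q 0 c ∧ b = 0

/-- The canonical map `V → A_{0,q}^c`. -/
def coord [IsGeneric q] (c : 𝕜) : V 𝕜 →ₗ[𝕜] Hyp q c :=
  (proj q c).toLinearMap ∘ₗ TensorAlgebra.ι 𝕜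

/-- The highest (spin `i`) component `V_i` of `V^{⊗ i} ⊆ T(V)`: the `U_q(sl(2))`-submodule
generated by the highest weight element `u ⊗ ⋯ ⊗ u`. -/
def highestComponent [IsGeneric q] (i : ℕ) : Submodule 𝕜 (TensorAlgebra 𝕜 (V 𝕜)) :=
  LinearMap.range (tensorAlgebraAct q (TensorAlgebra.ι 𝕜 (u 𝕜) ^ i)).ofConv

/-- The component `V_i` of `A_{0,q}^c`: the image of the highest component of `V^{⊗ i}`. -/
def component [IsGeneric q] (c : 𝕜) (i : ℕ) : Submodule 𝕜 (Hyp q c) :=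
  (highestComponent q i).map (proj q c).toLinearMap

/-! ### The tangent module and quantum anchors -/

/-- The left `A_{0,q}^c`-submodule of `A_{0,q}^c ⊗ V'` generated by `(V ⊗ V')₀`. -/
def tangentRelations [IsGeneric q] (c : 𝕜) : Submodule (Hyp q c) (Hyp q c ⊗[𝕜] V 𝕜) :=
  Submodule.span (Hyp q c) {(coord q c).rTensor (V 𝕜) (v₀ q)}

/-- The left tangent module `T(H_q)`. -/
abbrev Tangent [IsGeneric q] (c : 𝕜) : Type _ :=
  (Hyp q c ⊗[𝕜] V 𝕜) ⧸ tangentRelations q c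

/-- The map `V' → T(H_q)`, `x ↦ 1 ⊗ x`; the images of `u, v, w` are `U^q, V^q, W^q`. -/
def field [IsGeneric q] (c : 𝕜) : V 𝕜 →ₗ[𝕜] Tangent q c :=
  ((tangentRelations q c).mkQ.restrictScalars 𝕜) ∘ₗ TensorProduct.mk 𝕜 (Hyp q c) (V 𝕜) 1

/-- The operators on `A_{0,q}^c` corresponding to `U^q, V^q, W^q` (for `x = u, v, w`) under
`β`. -/
def op [IsGeneric q] {c : 𝕜} (β : Tangent q c ⊗[𝕜] Hyp q c →ₗ[𝕜] Hyp q c) :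
    V 𝕜 →ₗ[𝕜] Module.End 𝕜 (Hyp q c) :=
  TensorProduct.curry β ∘ₗ field q c

/-- A braided Lie bracket on `V`: a nontrivial `U_q(sl(2))`-morphism `V ⊗ V → V`. -/
structure IsBraidedBracket [IsGeneric q] (B : V 𝕜 ⊗[𝕜] V 𝕜 →ₗ[𝕜] V 𝕜) : Prop where
  equivariant : ∀ (h : Uq q) (t : V 𝕜 ⊗[𝕜] V 𝕜),
    B (tensorRep q (spinOne q) (spinOne q) h t) = spinOne q h (B t)
  ne_zero : B ≠ 0

/-- The `q`-adjoint operators `x ↦ (z ↦ [x, z]_q)`. -/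
def qad (B : V 𝕜 ⊗[𝕜] V 𝕜 →ₗ[𝕜] V 𝕜) : V 𝕜 →ₗ[𝕜] Module.End 𝕜 (V 𝕜) :=
  TensorProduct.curry B

/-- The operators `ρ x`, `x ∈ V`, realize a representation of `sl(2)_q`: they satisfy the defining
relations of its enveloping algebra. -/
def IsRep [IsGeneric q] (ħ : 𝕜) {M : Type*} [AddCommGroup M] [Module 𝕜 M]
    (ρ : V 𝕜 →ₗ[𝕜] Module.End 𝕜 M) : Prop :=
  ∀ r ∈ envelopingRelations q ħ, TensorAlgebra.lift 𝕜 ρ r = 0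

/-- `β` is a quantum anchor, extending the `q`-adjoint operators of the bracket `B` from `V`
(and from the constants, where they vanish) to `A_{0,q}^c`. -/
structure IsQuantumAnchor [IsGeneric q] {c : 𝕜} (B : V 𝕜 ⊗[𝕜] V 𝕜 →ₗ[𝕜] V 𝕜) (ħ : 𝕜)
    (β : Tangent q c ⊗[𝕜] Hyp q c →ₗ[𝕜] Hyp q c) : Prop where
  smul_compat : ∀ (a : Hyp q c) (ξ : Tangent q c) (f : Hyp q c),
    β ((a • ξ) ⊗ₜ f) = a * β (ξ ⊗ₜ f)
  isRep : IsRep q ħ (op q β)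
  op_one : ∀ x : V 𝕜, op q β x 1 = 0
  op_coord : ∀ x z : V 𝕜, op q β x (coord q c z) = coord q c (qad B x z)

/-- The operators of `β` map every component `V_i` into itself. -/
def PreservesComponents [IsGeneric q] {c : 𝕜}
    (β : Tangent q c ⊗[𝕜] Hyp q c →ₗ[𝕜] Hyp q c) : Prop :=
  ∀ (i : ℕ) (x : V 𝕜), ∀ f ∈ component q c i, op q β x f ∈ component q c i

/-- On each component `V_i` with `i ≥ 1`, at least one of the operators of `β` is nonzero (as is
the case for the classical action of vector fields on functions). -/
def NonzeroOnComponents [IsGeneric q] {c : 𝕜}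
    (β : Tangent q c ⊗[𝕜] Hyp q c →ₗ[𝕜] Hyp q c) : Prop :=
  ∀ i : ℕ, 1 ≤ i → ∃ x : V 𝕜, ∃ f ∈ component q c i, op q β x f ≠ 0

end

end QuantumAnchor

end

/-!
Everything takes place in one explicit model. Write `Lat 𝕜` for the space of functions on the
lattice of pairs `(i, k)`, and let row `i` be the functions supported at `(i, k)` with `|k| ≤ i`: it
carries the spin `i` module of `U_q(sl(2))`. The operators `mulU`, `mulV`, `mulW` on `Lat 𝕜` satisfy
the relations of the quantum hyperboloid (`envRel_mul`, `mul_v₀`), so applying them to the vacuum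
vector at `(0, 0)` gives a map `orbit` from the hyperboloid to `Lat 𝕜`. It intertwines the actions
of `U_q(sl(2))` (`orbit_proj_act`), is injective because the spanning monomials `u^k v^j`, `w^k v^j`
have different leading terms (`orbit_injective`), and maps the component `V_i` onto row `i`
(`map_orbit_component`).

*The constant.* A braided Lie bracket is unique up to a factor (`IsBraidedBracket.exists_eq`), and
its `q`-adjoint operators are a representation for exactly one `ħ`, which is nonzero since
`q ^ 6 ≠ -1` (`isRep_qad_iff`).

*Existence.* On each row, the operators `adU`, `adV`, `adW` are the generators of an irreducible
representation of `sl(2)_q` with constant `ħ` (`envRel_ad`). Their contraction with the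
multiplication operators through `v₀` vanishes (`mul_ad_v₀`), which is what it takes to extend
them to the tangent module (`exists_anchor`), and on row 1 they are the `q`-adjoint operators
(`hypAd_coord`).

*Uniqueness.* Let `a`, `b`, `d` be the operators by which `u`, `v`, `w` act on `V_i`, `i ≥ 1`, under
an anchor preserving the components. The relation `v₀ = 0` of the tangent module has components in
rows `i + 1` and `i - 1`, and these say that `(a, b, d) = (E T, D T, F T)` for a single operator
`T`, where `E`, `D`, `F` are the standard operators (`exists_eq_ad`). The relations of `sl(2)_q`
for the twisted operators force `T = 0` or `T = 1` (`IsLadder.eq_zero_or_eq_one`), in two stages.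

Over the algebraic closure, the relations say that for `t = ħ / (q² - 1)` the operators `E T`, `F T`
multiply the eigenvalues of `P = D T - t` by `q²`, `q⁻²`. The eigenvalue `0` does not occur, since
on the kernel of `P` the operators `E T`, `F T` commute, and a common eigenvector would make `E`
and `F` proportional to `D ≠ 0` on some vector. So the eigenvalues form finite strings. If the
only eigenvalue of `P` is `-t`, then `D T` is nilpotent and `T = 0`. Otherwise one end of a string
is different from `-t`; its eigenvector is killed by `E T` or `F T`, which makes the highest or the
lowest weight vector an eigenvector of `T` with nonzero eigenvalue (`twist_spectral`).

From that vector, two of the relations determine `T` one basis vector at a time. The first two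
scalars solve a homogeneous linear system whose determinant is nonzero (`ent_det_top`,
`ent_det_bot`), so they are `1`, and the others follow (`IsLadder.eq_one_of_apply_zero`). Since an
anchor as in the theorem does not vanish on `V_i`, it agrees there with the one constructed.
-/

namespace QuantumAnchor

set_option linter.unusedSimpArgs false
set_option linter.unusedSectionVars false

/-! ### Actions of `U_q(sl(2))` on tensor products and on the tensor algebra -/

section
variable {𝕜 : Type*} [Field 𝕜] (q : 𝕜)

theorem Uq.induction {C : Uq q → Prop} (hof : ∀ g, C (Uq.of q g))
    (halg : ∀ r : 𝕜, C (algebraMap 𝕜 (Uq q) r)) (hmul : ∀ a b, C a → C b → C (a * b))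
    (hadd : ∀ a b, C a → C b → C (a + b)) (h : Uq q) : C h := by
  obtain ⟨a, rfl⟩ := RingQuot.mkAlgHom_surjective 𝕜 (UqRel q) h
  induction a with
  | grade0 r => simpa using halg r
  | grade1 x => exact hof x
  | mul a b ha hb => rw [map_mul]; exact hmul _ _ ha hb
  | add a b ha hb => rw [map_add]; exact hadd _ _ ha hb

theorem tensorRep_apply {M N : Type*} [AddCommGroup M] [Module 𝕜 M] [AddCommGroup N] [Module 𝕜 N]
    (ρ : Uq q →ₐ[𝕜] Module.End 𝕜 M) (σ : Uq q →ₐ[𝕜] Module.End 𝕜 N) (h : Uq q) :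
    tensorRep q ρ σ h = Module.endTensorEndAlgHom (R := 𝕜) (S := 𝕜) (A := 𝕜)
      (Algebra.TensorProduct.map ρ σ (Coalgebra.comul (R := 𝕜) h)) := rfl

theorem endTensorEndAlgHom_tmul {M N : Type*} [AddCommGroup M] [Module 𝕜 M] [AddCommGroup N]
    [Module 𝕜 N] (f : Module.End 𝕜 M) (g : Module.End 𝕜 N) (x : M) (y : N) :
    Module.endTensorEndAlgHom (R := 𝕜) (S := 𝕜) (A := 𝕜) (f ⊗ₜ[𝕜] g) (x ⊗ₜ[𝕜] y) =
      f x ⊗ₜ[𝕜] g y := rfl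

theorem comul_of (g : UqGen) : Coalgebra.comul (R := 𝕜) (Uq.of q g) = Uq.comulGen q g :=
  Uq.comulHom_of q g

theorem counit_of (g : UqGen) : Coalgebra.counit (R := 𝕜) (Uq.of q g) = Uq.counitGen g :=
  Uq.counitHom_of q g

section
variable {M N : Type*} [AddCommGroup M] [Module 𝕜 M] [AddCommGroup N] [Module 𝕜 N]
    (ρ : Uq q →ₐ[𝕜] Module.End 𝕜 M) (σ : Uq q →ₐ[𝕜] Module.End 𝕜 N) (x : M) (y : N)

theorem tensorRep_X : tensorRep q ρ σ (Uq.of q .X) (x ⊗ₜ y) =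
    ρ (Uq.of q .X) x ⊗ₜ y + ρ (Uq.of q .Kinv) x ⊗ₜ σ (Uq.of q .X) y := by
  simp [tensorRep_apply, comul_of, Uq.comulGen, endTensorEndAlgHom_tmul]

theorem tensorRep_Y : tensorRep q ρ σ (Uq.of q .Y) (x ⊗ₜ y) =
    x ⊗ₜ σ (Uq.of q .Y) y + ρ (Uq.of q .Y) x ⊗ₜ σ (Uq.of q .K) y := by
  simp [tensorRep_apply, comul_of, Uq.comulGen, endTensorEndAlgHom_tmul]

theorem tensorRep_K : tensorRep q ρ σ (Uq.of q .K) (x ⊗ₜ y) =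
    ρ (Uq.of q .K) x ⊗ₜ σ (Uq.of q .K) y := by
  simp [tensorRep_apply, comul_of, Uq.comulGen, endTensorEndAlgHom_tmul]

theorem tensorRep_Kinv : tensorRep q ρ σ (Uq.of q .Kinv) (x ⊗ₜ y) =
    ρ (Uq.of q .Kinv) x ⊗ₜ σ (Uq.of q .Kinv) y := by
  simp [tensorRep_apply, comul_of, Uq.comulGen, endTensorEndAlgHom_tmul]

end

section
variable [IsGeneric q]

theorem act_one (h : Uq q) :
    act q h (1 : TensorAlgebra 𝕜 (V 𝕜)) = algebraMap 𝕜 _ (Coalgebra.counit (R := 𝕜) h) := by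
  simp [act, LinearMap.convOne_def]

theorem act_algebraMap (h : Uq q) (r : 𝕜) : act q h (algebraMap 𝕜 (TensorAlgebra 𝕜 (V 𝕜)) r) =
    Coalgebra.counit (R := 𝕜) h • algebraMap 𝕜 _ r := by
  rw [act, AlgHom.commutes, LinearMap.convAlgebraMap_apply, Algebra.smul_def, Algebra.smul_def]
  exact Algebra.commutes _ _

theorem act_ι (h : Uq q) (x : V 𝕜) :
    act q h (TensorAlgebra.ι 𝕜 x) = TensorAlgebra.ι 𝕜 (spinOne q h x) := by
  simp [act, tensorAlgebraAct]

theorem act_mul (h : Uq q) (a b : TensorAlgebra 𝕜 (V 𝕜)) :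
    act q h (a * b) = LinearMap.mul' 𝕜 _ (TensorProduct.map (tensorAlgebraAct q a).ofConv
      (tensorAlgebraAct q b).ofConv (Coalgebra.comul h)) := by
  rw [act, map_mul, LinearMap.convMul_apply]

/-- The action on `T(V)` as a linear map in the second variable. -/
noncomputable def actₗ (h : Uq q) : TensorAlgebra 𝕜 (V 𝕜) →ₗ[𝕜] TensorAlgebra 𝕜 (V 𝕜) where
  toFun := act q h
  map_add' a b := by simp [act]
  map_smul' r a := by simp [act]

theorem act_add (h : Uq q) (a b : TensorAlgebra 𝕜 (V 𝕜)) :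
    act q h (a + b) = act q h a + act q h b := (actₗ q h).map_add a b

theorem act_sub (h : Uq q) (a b : TensorAlgebra 𝕜 (V 𝕜)) :
    act q h (a - b) = act q h a - act q h b := (actₗ q h).map_sub a b

theorem act_smul (h : Uq q) (r : 𝕜) (a : TensorAlgebra 𝕜 (V 𝕜)) :
    act q h (r • a) = r • act q h a := (actₗ q h).map_smul r a

@[simp] theorem incl₂_tmul (x y : V 𝕜) :
    incl₂ (x ⊗ₜ[𝕜] y) = TensorAlgebra.ι 𝕜 x * TensorAlgebra.ι 𝕜 y := by
  simp [incl₂]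

theorem act_incl₂ (h : Uq q) (z : V 𝕜 ⊗[𝕜] V 𝕜) :
    act q h (incl₂ z) = incl₂ (tensorRep q (spinOne q) (spinOne q) h z) := by
  induction z with
  | zero => simp [act]
  | add x y hx hy => rw [map_add, act_add, hx, hy, map_add, map_add]
  | tmul x y =>
    rw [incl₂_tmul, act_mul, tensorRep_apply]
    generalize Coalgebra.comul (R := 𝕜) h = t
    induction t with
    | zero => simp
    | add a b ha hb => simp only [map_add, ha, hb, LinearMap.add_apply]
    | tmul a b =>
      have h1 : ∀ (a : Uq q) (x : V 𝕜), (tensorAlgebraAct q (TensorAlgebra.ι 𝕜 x)).ofConv a =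
        TensorAlgebra.ι 𝕜 (spinOne q a x) := act_ι q
      simp [h1, endTensorEndAlgHom_tmul]

end
section
variable [hq : IsGeneric q]

theorem spinOne_of (g : UqGen) : spinOne q (Uq.of q g) = Matrix.toLin' (spinOneGen q g) := by
  simp [spinOne, Uq.of]; rfl

theorem spinOne_X (x : V 𝕜) : spinOne q (Uq.of q .X) x = ![-(q + q⁻¹) * x 1, x 2, 0] := by
  rw [spinOne_of]
  ext i; fin_cases i <;> simp [spinOneGen, Matrix.mulVec, dotProduct, Fin.sum_univ_three]

theorem spinOne_Y (x : V 𝕜) : spinOne q (Uq.of q .Y) x = ![0, - x 0, (q + q⁻¹) * x 1] := by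
  rw [spinOne_of]
  ext i; fin_cases i <;> simp [spinOneGen, Matrix.mulVec, dotProduct, Fin.sum_univ_three]

theorem spinOne_K (x : V 𝕜) : spinOne q (Uq.of q .K) x = ![q ^ 2 * x 0, x 1, q⁻¹ ^ 2 * x 2] := by
  rw [spinOne_of]
  ext i; fin_cases i <;> simp [spinOneGen, Matrix.mulVec, dotProduct, Fin.sum_univ_three]

theorem spinOne_Kinv (x : V 𝕜) :
    spinOne q (Uq.of q .Kinv) x = ![q⁻¹ ^ 2 * x 0, x 1, q ^ 2 * x 2] := by
  rw [spinOne_of]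
  ext i; fin_cases i <;> simp [spinOneGen, Matrix.mulVec, dotProduct, Fin.sum_univ_three]

theorem vec_eq (x : V 𝕜) : x = x 0 • u 𝕜 + x 1 • v 𝕜 + x 2 • w 𝕜 := by
  ext i; fin_cases i <;> simp

end
end

/-! ### The relations of the enveloping algebra -/

section
variable {𝕜 : Type*} [Field 𝕜] (q : 𝕜) [hq : IsGeneric q]

theorem spinOne_X_u : spinOne q (Uq.of q .X) (u 𝕜) = 0 := by
  rw [spinOne_X]; ext i; fin_cases i <;> simp
theorem spinOne_X_v : spinOne q (Uq.of q .X) (v 𝕜) = -(q + q⁻¹) • u 𝕜 := by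
  rw [spinOne_X]; ext i; fin_cases i <;> simp
theorem spinOne_X_w : spinOne q (Uq.of q .X) (w 𝕜) = v 𝕜 := by
  rw [spinOne_X]; ext i; fin_cases i <;> simp
theorem spinOne_Y_u : spinOne q (Uq.of q .Y) (u 𝕜) = -v 𝕜 := by
  rw [spinOne_Y]; ext i; fin_cases i <;> simp
theorem spinOne_Y_v : spinOne q (Uq.of q .Y) (v 𝕜) = (q + q⁻¹) • w 𝕜 := by
  rw [spinOne_Y]; ext i; fin_cases i <;> simp
theorem spinOne_Y_w : spinOne q (Uq.of q .Y) (w 𝕜) = 0 := by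
  rw [spinOne_Y]; ext i; fin_cases i <;> simp
theorem spinOne_K_u : spinOne q (Uq.of q .K) (u 𝕜) = q ^ 2 • u 𝕜 := by
  rw [spinOne_K]; ext i; fin_cases i <;> simp
theorem spinOne_K_v : spinOne q (Uq.of q .K) (v 𝕜) = v 𝕜 := by
  rw [spinOne_K]; ext i; fin_cases i <;> simp
theorem spinOne_K_w : spinOne q (Uq.of q .K) (w 𝕜) = q⁻¹ ^ 2 • w 𝕜 := by
  rw [spinOne_K]; ext i; fin_cases i <;> simp
theorem spinOne_Kinv_u : spinOne q (Uq.of q .Kinv) (u 𝕜) = q⁻¹ ^ 2 • u 𝕜 := by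
  rw [spinOne_Kinv]; ext i; fin_cases i <;> simp
theorem spinOne_Kinv_v : spinOne q (Uq.of q .Kinv) (v 𝕜) = v 𝕜 := by
  rw [spinOne_Kinv]; ext i; fin_cases i <;> simp
theorem spinOne_Kinv_w : spinOne q (Uq.of q .Kinv) (w 𝕜) = q ^ 2 • w 𝕜 := by
  rw [spinOne_Kinv]; ext i; fin_cases i <;> simp

/-- The weight zero vector `Y v₁` of the spin 1 component of `V ⊗ V`. -/
noncomputable def v₁' : V 𝕜 ⊗[𝕜] V 𝕜 :=
  (q ^ 3 + q) • (u 𝕜 ⊗ₜ w 𝕜 - w 𝕜 ⊗ₜ u 𝕜) + (1 - q ^ 2) • (v 𝕜 ⊗ₜ v 𝕜)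

/-- The lowest weight vector `(q + q⁻¹)⁻¹ Y² v₁` of the spin 1 component of `V ⊗ V`. -/
noncomputable def v₁'' : V 𝕜 ⊗[𝕜] V 𝕜 := w 𝕜 ⊗ₜ v 𝕜 - q ^ 2 • (v 𝕜 ⊗ₜ w 𝕜)

/-- `v₁ ↦ u`, `v₁' ↦ -v`, `v₁'' ↦ -w` is an isomorphism from the spin 1 component of `V ⊗ V`
onto `V`. -/
theorem tensorRep_v₁ (h : Uq q) (a b c : 𝕜) : ∃ a' b' c' : 𝕜,
    tensorRep q (spinOne q) (spinOne q) h (a • v₁ q + b • v₁' q + c • v₁'' q) =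
      a' • v₁ q + b' • v₁' q + c' • v₁'' q ∧
    spinOne q h (a • u 𝕜 - b • v 𝕜 - c • w 𝕜) = a' • u 𝕜 - b' • v 𝕜 - c' • w 𝕜 := by
  have h0 : q ≠ 0 := hq.ne_zero
  induction h using Uq.induction generalizing a b c with
  | hof g =>
    cases g with
    | X =>
      refine ⟨(q + q⁻¹) * b, c, 0, ?_, ?_⟩
      · simp only [v₁, v₁', v₁'', map_add, map_sub, map_smul, tensorRep_X, spinOne_X_u,
          spinOne_X_v, spinOne_X_w, spinOne_Kinv_u, spinOne_Kinv_v, spinOne_Kinv_w,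
          TensorProduct.tmul_smul, ← TensorProduct.smul_tmul', TensorProduct.tmul_zero,
          TensorProduct.zero_tmul]
        match_scalars <;> field_simp <;> ring
      · simp only [map_sub, map_smul, spinOne_X_u, spinOne_X_v, spinOne_X_w]
        match_scalars <;> field_simp <;> norm_num
    | Y =>
      refine ⟨0, a, (q + q⁻¹) * b, ?_, ?_⟩
      · simp only [v₁, v₁', v₁'', map_add, map_sub, map_smul, tensorRep_Y, spinOne_Y_u,
          spinOne_Y_v, spinOne_Y_w, spinOne_K_u, spinOne_K_v, spinOne_K_w,
          TensorProduct.tmul_smul, ← TensorProduct.smul_tmul', TensorProduct.tmul_zero,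
          TensorProduct.zero_tmul, TensorProduct.tmul_neg, TensorProduct.neg_tmul]
        match_scalars <;> field_simp <;> ring
      · simp only [map_sub, map_smul, spinOne_Y_u, spinOne_Y_v, spinOne_Y_w]
        match_scalars <;> field_simp
    | K =>
      refine ⟨q ^ 2 * a, b, q⁻¹ ^ 2 * c, ?_, ?_⟩
      · simp only [v₁, v₁', v₁'', map_add, map_sub, map_smul, tensorRep_K, spinOne_K_u,
          spinOne_K_v, spinOne_K_w, TensorProduct.tmul_smul, ← TensorProduct.smul_tmul']
        match_scalars <;> field_simp
      · simp only [map_sub, map_smul, spinOne_K_u, spinOne_K_v, spinOne_K_w]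
        match_scalars <;> field_simp
    | Kinv =>
      refine ⟨q⁻¹ ^ 2 * a, b, q ^ 2 * c, ?_, ?_⟩
      · simp only [v₁, v₁', v₁'', map_add, map_sub, map_smul, tensorRep_Kinv, spinOne_Kinv_u,
          spinOne_Kinv_v, spinOne_Kinv_w, TensorProduct.tmul_smul, ← TensorProduct.smul_tmul']
        match_scalars <;> field_simp
      · simp only [map_sub, map_smul, spinOne_Kinv_u, spinOne_Kinv_v, spinOne_Kinv_w]
        match_scalars <;> field_simp
  | halg r =>
    refine ⟨r * a, r * b, r * c, ?_, ?_⟩ <;>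
      simp only [AlgHom.commutes, Module.algebraMap_end_apply] <;> module
  | hmul x y hx hy =>
    obtain ⟨a₁, b₁, c₁, h₁, h₁'⟩ := hy a b c
    obtain ⟨a₂, b₂, c₂, h₂, h₂'⟩ := hx a₁ b₁ c₁
    exact ⟨a₂, b₂, c₂, by rw [map_mul, Module.End.mul_apply, h₁, h₂],
      by rw [map_mul, Module.End.mul_apply, h₁', h₂']⟩
  | hadd x y hx hy =>
    obtain ⟨a₁, b₁, c₁, h₁, h₁'⟩ := hy a b c
    obtain ⟨a₂, b₂, c₂, h₂, h₂'⟩ := hx a b c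
    refine ⟨a₁ + a₂, b₁ + b₂, c₁ + c₂, ?_, ?_⟩
    · rw [map_add (tensorRep q (spinOne q) (spinOne q)) x y, LinearMap.add_apply, h₁, h₂]; module
    · rw [map_add, LinearMap.add_apply, h₁', h₂']; module

theorem tensorRep_v₀ (h : Uq q) : tensorRep q (spinOne q) (spinOne q) h (v₀ q) =
    Coalgebra.counit (R := 𝕜) h • v₀ q := by
  have h0 : q ≠ 0 := hq.ne_zero
  induction h using Uq.induction with
  | hof g =>
    rw [counit_of]
    cases g <;>
    · simp only [v₀, Uq.counitGen, map_add, map_smul, tensorRep_X, tensorRep_Y, tensorRep_K,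
        tensorRep_Kinv, spinOne_X_u, spinOne_Y_u, spinOne_Y_v, spinOne_Y_w, spinOne_K_u,
        spinOne_K_v, spinOne_K_w, spinOne_X_v, spinOne_X_w, spinOne_Kinv_u, spinOne_Kinv_v,
        spinOne_Kinv_w, TensorProduct.tmul_smul, ← TensorProduct.smul_tmul',
        TensorProduct.tmul_zero, TensorProduct.zero_tmul, TensorProduct.tmul_neg,
        TensorProduct.neg_tmul]
      match_scalars <;> field_simp <;> ring
  | halg r => simp
  | hmul x y hx hy =>
    rw [map_mul, Module.End.mul_apply, hy, map_smul, hx, Bialgebra.counit_mul, smul_smul, mul_comm]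
  | hadd x y hx hy => rw [map_add, LinearMap.add_apply, hx, hy, map_add, add_smul]

/-- The enveloping algebra of `sl(2)_q` is defined by three relations, one for each weight. -/
theorem forall_envelopingRelations_iff {N : Type*} [AddCommGroup N] [Module 𝕜 N]
    (φ : TensorAlgebra 𝕜 (V 𝕜) →ₗ[𝕜] N) (ħ : 𝕜) :
    (∀ r ∈ envelopingRelations q ħ, φ r = 0) ↔
      φ (incl₂ (v₁ q)) = ħ • φ (TensorAlgebra.ι 𝕜 (u 𝕜)) ∧
      φ (incl₂ (v₁' q)) = -ħ • φ (TensorAlgebra.ι 𝕜 (v 𝕜)) ∧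
      φ (incl₂ (v₁'' q)) = -ħ • φ (TensorAlgebra.ι 𝕜 (w 𝕜)) := by
  have h0 : q ≠ 0 := hq.ne_zero
  have key : ∀ h : Uq q, act q h (incl₂ (v₁ q) - ħ • TensorAlgebra.ι 𝕜 (u 𝕜)) =
      incl₂ (tensorRep q (spinOne q) (spinOne q) h (v₁ q)) -
        ħ • TensorAlgebra.ι 𝕜 (spinOne q h (u 𝕜)) := by
    intro h
    rw [act_sub, act_smul, act_incl₂, act_ι]
  constructor
  · intro H
    have hY : tensorRep q (spinOne q) (spinOne q) (Uq.of q .Y) (v₁ q) = v₁' q := by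
      simp only [v₁, v₁', map_sub, map_smul, tensorRep_Y, spinOne_Y_u,
          spinOne_Y_v, spinOne_K_u, spinOne_K_v,
          TensorProduct.tmul_smul, ← TensorProduct.smul_tmul',
          TensorProduct.tmul_neg, TensorProduct.neg_tmul]
      match_scalars <;> field_simp <;> ring
    have hY' : tensorRep q (spinOne q) (spinOne q) (Uq.of q .Y) (v₁' q) =
        (q + q⁻¹) • v₁'' q := by
      simp only [v₁', v₁'', map_add, map_sub, map_smul, tensorRep_Y, spinOne_Y_u,
          spinOne_Y_v, spinOne_Y_w, spinOne_K_u, spinOne_K_v, spinOne_K_w,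
          TensorProduct.tmul_smul, ← TensorProduct.smul_tmul', TensorProduct.tmul_zero,
          TensorProduct.zero_tmul, TensorProduct.tmul_neg, TensorProduct.neg_tmul]
      match_scalars <;> field_simp <;> ring
    have hs : q + q⁻¹ ≠ 0 := by
      intro h
      apply hq.pow_ne_one 4 (by norm_num)
      have : q ^ 2 = -1 := by field_simp at h; linear_combination h
      linear_combination (q ^ 2 - 1) * this
    refine ⟨?_, ?_, ?_⟩
    · have := H _ ⟨1, rfl⟩
      rw [key] at this
      simpa [sub_eq_zero] using this
    · have := H _ ⟨Uq.of q .Y, rfl⟩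
      rw [key, hY, spinOne_Y_u] at this
      simpa [add_eq_zero_iff_eq_neg] using this
    · have := H _ ⟨Uq.of q .Y * Uq.of q .Y, rfl⟩
      rw [key] at this
      simp only [map_mul, Module.End.mul_apply, hY, hY', spinOne_Y_u, map_neg, spinOne_Y_v] at this
      have h2 : (q + q⁻¹) • (φ (incl₂ (v₁'' q)) + ħ • φ (TensorAlgebra.ι 𝕜 (w 𝕜))) = 0 := by
        rw [← this]; simp only [map_sub, map_smul, map_neg]; module
      have h3 := (smul_eq_zero.mp h2).resolve_left hs
      rw [neg_smul]; exact eq_neg_of_add_eq_zero_left h3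
  · rintro ⟨h1, h2, h3⟩ r ⟨h, rfl⟩
    obtain ⟨a, b, c, e1, e2⟩ := tensorRep_v₁ q h 1 0 0
    simp only [one_smul, zero_smul, add_zero, sub_zero] at e1 e2
    rw [key, e1, e2]
    simp only [map_sub, map_add, map_smul, h1, h2, h3]
    module

section
variable {M : Type*} [AddCommGroup M] [Module 𝕜 M]

/-- The defining relations of the enveloping algebra of `sl(2)_q`, for three operators. -/
structure EnvRel (ħ : 𝕜) (a b d : Module.End 𝕜 M) : Prop where
  rel_u : q ^ 2 • (a * b) - b * a = ħ • a
  rel_v : (q ^ 3 + q) • (a * d - d * a) + (1 - q ^ 2) • (b * b) = -ħ • b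
  rel_w : d * b - q ^ 2 • (b * d) = -ħ • d

theorem EnvRel.map {N : Type*} [AddCommGroup N] [Module 𝕜 N]
    {ħ : 𝕜} {a b d : Module.End 𝕜 M} (h : EnvRel q ħ a b d)
    (F : Module.End 𝕜 M →ₐ[𝕜] Module.End 𝕜 N) : EnvRel q ħ (F a) (F b) (F d) where
  rel_u := by simpa using congrArg F h.rel_u
  rel_v := by simpa using congrArg F h.rel_v
  rel_w := by simpa using congrArg F h.rel_w

theorem isRep_iff (ħ : 𝕜) (ρ : V 𝕜 →ₗ[𝕜] Module.End 𝕜 M) :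
    IsRep q ħ ρ ↔ EnvRel q ħ (ρ (u 𝕜)) (ρ (v 𝕜)) (ρ (w 𝕜)) := by
  have := forall_envelopingRelations_iff q (TensorAlgebra.lift 𝕜 ρ).toLinearMap ħ
  rw [IsRep]
  refine this.trans ⟨fun h => ?_, fun h => ?_⟩
  · obtain ⟨h1, h2, h3⟩ := h
    constructor
    · simpa [v₁] using h1
    · simpa [v₁'] using h2
    · simpa [v₁''] using h3
  · obtain ⟨h1, h2, h3⟩ := h
    refine ⟨?_, ?_, ?_⟩
    · simpa [v₁] using h1
    · simpa [v₁'] using h2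
    · simpa [v₁''] using h3

end

end

/-! ### Nonvanishing for generic parameters -/

section
variable {𝕜 : Type*} [Field 𝕜] (q : 𝕜)

theorem IsGeneric.zpow_ne_one [hq : IsGeneric q] {n : ℤ} (hn : n ≠ 0) : q ^ n ≠ 1 := by
  intro h
  have h2 : q ^ n.natAbs = 1 := by
    rcases Int.natAbs_eq n with e | e
    · rw [← zpow_natCast, ← e, h]
    · rw [← zpow_natCast, show (n.natAbs : ℤ) = -n by omega, zpow_neg, h, inv_one]
  exact hq.pow_ne_one _ (by omega) h2

theorem IsGeneric.zpow_injective [hq : IsGeneric q] {m n : ℤ} (h : q ^ m = q ^ n) : m = n := by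
  by_contra hne
  have h0 : q ≠ 0 := hq.ne_zero
  apply IsGeneric.zpow_ne_one q (sub_ne_zero.mpr hne)
  rw [zpow_sub₀ h0, h, div_self (zpow_ne_zero _ h0)]

theorem IsGeneric.sq_sub_one_ne [hq : IsGeneric q] : q ^ 2 - 1 ≠ 0 :=
  sub_ne_zero.mpr (hq.pow_ne_one 2 (by norm_num))

theorem IsGeneric.sq_add_one_ne [hq : IsGeneric q] : q ^ 2 + 1 ≠ 0 := by
  intro h
  apply hq.pow_ne_one 4 (by norm_num)
  linear_combination (q ^ 2 - 1) * h

theorem IsGeneric.add_inv_ne [hq : IsGeneric q] : q + q⁻¹ ≠ 0 := by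
  have h0 : q ≠ 0 := hq.ne_zero
  intro h; apply IsGeneric.sq_add_one_ne q; field_simp at h; linear_combination h

theorem IsGeneric.sub_inv_ne [hq : IsGeneric q] : q - q⁻¹ ≠ 0 := by
  have h0 : q ≠ 0 := hq.ne_zero
  intro h; apply IsGeneric.sq_sub_one_ne q; field_simp at h; linear_combination h

theorem IsGeneric.pow_three_add_ne [hq : IsGeneric q] : q ^ 3 + q ≠ 0 := by
  rw [show q ^ 3 + q = q * (q ^ 2 + 1) by ring]
  exact mul_ne_zero hq.ne_zero (IsGeneric.sq_add_one_ne q)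

theorem IsGeneric.pow_four_mul_sub_one_ne [hq : IsGeneric q] (i : ℤ) (n : ℤ) (hn : Odd n) :
    (q ^ i) ^ 4 * q ^ (2 * n) - 1 ≠ 0 := by
  rw [sub_ne_zero, ← zpow_natCast, ← zpow_mul, ← zpow_add₀ hq.ne_zero]
  apply IsGeneric.zpow_ne_one
  obtain ⟨m, rfl⟩ := hn
  push_cast; omega

theorem IsGeneric.pow_four_mul_sq_sub_one_ne [hq : IsGeneric q] (i : ℤ) :
    (q ^ i) ^ 4 * q ^ 2 - 1 ≠ 0 := by
  simpa using! IsGeneric.pow_four_mul_sub_one_ne q i 1 (by decide)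

theorem IsGeneric.pow_four_mul_pow_six_sub_one_ne [hq : IsGeneric q] (i : ℤ) :
    (q ^ i) ^ 4 * q ^ 6 - 1 ≠ 0 := by
  simpa using! IsGeneric.pow_four_mul_sub_one_ne q i 3 (by decide)

theorem IsGeneric.pow_four_sub_sq_ne [hq : IsGeneric q] (i : ℤ) :
    (q ^ i) ^ 4 - q ^ 2 ≠ 0 := by
  have h0 : q ≠ 0 := hq.ne_zero
  have := IsGeneric.pow_four_mul_sub_one_ne q i (-1) (by decide)
  intro h
  apply this
  rw [show (2 * -1 : ℤ) = -2 by norm_num, zpow_neg, zpow_ofNat, sub_eq_zero.mp h]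
  exact sub_eq_zero.mpr (mul_inv_cancel₀ (pow_ne_zero 2 h0))

theorem IsGeneric.pow_four_mul_sq_add_one_ne [hq : IsGeneric q] (i : ℤ) :
    (q ^ i) ^ 4 * q ^ 2 + 1 ≠ 0 := by
  intro h
  have h2 : ((q ^ i) ^ 4 * q ^ 2) ^ 2 = 1 := by
    rw [eq_neg_of_add_eq_zero_left h]; norm_num
  rw [← zpow_natCast, ← zpow_natCast, ← zpow_natCast, ← zpow_mul, ← zpow_add₀ hq.ne_zero,
    ← zpow_mul] at h2
  refine IsGeneric.zpow_ne_one q ?_ h2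
  push_cast; omega

/-! ### Operators on the lattice of weights -/

/-- The space of all functions on the lattice of pairs `(i, k)` (spin, half-weight). -/
abbrev Lat (𝕜 : Type*) : Type _ := ℤ → ℤ → 𝕜

/-- The operator on `Lat 𝕜` whose value at `(i, k)` is `f (q ^ i) (q ^ k)` times the value at
`(i + a, k + b)`. -/
noncomputable def hop (f : 𝕜 → 𝕜 → 𝕜) (a b : ℤ) : Module.End 𝕜 (Lat 𝕜) where
  toFun m i k := f (q ^ i) (q ^ k) * m (i + a) (k + b)
  map_add' m n := by funext i k; simp [mul_add]
  map_smul' r m := by funext i k; simp [mul_left_comm]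

theorem hop_apply (f : 𝕜 → 𝕜 → 𝕜) (a b : ℤ) (m : Lat 𝕜) (i k : ℤ) :
    hop q f a b m i k = f (q ^ i) (q ^ k) * m (i + a) (k + b) := rfl

/-- The normalization of the part of the multiplication operators that lowers the spin, as a
function of `a = q ^ i`. -/
noncomputable def kap (c a : 𝕜) : 𝕜 :=
  -c * a ^ 4 * q ^ 3 / ((q ^ 2 + 1) ^ 2 * (a ^ 4 * q ^ 6 - 1) * (a ^ 4 * q ^ 2 - 1))

/-- Left multiplication by `u` on the quantum hyperboloid, in the basis of weight vectors: its first
summand sends spin `i` to spin `i + 1`, its second to spin `i - 1`. As operators on all functions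
on the lattice, `mulU`, `mulV` and `mulW` satisfy the relations without any boundary condition. -/
noncomputable def mulU (c : 𝕜) : Module.End 𝕜 (Lat 𝕜) :=
  hop q (fun a b => b ^ 2 / a ^ 2) (-1) (-1) +
  hop q (fun a b => kap q c a * ((a ^ 2 * q ^ 4 - b ^ 2) * (a ^ 2 * q ^ 2 - b ^ 2))) 1 (-1)

/-- Left multiplication by `v`; see `mulU`. -/
noncomputable def mulV (c : 𝕜) : Module.End 𝕜 (Lat 𝕜) :=
  hop q (fun a b => -(q + q⁻¹) * (b * q / a)) (-1) 0 +
  hop q (fun a b => kap q c a * ((q + q⁻¹) * q / (a * b) *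
    ((a ^ 2 * b ^ 2 * q ^ 2 - 1) * (a ^ 2 * q ^ 2 - b ^ 2)))) 1 0

/-- Left multiplication by `w`; see `mulU`. -/
noncomputable def mulW (c : 𝕜) : Module.End 𝕜 (Lat 𝕜) :=
  hop q (fun _ _ => -1) (-1) 1 +
  hop q (fun a b => -kap q c a *
    ((a ^ 2 * b ^ 2 * q ^ 4 - 1) * (a ^ 2 * b ^ 2 * q ^ 2 - 1) / (a ^ 2 * b ^ 2 * q ^ 2))) 1 1

/-- The `q`-number `[n]`, as a function of `x = q ^ n`. -/
noncomputable def br (x : 𝕜) : 𝕜 := (x - x⁻¹) / (q - q⁻¹)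

/-- The generator `X` in the spin `i` module with its basis of weight vectors. -/
noncomputable def actX : Module.End 𝕜 (Lat 𝕜) := hop q (fun a b => br q (a * q / b)) 0 (-1)
/-- The generator `Y`. -/
noncomputable def actY : Module.End 𝕜 (Lat 𝕜) := hop q (fun a b => br q (a * b * q)) 0 1
/-- The generator `q^H`; the index `k` is half the weight. -/
noncomputable def actK : Module.End 𝕜 (Lat 𝕜) := hop q (fun _ b => b ^ 2) 0 0
/-- The generator `q^{-H}`. -/
noncomputable def actKinv : Module.End 𝕜 (Lat 𝕜) := hop q (fun _ b => (b ^ 2)⁻¹) 0 0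

/-- The normalization, as a function of `a = q ^ i`, for which the operators on spin `i` satisfy the
relations with constant `ħ`. -/
noncomputable def cas (ħ a : 𝕜) : 𝕜 := -ħ * a ^ 2 * q / (a ^ 4 * q ^ 2 + 1)

/-- The operator by which `u` acts on the spin `i` module under the representation of `sl(2)_q`
with constant `ħ`. It preserves `i` and raises the weight. -/
noncomputable def adU (ħ : 𝕜) : Module.End 𝕜 (Lat 𝕜) :=
  hop q (fun a b => cas q ħ a * (b ^ 2 / q ^ 2 * br q (a * q / b))) 0 (-1)
/-- The operator by which `v` acts; it preserves the weight. -/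
noncomputable def adV (ħ : 𝕜) : Module.End 𝕜 (Lat 𝕜) :=
  hop q (fun a b => cas q ħ a *
    (q⁻¹ * ((q + q⁻¹) * b ^ 2 - a ^ 2 * q - (a ^ 2 * q)⁻¹) / (q - q⁻¹))) 0 0
/-- The operator by which `w` acts; it lowers the weight. -/
noncomputable def adW (ħ : 𝕜) : Module.End 𝕜 (Lat 𝕜) :=
  hop q (fun a b => cas q ħ a * (br q (a * b * q) / q ^ 2)) 0 1

theorem kap_mul_inv [hq : IsGeneric q] (c : 𝕜) (i : ℤ) :
    kap q c (q ^ i * q⁻¹) =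
      kap q c (q ^ i) * ((q ^ i) ^ 4 * q ^ 6 - 1) / (q ^ 2 * ((q ^ i) ^ 4 - q ^ 2)) := by
  have h0 : q ≠ 0 := hq.ne_zero
  have h1 := IsGeneric.sq_add_one_ne q
  have e1 := IsGeneric.pow_four_mul_sq_sub_one_ne q i
  have e3 := IsGeneric.pow_four_mul_pow_six_sub_one_ne q i
  have em := IsGeneric.pow_four_sub_sq_ne q i
  generalize q ^ i = a at *
  have f1 : (a * q⁻¹) ^ 4 * q ^ 6 - 1 = a ^ 4 * q ^ 2 - 1 := by field_simp
  have f2 : (a * q⁻¹) ^ 4 * q ^ 2 - 1 = (a ^ 4 - q ^ 2) / q ^ 2 := by field_simp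
  rw [kap, kap, f1, f2]
  field_simp

/-- The constant `c`, solved from `kap`; this lets the relations be checked for an indeterminate
`kap`. -/
theorem kap_spec [hq : IsGeneric q] (c : 𝕜) (i : ℤ) :
    c = -kap q c (q ^ i) * ((q ^ 2 + 1) ^ 2 * ((q ^ i) ^ 4 * q ^ 6 - 1) * ((q ^ i) ^ 4 * q ^ 2 - 1))
      / ((q ^ i) ^ 4 * q ^ 3) := by
  have h0 : q ≠ 0 := hq.ne_zero
  have h1 := IsGeneric.sq_add_one_ne q
  have e1 := IsGeneric.pow_four_mul_sq_sub_one_ne q i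
  have e3 := IsGeneric.pow_four_mul_pow_six_sub_one_ne q i
  have ha : q ^ i ≠ 0 := zpow_ne_zero _ h0
  rw [kap]
  field_simp

theorem envRel_mul [hq : IsGeneric q] (c : 𝕜) :
    EnvRel q 0 (mulU q c) (mulV q c) (mulW q c) := by
  have h0 : q ≠ 0 := hq.ne_zero
  constructor <;>
  · ext m i k
    have em := IsGeneric.pow_four_sub_sq_ne q i
    have ha : q ^ i ≠ 0 := zpow_ne_zero _ h0
    have hb : q ^ k ≠ 0 := zpow_ne_zero _ h0
    simp only [mulU, mulV, mulW, Module.End.mul_apply, LinearMap.sub_apply, LinearMap.add_apply,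
      LinearMap.smul_apply, Pi.add_apply, Pi.sub_apply, Pi.smul_apply, hop_apply, smul_eq_mul,
      add_zero, neg_add_cancel_right, add_neg_cancel_right, zpow_add₀ h0, zpow_neg_one,
      zpow_one, zero_mul, kap_mul_inv, neg_zero]
    generalize kap q c (q ^ i) = κ
    generalize kap q c (q ^ i * q) = κ'
    generalize q ^ i = a at *
    generalize q ^ k = b at *
    field_simp
    ring

/-- The multiplication operators satisfy the relation `v₀ = c`. -/
theorem mul_v₀ [hq : IsGeneric q] (c : 𝕜) :
    (q ^ 3 + q) • (mulU q c * mulW q c) + mulV q c * mulV q c +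
      (q + q⁻¹) • (mulW q c * mulU q c) = algebraMap 𝕜 _ c := by
  have h0 : q ≠ 0 := hq.ne_zero
  ext m i k
  have em := IsGeneric.pow_four_sub_sq_ne q i
  have ha : q ^ i ≠ 0 := zpow_ne_zero _ h0
  have hb : q ^ k ≠ 0 := zpow_ne_zero _ h0
  simp only [mulU, mulV, mulW, Module.End.mul_apply, LinearMap.sub_apply, LinearMap.add_apply,
    LinearMap.smul_apply, Pi.add_apply, Pi.sub_apply, Pi.smul_apply, hop_apply, smul_eq_mul,
    add_zero, neg_add_cancel_right, add_neg_cancel_right, zpow_add₀ h0, zpow_neg_one,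
    zpow_one, zero_mul, kap_mul_inv, neg_zero, Module.algebraMap_end_apply]
  conv_rhs => rw [kap_spec q c i]
  generalize kap q c (q ^ i) = κ
  generalize kap q c (q ^ i * q) = κ'
  generalize q ^ i = a at *
  generalize q ^ k = b at *
  field_simp
  ring

/-- The constant `ħ`, solved from `cas`. -/
theorem cas_spec [hq : IsGeneric q] (ħ : 𝕜) (i : ℤ) :
    ħ = -cas q ħ (q ^ i) * ((q ^ i) ^ 4 * q ^ 2 + 1) / ((q ^ i) ^ 2 * q) := by
  have h0 : q ≠ 0 := hq.ne_zero
  have e := IsGeneric.pow_four_mul_sq_add_one_ne q i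
  have ha : q ^ i ≠ 0 := zpow_ne_zero _ h0
  rw [cas]
  field_simp

theorem envRel_ad [hq : IsGeneric q] (ħ : 𝕜) :
    EnvRel q ħ (adU q ħ) (adV q ħ) (adW q ħ) := by
  have h0 : q ≠ 0 := hq.ne_zero
  have h1 := IsGeneric.sq_sub_one_ne q
  have h2 := IsGeneric.sub_inv_ne q
  constructor <;>
  · ext m i k
    have hc := cas_spec q ħ i
    have ha : q ^ i ≠ 0 := zpow_ne_zero _ h0
    have hb : q ^ k ≠ 0 := zpow_ne_zero _ h0
    simp only [adU, adV, adW, Module.End.mul_apply, LinearMap.sub_apply, LinearMap.add_apply,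
      LinearMap.smul_apply, Pi.add_apply, Pi.sub_apply, Pi.smul_apply, hop_apply, smul_eq_mul,
      add_zero, neg_add_cancel_right, add_neg_cancel_right, zpow_add₀ h0, zpow_neg_one,
      zpow_one, br]
    generalize cas q ħ (q ^ i) = g at *
    rw [hc]
    generalize q ^ i = a at *
    generalize q ^ k = b at *
    field_simp
    ring

/-- The contraction of the multiplication operators with the operators `adU`, `adV`, `adW` through
`v₀` vanishes, so that the latter extend to the tangent module. -/
theorem mul_ad_v₀ [hq : IsGeneric q] (c ħ : 𝕜) :
    (q ^ 3 + q) • (mulU q c * adW q ħ) + mulV q c * adV q ħ +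
      (q + q⁻¹) • (mulW q c * adU q ħ) = 0 := by
  have h0 : q ≠ 0 := hq.ne_zero
  have h1 := IsGeneric.sq_sub_one_ne q
  have h2 := IsGeneric.sub_inv_ne q
  ext m i k
  have ha : q ^ i ≠ 0 := zpow_ne_zero _ h0
  have hb : q ^ k ≠ 0 := zpow_ne_zero _ h0
  simp only [mulU, mulV, mulW, adU, adV, adW, Module.End.mul_apply, LinearMap.sub_apply,
    LinearMap.add_apply, LinearMap.zero_apply, Pi.zero_apply,
    LinearMap.smul_apply, Pi.add_apply, Pi.sub_apply, Pi.smul_apply, hop_apply, smul_eq_mul,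
    add_zero, neg_add_cancel_right, add_neg_cancel_right, zpow_add₀ h0, zpow_neg_one,
    zpow_one, br]
  generalize cas q ħ (q ^ i * q) = g
  generalize cas q ħ (q ^ i * q⁻¹) = g'
  generalize kap q c (q ^ i) = κ
  generalize q ^ i = a at *
  generalize q ^ k = b at *
  field_simp
  ring

/-- The action of the generators of `U_q(sl(2))` on `Lat 𝕜`. -/
noncomputable def latGen : UqGen → Module.End 𝕜 (Lat 𝕜)
  | .X => actX q
  | .Y => actY q
  | .K => actK q
  | .Kinv => actKinv q

/-- The representation of `U_q(sl(2))` on `Lat 𝕜`: row `i` contains the spin `i` module. -/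
noncomputable def latRep [hq : IsGeneric q] : Uq q →ₐ[𝕜] Module.End 𝕜 (Lat 𝕜) :=
  RingQuot.liftAlgHom 𝕜 ⟨FreeAlgebra.lift 𝕜 (latGen q), by
    have h0 : q ≠ 0 := hq.ne_zero
    have h1 := IsGeneric.sq_sub_one_ne q
    have h2 := IsGeneric.sub_inv_ne q
    intro a b h
    cases h <;>
    · ext m i k
      have ha : q ^ i ≠ 0 := zpow_ne_zero _ h0
      have hb : q ^ k ≠ 0 := zpow_ne_zero _ h0
      simp only [map_mul, map_sub, map_smul, map_one, FreeAlgebra.lift_ι_apply, latGen, actX, actY,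
        actK, actKinv, Module.End.mul_apply, LinearMap.sub_apply, LinearMap.add_apply,
        LinearMap.smul_apply, Pi.add_apply, Pi.sub_apply, Pi.smul_apply, hop_apply, smul_eq_mul,
        add_zero, neg_add_cancel_right, add_neg_cancel_right, zpow_add₀ h0, zpow_neg_one,
        zpow_one, br, Module.End.one_apply]
      generalize q ^ i = a at *
      generalize q ^ k = b at *
      field_simp <;> ring⟩

theorem latRep_of [IsGeneric q] (g : UqGen) : latRep q (Uq.of q g) = latGen q g := by
  simp [latRep, Uq.of]

end

/-! ### The action of the quantum hyperboloid on the lattice -/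

section
variable {𝕜 : Type*} [Field 𝕜] (q : 𝕜)

/-- The operators on `Lat 𝕜` by which the elements of `V` act. -/
noncomputable def mulV₃ (c : 𝕜) : V 𝕜 →ₗ[𝕜] Module.End 𝕜 (Lat 𝕜) :=
  (LinearMap.proj 0 : V 𝕜 →ₗ[𝕜] 𝕜).smulRight (mulU q c) +
  (LinearMap.proj 1 : V 𝕜 →ₗ[𝕜] 𝕜).smulRight (mulV q c) +
  (LinearMap.proj 2 : V 𝕜 →ₗ[𝕜] 𝕜).smulRight (mulW q c)

theorem mulV₃_apply (c : 𝕜) (x : V 𝕜) :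
    mulV₃ q c x = x 0 • mulU q c + x 1 • mulV q c + x 2 • mulW q c := by
  simp [mulV₃]

@[simp] theorem mulV₃_u (c : 𝕜) : mulV₃ q c (u 𝕜) = mulU q c := by simp [mulV₃_apply]
@[simp] theorem mulV₃_v (c : 𝕜) : mulV₃ q c (v 𝕜) = mulV q c := by simp [mulV₃_apply]
@[simp] theorem mulV₃_w (c : 𝕜) : mulV₃ q c (w 𝕜) = mulW q c := by simp [mulV₃_apply]

variable [hq : IsGeneric q]

/-- The representation of the quantum hyperboloid on `Lat 𝕜`. -/
noncomputable def hypRep (c : 𝕜) : Hyp q c →ₐ[𝕜] Module.End 𝕜 (Lat 𝕜) :=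
  RingQuot.liftAlgHom 𝕜 ⟨TensorAlgebra.lift 𝕜 (mulV₃ q c), by
    rintro a b ⟨ha, rfl⟩
    rw [map_zero]
    rcases ha with ⟨h, rfl⟩ | ha
    · rw [act_sub, act_incl₂, tensorRep_v₀, act_algebraMap, map_smul, ← smul_sub, map_smul]
      have := mul_v₀ q c
      simp [v₀, ← this]
    · have := (isRep_iff q 0 (mulV₃ q c)).mpr (by simpa using envRel_mul q c)
      exact this a ha⟩

theorem hypRep_proj (c : 𝕜) (t : TensorAlgebra 𝕜 (V 𝕜)) :
    hypRep q c (proj q c t) = TensorAlgebra.lift 𝕜 (mulV₃ q c) t := by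
  exact RingQuot.liftAlgHom_mkAlgHom_apply (S := 𝕜) _ _ _

theorem hypRep_coord (c : 𝕜) (x : V 𝕜) : hypRep q c (coord q c x) = mulV₃ q c x := by
  simp [coord, hypRep_proj]

theorem proj_relation (c : 𝕜) {r : TensorAlgebra 𝕜 (V 𝕜)} (hr : r ∈ algRelations q 0 c) :
    proj q c r = 0 := by
  have := RingQuot.mkAlgHom_rel 𝕜
    (s := fun a b : TensorAlgebra 𝕜 (V 𝕜) => a ∈ algRelations q 0 c ∧ b = 0) ⟨hr, rfl⟩
  exact this.trans (map_zero (proj q c))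

theorem proj_surjective (c : 𝕜) : Function.Surjective (proj q c) :=
  RingQuot.mkAlgHom_surjective 𝕜 _

theorem proj_ι (c : 𝕜) (x : V 𝕜) : proj q c (TensorAlgebra.ι 𝕜 x) = coord q c x := rfl

theorem coord_relations (c : 𝕜) :
    q ^ 2 • (coord q c (u 𝕜) * coord q c (v 𝕜)) - coord q c (v 𝕜) * coord q c (u 𝕜) = 0 ∧
    (q ^ 3 + q) • (coord q c (u 𝕜) * coord q c (w 𝕜) - coord q c (w 𝕜) * coord q c (u 𝕜)) +
      (1 - q ^ 2) • (coord q c (v 𝕜) * coord q c (v 𝕜)) = 0 ∧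
    coord q c (w 𝕜) * coord q c (v 𝕜) - q ^ 2 • (coord q c (v 𝕜) * coord q c (w 𝕜)) = 0 := by
  have := (forall_envelopingRelations_iff q (proj q c).toLinearMap 0).mp
    (fun r hr => proj_relation q c (Or.inr hr))
  obtain ⟨h1, h2, h3⟩ := this
  refine ⟨?_, ?_, ?_⟩
  · simpa [v₁, proj_ι] using h1
  · simpa [v₁', proj_ι] using h2
  · simpa [v₁'', proj_ι] using h3

theorem coord_v₀ (c : 𝕜) :
    (q ^ 3 + q) • (coord q c (u 𝕜) * coord q c (w 𝕜)) + coord q c (v 𝕜) * coord q c (v 𝕜) +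
      (q + q⁻¹) • (coord q c (w 𝕜) * coord q c (u 𝕜)) = algebraMap 𝕜 _ c := by
  have := proj_relation q c (Or.inl ⟨1, rfl⟩)
  rw [act_sub, act_incl₂, tensorRep_v₀, act_algebraMap] at this
  simpa [v₀, proj_ι, sub_eq_zero] using this

/-- The basis vector of `Lat 𝕜` at `(i, k)`. -/
noncomputable def latSingle (i k : ℤ) : Lat 𝕜 := Pi.single i (Pi.single k 1)

theorem latSingle_apply (i k i' k' : ℤ) :
    latSingle (𝕜 := 𝕜) i k i' k' = if i' = i ∧ k' = k then 1 else 0 := by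
  rw [latSingle]
  by_cases h : i' = i
  · subst h; simp [Pi.single_apply]
  · simp [h]

/-- The orbit map of the vacuum vector, `a ↦ a • e₀₀`. -/
noncomputable def orbit (c : 𝕜) : Hyp q c →ₗ[𝕜] Lat 𝕜 :=
  (LinearMap.applyₗ (latSingle 0 0)) ∘ₗ (hypRep q c).toLinearMap

theorem orbit_apply (c : 𝕜) (a : Hyp q c) : orbit q c a = hypRep q c a (latSingle 0 0) := rfl

theorem orbit_one (c : 𝕜) : orbit q c 1 = latSingle 0 0 := by simp [orbit_apply]

theorem orbit_mul (c : 𝕜) (a b : Hyp q c) : orbit q c (a * b) = hypRep q c a (orbit q c b) := by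
  simp [orbit_apply]

/-- The multiplication `V ⊗ Lat 𝕜 → Lat 𝕜`. -/
noncomputable def latMul (c : 𝕜) : V 𝕜 ⊗[𝕜] Lat 𝕜 →ₗ[𝕜] Lat 𝕜 := TensorProduct.lift (mulV₃ q c)

theorem latMul_equivariant_of (c : 𝕜) (g : UqGen) (x : V 𝕜) (m : Lat 𝕜) :
    latMul q c (tensorRep q (spinOne q) (latRep q) (Uq.of q g) (x ⊗ₜ m)) =
      latRep q (Uq.of q g) (latMul q c (x ⊗ₜ m)) := by
  have h0 : q ≠ 0 := hq.ne_zero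
  have h1 := IsGeneric.sq_sub_one_ne q
  have h2 := IsGeneric.sub_inv_ne q
  cases g <;>
  · simp only [tensorRep_X, tensorRep_Y, tensorRep_K, tensorRep_Kinv, spinOne_X, spinOne_Y,
      spinOne_K, spinOne_Kinv, latRep_of, latGen, latMul, map_add, TensorProduct.lift.tmul,
      mulV₃_apply]
    ext i k
    have ha : q ^ i ≠ 0 := zpow_ne_zero _ h0
    have hb : q ^ k ≠ 0 := zpow_ne_zero _ h0
    simp only [mulU, mulV, mulW, actX, actY, actK, actKinv, Module.End.mul_apply,
      LinearMap.sub_apply, LinearMap.add_apply, LinearMap.zero_apply, Pi.zero_apply,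
      LinearMap.smul_apply, Pi.add_apply, Pi.sub_apply, Pi.smul_apply, hop_apply, smul_eq_mul,
      add_zero, neg_add_cancel_right, add_neg_cancel_right, zpow_add₀ h0, zpow_neg_one,
      zpow_one, br, Matrix.cons_val_zero, Matrix.cons_val_one, Matrix.cons_val]
    generalize kap q c (q ^ i) = κ
    generalize q ^ i = a at *
    generalize q ^ k = b at *
    field_simp <;> ring

theorem latMul_equivariant (c : 𝕜) (h : Uq q) (z : V 𝕜 ⊗[𝕜] Lat 𝕜) :
    latMul q c (tensorRep q (spinOne q) (latRep q) h z) = latRep q h (latMul q c z) := by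
  induction h using Uq.induction generalizing z with
  | hof g =>
    induction z with
    | zero => simp
    | add x y hx hy => simp only [map_add, hx, hy]
    | tmul x m => exact latMul_equivariant_of q c g x m
  | halg r => simp
  | hmul a b ha hb => rw [map_mul, map_mul, Module.End.mul_apply, Module.End.mul_apply, ha, hb]
  | hadd a b ha hb =>
    rw [map_add (tensorRep q (spinOne q) (latRep q)) a b, map_add (latRep q),
      LinearMap.add_apply, LinearMap.add_apply, map_add, ha, hb]

theorem latRep_vacuum (h : Uq q) :
    latRep q h (latSingle 0 0) = Coalgebra.counit (R := 𝕜) h • latSingle 0 0 := by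
  have h0 : q ≠ 0 := hq.ne_zero
  induction h using Uq.induction with
  | hof g =>
    rw [counit_of, latRep_of]
    ext i k
    cases g
    · simp only [latGen, actX, hop_apply, latSingle_apply, Uq.counitGen, zero_smul, add_zero]
      split_ifs with h
      · obtain ⟨rfl, hk⟩ := h
        obtain rfl : k = 1 := by omega
        simp [br, h0]
      · simp
    · simp only [latGen, actY, hop_apply, latSingle_apply, Uq.counitGen, zero_smul, add_zero]
      split_ifs with h
      · obtain ⟨rfl, hk⟩ := h
        obtain rfl : k = -1 := by omega
        simp [br, h0]
      · simp
    · simp only [latGen, actK, hop_apply, latSingle_apply, Uq.counitGen, Pi.smul_apply, add_zero]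
      split_ifs with h <;> simp [h]
    · simp only [latGen, actKinv, hop_apply, latSingle_apply, Uq.counitGen, Pi.smul_apply, add_zero]
      split_ifs with h <;> simp [h]
  | halg r => simp
  | hmul x y hx hy =>
    rw [map_mul, Module.End.mul_apply, hy, map_smul, hx, Bialgebra.counit_mul, smul_smul, mul_comm]
  | hadd x y hx hy => rw [map_add, LinearMap.add_apply, hx, hy, map_add, add_smul]

/-- To prove that a property holds in the tensor algebra, it is enough to build elements up by
multiplication with vectors on the left. -/
theorem tensorAlgebra_induction_left {C : TensorAlgebra 𝕜 (V 𝕜) → Prop} (h1 : C 1)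
    (hsmul : ∀ (r : 𝕜) t, C t → C (r • t)) (hadd : ∀ s t, C s → C t → C (s + t))
    (hmul : ∀ x t, C t → C (TensorAlgebra.ι 𝕜 x * t)) (t : TensorAlgebra 𝕜 (V 𝕜)) : C t := by
  suffices H : ∀ s, C s → C (t * s) by simpa using H 1 h1
  induction t using TensorAlgebra.induction with
  | algebraMap r => intro s hs; rw [← Algebra.smul_def]; exact hsmul r s hs
  | ι x => exact hmul x
  | mul a b ha hb => intro s hs; rw [mul_assoc]; exact ha _ (hb _ hs)
  | add a b ha hb => intro s hs; rw [add_mul]; exact hadd _ _ (ha _ hs) (hb _ hs)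

theorem orbit_proj_ι_mul (c : 𝕜) (x : V 𝕜) (t : TensorAlgebra 𝕜 (V 𝕜)) :
    orbit q c (proj q c (TensorAlgebra.ι 𝕜 x * t)) =
      latMul q c (x ⊗ₜ orbit q c (proj q c t)) := by
  rw [map_mul, orbit_mul, proj_ι, hypRep_coord]; rfl

/-- The orbit map intertwines the action of `U_q(sl(2))` on `T(V)` with that on `Lat 𝕜`. -/
theorem orbit_proj_act (c : 𝕜) (h : Uq q) (t : TensorAlgebra 𝕜 (V 𝕜)) :
    orbit q c (proj q c (act q h t)) = latRep q h (orbit q c (proj q c t)) := by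
  induction t using tensorAlgebra_induction_left generalizing h with
  | h1 =>
    rw [act_one, map_one, orbit_one, latRep_vacuum, AlgHom.commutes, Algebra.algebraMap_eq_smul_one,
      map_smul, orbit_one]
  | hsmul r t ht => rw [act_smul, map_smul, map_smul, ht, map_smul, map_smul, map_smul]
  | hadd s t hs ht => rw [act_add, map_add, map_add, hs, ht, map_add, map_add, map_add]
  | hmul x t ht =>
    rw [orbit_proj_ι_mul, ← latMul_equivariant, act_mul, tensorRep_apply]
    generalize Coalgebra.comul (R := 𝕜) h = z
    induction z with
    | zero => simp
    | add a b ha hb => simp only [map_add, ha, hb, LinearMap.add_apply]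
    | tmul a b =>
      have e1 : (tensorAlgebraAct q (TensorAlgebra.ι 𝕜 x)).ofConv a =
        TensorAlgebra.ι 𝕜 (spinOne q a x) := act_ι q a x
      have e2 : (tensorAlgebraAct q t).ofConv b = act q b t := rfl
      rw [TensorProduct.map_tmul, LinearMap.mul'_apply, e1, e2, orbit_proj_ι_mul, ht]
      rfl

end

/-! ### Components of the quantum hyperboloid -/

section
variable {𝕜 : Type*} [Field 𝕜] (q : 𝕜)

/-- The spin `i` part of `Lat 𝕜`: functions supported at `(i, k)` with `|k| ≤ i`. It vanishes for
negative `i`. -/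
def row (𝕜 : Type*) [Field 𝕜] (i : ℤ) : Submodule 𝕜 (Lat 𝕜) where
  carrier := {m | ∀ i' k, m i' k ≠ 0 → i' = i ∧ |k| ≤ i}
  add_mem' {m n} hm hn i' k h := by
    by_cases h1 : m i' k = 0
    · exact hn i' k (by simpa [h1] using h)
    · exact hm i' k h1
  zero_mem' i' k h := absurd rfl h
  smul_mem' r m hm i' k h := hm i' k (right_ne_zero_of_mul (by simpa using h))

theorem hop_mem_row {f : 𝕜 → 𝕜 → 𝕜} {a b i j : ℤ} (hj : j + a = i)
    (hf : ∀ k, |k + b| ≤ i → f (q ^ j) (q ^ k) ≠ 0 → |k| ≤ j) {m : Lat 𝕜} (hm : m ∈ row 𝕜 i) :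
    hop q f a b m ∈ row 𝕜 j := by
  intro i' k h
  rw [hop_apply] at h
  obtain ⟨h1, h2⟩ := hm _ _ (right_ne_zero_of_mul h)
  obtain rfl : i' = j := by omega
  exact ⟨rfl, hf k h2 (left_ne_zero_of_mul h)⟩

/-- `m` has weight `k` and its component of highest spin has spin `N`. -/
def HasLead (N k : ℤ) (m : Lat 𝕜) : Prop :=
  m N k ≠ 0 ∧ ∀ i k', m i k' ≠ 0 → k' = k ∧ i ≤ N

theorem HasLead.hop_add_hop {f g : 𝕜 → 𝕜 → 𝕜} {b N k : ℤ} {m : Lat 𝕜} (hm : HasLead N k m)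
    (hf : ∀ i k : ℤ, f (q ^ i) (q ^ k) ≠ 0) :
    HasLead (N + 1) (k - b) ((hop q f (-1) b + hop q g 1 b) m) := by
  obtain ⟨h1, h2⟩ := hm
  constructor
  · have : m (N + 1 + 1) k = 0 := by
      by_contra h
      have := (h2 _ _ h).2
      omega
    simpa [hop_apply, this, h1] using hf _ _
  · intro i k' h
    simp only [LinearMap.add_apply, Pi.add_apply, hop_apply] at h
    by_cases h3 : m (i + -1) (k' + b) = 0
    · have h4 : m (i + 1) (k' + b) ≠ 0 := by
        intro h4; rw [h3, h4] at h; simp at h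
      have := h2 _ _ h4
      omega
    · have := h2 _ _ h3
      omega

variable [hq : IsGeneric q]

theorem mulU_mem_row (c : 𝕜) {i : ℤ} {m : Lat 𝕜} (hm : m ∈ row 𝕜 i) :
    mulU q c m ∈ row 𝕜 (i + 1) ⊔ row 𝕜 (i - 1) := by
  have h0 : q ≠ 0 := hq.ne_zero
  refine Submodule.add_mem_sup (hop_mem_row q (by ring) (fun k hk _ => ?_) hm)
    (hop_mem_row q (by ring) (fun k hk hf => ?_) hm)
  · rw [abs_le] at *; omega
  · have h1 : k ≠ i := by
      rintro rfl; apply hf; rw [zpow_sub₀ h0]; field_simp; ring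
    have h2 : k ≠ i + 1 := by
      rintro rfl; apply hf; rw [zpow_sub₀ h0, zpow_add₀ h0]; field_simp; ring
    rw [abs_le] at *; omega

theorem mulV_mem_row (c : 𝕜) {i : ℤ} {m : Lat 𝕜} (hm : m ∈ row 𝕜 i) :
    mulV q c m ∈ row 𝕜 (i + 1) ⊔ row 𝕜 (i - 1) := by
  have h0 : q ≠ 0 := hq.ne_zero
  refine Submodule.add_mem_sup (hop_mem_row q (by ring) (fun k hk _ => ?_) hm)
    (hop_mem_row q (by ring) (fun k hk hf => ?_) hm)
  · rw [abs_le] at *; omega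
  · have h1 : k ≠ i := by
      rintro rfl; apply hf; rw [zpow_sub₀ h0]; field_simp; ring
    have h2 : k ≠ -i := by
      rintro rfl; apply hf; rw [zpow_sub₀ h0, zpow_neg]; field_simp; ring
    rw [abs_le] at *; omega

theorem mulW_mem_row (c : 𝕜) {i : ℤ} {m : Lat 𝕜} (hm : m ∈ row 𝕜 i) :
    mulW q c m ∈ row 𝕜 (i + 1) ⊔ row 𝕜 (i - 1) := by
  have h0 : q ≠ 0 := hq.ne_zero
  refine Submodule.add_mem_sup (hop_mem_row q (by ring) (fun k hk _ => ?_) hm)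
    (hop_mem_row q (by ring) (fun k hk hf => ?_) hm)
  · rw [abs_le] at *; omega
  · have h1 : k ≠ -i := by
      rintro rfl; apply hf; rw [zpow_sub₀ h0, zpow_neg]; field_simp; ring
    have h2 : k ≠ -i - 1 := by
      rintro rfl; apply hf; rw [zpow_sub₀ h0, zpow_sub₀ h0, zpow_neg]; field_simp; ring
    rw [abs_le] at *; omega

theorem latRep_mem_row {i : ℤ} (h : Uq q) {m : Lat 𝕜} (hm : m ∈ row 𝕜 i) :
    latRep q h m ∈ row 𝕜 i := by
  have h0 : q ≠ 0 := hq.ne_zero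
  induction h using Uq.induction generalizing m with
  | hof g =>
    rw [latRep_of]
    cases g
    · refine hop_mem_row q (by ring) (fun k hk hf => ?_) hm
      have h1 : k ≠ i + 1 := by
        rintro rfl; apply hf; rw [zpow_add₀ h0, zpow_one, div_self (by positivity)]; simp [br]
      rw [abs_le] at *; omega
    · refine hop_mem_row q (by ring) (fun k hk hf => ?_) hm
      have h1 : k ≠ -i - 1 := by
        rintro rfl; apply hf; rw [zpow_sub₀ h0, zpow_neg, zpow_one]
        have ha : q ^ i ≠ 0 := zpow_ne_zero _ h0
        rw [show q ^ i * ((q ^ i)⁻¹ / q) * q = 1 by field_simp]; simp [br]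
      rw [abs_le] at *; omega
    · exact hop_mem_row q (by ring) (fun k hk hf => by simpa using hk) hm
    · exact hop_mem_row q (by ring) (fun k hk hf => by simpa using hk) hm
  | halg r => simpa using (row 𝕜 i).smul_mem r hm
  | hmul x y hx hy => rw [map_mul, Module.End.mul_apply]; exact hx (hy hm)
  | hadd x y hx hy => rw [map_add, LinearMap.add_apply]; exact add_mem (hx hm) (hy hm)

theorem latSingle_mem_row {i k : ℤ} (h : |k| ≤ i) : latSingle i k ∈ row 𝕜 i := by
  intro i' k' hne
  rw [latSingle_apply] at hne
  split_ifs at hne with h1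
  · exact ⟨h1.1, h1.2 ▸ h⟩
  · exact absurd rfl hne

theorem eq_sum_of_mem_row {i : ℤ} {m : Lat 𝕜} (hm : m ∈ row 𝕜 i) :
    m = ∑ k ∈ Finset.Icc (-i) i, m i k • latSingle i k := by
  ext i' k'
  simp only [Finset.sum_apply, Pi.smul_apply, latSingle_apply, smul_eq_mul, mul_ite, mul_one,
    mul_zero]
  by_cases h : i' = i ∧ |k'| ≤ i
  · obtain ⟨rfl, h2⟩ := h
    rw [abs_le] at h2
    simp [h2.1, h2.2]
  · have : m i' k' = 0 := by by_contra hne; exact h (hm _ _ hne)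
    rw [this]
    symm
    refine Finset.sum_eq_zero fun k hk => ?_
    rw [Finset.mem_Icc] at hk
    rw [if_neg]
    rintro ⟨rfl, rfl⟩
    exact h ⟨rfl, abs_le.mpr hk⟩

theorem orbit_u_pow (c : 𝕜) (n : ℕ) : orbit q c (coord q c (u 𝕜) ^ n) = latSingle n n := by
  have h0 : q ≠ 0 := hq.ne_zero
  induction n with
  | zero => simpa using orbit_one q c
  | succ n ih =>
    rw [pow_succ', orbit_mul, ih, hypRep_coord, mulV₃_u]
    ext i k
    simp only [mulU, LinearMap.add_apply, Pi.add_apply, hop_apply, latSingle_apply]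
    have e1 : ((i + -1 = n ∧ k + -1 = n) ↔ (i = (n + 1 : ℕ) ∧ k = (n + 1 : ℕ))) := by
      push_cast; omega
    rw [if_congr e1 rfl rfl]
    have e2 : (if i + 1 = n ∧ k + -1 = n then (1 : 𝕜) else 0) = 0 ∨
        (q ^ i) ^ 2 * q ^ 4 - (q ^ k) ^ 2 = 0 := by
      by_cases h : i + 1 = n ∧ k + -1 = n
      · right
        obtain rfl : k = i + 2 := by omega
        rw [zpow_add₀ h0, zpow_ofNat]; ring
      · left; rw [if_neg h]
    have e3 : (kap q c (q ^ i) * (((q ^ i) ^ 2 * q ^ 4 - (q ^ k) ^ 2) *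
        ((q ^ i) ^ 2 * q ^ 2 - (q ^ k) ^ 2))) *
        (if i + 1 = n ∧ k + -1 = n then (1 : 𝕜) else 0) = 0 := by
      rcases e2 with e | e <;> simp [e]
    rw [e3, add_zero]
    split_ifs with h
    · rw [h.1, h.2]; field_simp
    · simp

theorem br_zpow_ne_zero {n : ℤ} (hn : n ≠ 0) : br q (q ^ n) ≠ 0 := by
  have h0 : q ≠ 0 := hq.ne_zero
  have h1 := IsGeneric.sq_sub_one_ne q
  have h2 := IsGeneric.sub_inv_ne q
  refine div_ne_zero (fun h => ?_) h2
  have h3 : q ^ n * q ^ n = 1 := by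
    rw [sub_eq_zero] at h
    nth_rewrite 2 [h]
    exact mul_inv_cancel₀ (zpow_ne_zero _ h0)
  rw [← zpow_add₀ h0] at h3
  exact IsGeneric.zpow_ne_one q (by omega) h3

theorem actY_latSingle (i k : ℤ) :
    actY q (latSingle i k) = br q (q ^ (i + k)) • latSingle i (k - 1) := by
  have h0 : q ≠ 0 := hq.ne_zero
  ext i' k'
  simp only [actY, hop_apply, latSingle_apply, Pi.smul_apply, smul_eq_mul]
  have e1 : (i' + 0 = i ∧ k' + 1 = k) ↔ (i' = i ∧ k' = k - 1) := by omega
  rw [if_congr e1 rfl rfl]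
  split_ifs with h
  · rw [h.1, h.2, zpow_add₀ h0, zpow_sub₀ h0]; field_simp
  · simp

/-- The component `V_i` of the quantum hyperboloid is the part of spin `i`. -/
theorem map_orbit_component (c : 𝕜) (n : ℕ) : (component q c n).map (orbit q c) = row 𝕜 n := by
  have key : ∀ h : Uq q, orbit q c (proj q c ((tensorAlgebraAct q
      (TensorAlgebra.ι 𝕜 (u 𝕜) ^ n)).ofConv h)) = latRep q h (latSingle n n) := by
    intro h
    rw [← orbit_u_pow q c, ← proj_ι, ← map_pow (proj q c)]
    exact orbit_proj_act q c h _
  apply le_antisymm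
  · rintro _ ⟨_, ⟨_, ⟨h, rfl⟩, rfl⟩, rfl⟩
    rw [AlgHom.toLinearMap_apply, key]
    exact latRep_mem_row q h (latSingle_mem_row (by simp))
  · have hmem : ∀ j : ℕ, j ≤ 2 * n → ∃ h : Uq q, latRep q h (latSingle n n) =
        latSingle n (n - j) := by
      intro j hj
      induction j with
      | zero => exact ⟨1, by simp⟩
      | succ j ih =>
        obtain ⟨h, hh⟩ := ih (by omega)
        have hne : br q (q ^ ((n : ℤ) + (n - j))) ≠ 0 := br_zpow_ne_zero q (by omega)
        refine ⟨(br q (q ^ ((n : ℤ) + (n - j))))⁻¹ • (Uq.of q .Y * h), ?_⟩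
        rw [map_smul, map_mul, LinearMap.smul_apply, Module.End.mul_apply, hh, latRep_of]
        change _ • actY q _ = _
        rw [actY_latSingle, smul_smul, inv_mul_cancel₀ hne, one_smul]
        congr 1; push_cast; ring
    intro m hm
    rw [eq_sum_of_mem_row hm]
    refine Submodule.sum_mem _ fun k hk => Submodule.smul_mem _ _ ?_
    rw [Finset.mem_Icc] at hk
    obtain ⟨h, hh⟩ := hmem (n - k).toNat (by omega)
    refine ⟨_, ⟨_, ⟨h, rfl⟩, rfl⟩, ?_⟩
    rw [AlgHom.toLinearMap_apply, key, hh]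
    congr 1; omega

theorem orbit_mem_iSup_row (c : 𝕜) (a : Hyp q c) : orbit q c a ∈ ⨆ i : ℤ, row 𝕜 i := by
  obtain ⟨t, rfl⟩ := proj_surjective q c a
  induction t using tensorAlgebra_induction_left with
  | h1 =>
    rw [map_one, orbit_one]
    exact Submodule.mem_iSup_of_mem 0 (latSingle_mem_row (by simp))
  | hsmul r t ht => rw [map_smul, map_smul]; exact Submodule.smul_mem _ _ ht
  | hadd s t hs ht => rw [map_add, map_add]; exact add_mem hs ht
  | hmul x t ht =>
    rw [map_mul, orbit_mul, proj_ι, hypRep_coord]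
    generalize orbit q c (proj q c t) = m at ht
    have hle : ∀ i : ℤ, row 𝕜 (i + 1) ⊔ row 𝕜 (i - 1) ≤ ⨆ i : ℤ, row 𝕜 i := fun i =>
      sup_le (le_iSup (row 𝕜) _) (le_iSup (row 𝕜) _)
    induction ht using Submodule.iSup_induction' with
    | mem i m hm =>
      rw [mulV₃_apply]
      exact add_mem (add_mem (Submodule.smul_mem _ _ (hle i (mulU_mem_row q c hm)))
        (Submodule.smul_mem _ _ (hle i (mulV_mem_row q c hm))))
        (Submodule.smul_mem _ _ (hle i (mulW_mem_row q c hm)))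
    | zero => rw [map_zero]; exact zero_mem _
    | add x y _ _ hx hy => rw [map_add]; exact add_mem hx hy

/-! ### Injectivity of the orbit map -/

/-- The monomials `u^k v^j` and `w^k v^j`. -/
noncomputable def mon (c : 𝕜) (p : ℤ × ℕ) : Hyp q c :=
  coord q c (u 𝕜) ^ p.1.toNat * coord q c (w 𝕜) ^ (-p.1).toNat * coord q c (v 𝕜) ^ p.2

/-- Since `uw` and `wu` are combinations of `1` and `v²`, the monomials `u^k v^j` and `w^k v^j` span
the quantum hyperboloid. -/
theorem coord_mul_coord (c : 𝕜) : ∃ α β β' : 𝕜,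
    coord q c (w 𝕜) * coord q c (u 𝕜) = α • 1 + β • (coord q c (v 𝕜) * coord q c (v 𝕜)) ∧
    coord q c (u 𝕜) * coord q c (w 𝕜) = α • 1 + β' • (coord q c (v 𝕜) * coord q c (v 𝕜)) := by
  obtain ⟨-, h2, -⟩ := coord_relations q c
  have h3 := coord_v₀ q c
  rw [Algebra.algebraMap_eq_smul_one] at h3
  have h0 : q ≠ 0 := hq.ne_zero
  have h1 := IsGeneric.sq_add_one_ne q
  generalize coord q c (u 𝕜) * coord q c (w 𝕜) = x at *
  generalize coord q c (w 𝕜) * coord q c (u 𝕜) = y at *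
  generalize coord q c (v 𝕜) * coord q c (v 𝕜) = z at *
  have hy : ((q ^ 2 + 1) ^ 2 / q) • y = c • 1 - q ^ 2 • z := by
    have : ((q ^ 2 + 1) ^ 2 / q) • y = ((q ^ 3 + q) • x + z + (q + q⁻¹) • y) -
      ((q ^ 3 + q) • (x - y) + (1 - q ^ 2) • z) - q ^ 2 • z := by
        match_scalars <;> field_simp <;> ring
    rw [this, h2, h3, sub_zero]
  have hne : (q ^ 2 + 1) ^ 2 / q ≠ 0 := by positivity
  have hy' : y = ((q ^ 2 + 1) ^ 2 / q)⁻¹ • (c • 1 - q ^ 2 • z) := by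
    rw [← hy, smul_smul, inv_mul_cancel₀ hne, one_smul]
  have hne' := IsGeneric.pow_three_add_ne q
  have hx : x = y - (q ^ 3 + q)⁻¹ • ((1 - q ^ 2) • z) := by
    have : (q ^ 3 + q)⁻¹ • ((q ^ 3 + q) • (x - y) + (1 - q ^ 2) • z) = 0 := by rw [h2, smul_zero]
    rw [smul_add, smul_smul, inv_mul_cancel₀ hne', one_smul] at this
    rw [← sub_eq_zero, ← this]; abel
  refine ⟨((q ^ 2 + 1) ^ 2 / q)⁻¹ * c, -((q ^ 2 + 1) ^ 2 / q)⁻¹ * q ^ 2,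
    -((q ^ 2 + 1) ^ 2 / q)⁻¹ * q ^ 2 - (q ^ 3 + q)⁻¹ * (1 - q ^ 2), ?_, ?_⟩
  · rw [hy']; module
  · rw [hx, hy']; module

theorem coord_v_mul_u_pow (c : 𝕜) (n : ℕ) : coord q c (v 𝕜) * coord q c (u 𝕜) ^ n =
    (q ^ 2) ^ n • (coord q c (u 𝕜) ^ n * coord q c (v 𝕜)) := by
  have h := (coord_relations q c).1
  rw [sub_eq_zero] at h
  induction n with
  | zero => simp
  | succ n ih =>
    rw [pow_succ, ← mul_assoc, ih, smul_mul_assoc, mul_assoc, ← h, mul_smul_comm, smul_smul,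
      ← mul_assoc, pow_succ (q ^ 2) n]

theorem coord_v_mul_w_pow (c : 𝕜) (n : ℕ) : coord q c (v 𝕜) * coord q c (w 𝕜) ^ n =
    (q⁻¹ ^ 2) ^ n • (coord q c (w 𝕜) ^ n * coord q c (v 𝕜)) := by
  have h0 : q ≠ 0 := hq.ne_zero
  have h := (coord_relations q c).2.2
  rw [sub_eq_zero] at h
  have h' : coord q c (v 𝕜) * coord q c (w 𝕜) = q⁻¹ ^ 2 • (coord q c (w 𝕜) * coord q c (v 𝕜)) := by
    rw [h, smul_smul, ← mul_pow, inv_mul_cancel₀ h0, one_pow, one_smul]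
  induction n with
  | zero => simp
  | succ n ih =>
    rw [pow_succ, ← mul_assoc, ih, smul_mul_assoc, mul_assoc, h', mul_smul_comm, smul_smul,
      ← mul_assoc, pow_succ (q⁻¹ ^ 2) n]

theorem u_pow_mem_span (c : 𝕜) (n j : ℕ) : coord q c (u 𝕜) ^ n * coord q c (v 𝕜) ^ j ∈
    Submodule.span 𝕜 (Set.range (mon q c)) :=
  Submodule.subset_span ⟨((n : ℤ), j), by simp [mon]⟩

theorem w_pow_mem_span (c : 𝕜) (n j : ℕ) : coord q c (w 𝕜) ^ n * coord q c (v 𝕜) ^ j ∈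
    Submodule.span 𝕜 (Set.range (mon q c)) :=
  Submodule.subset_span ⟨(-(n : ℤ), j), by simp [mon]⟩

theorem v_mul_mem_span (c : 𝕜) {a : Hyp q c} (ha : a ∈ Submodule.span 𝕜 (Set.range (mon q c))) :
    coord q c (v 𝕜) * a ∈ Submodule.span 𝕜 (Set.range (mon q c)) := by
  induction ha using Submodule.span_induction with
  | mem x hx =>
    obtain ⟨⟨k, j⟩, rfl⟩ := hx
    rcases le_total 0 k with hk | hk
    · have : (-k).toNat = 0 := by omega
      simp only [mon, this, pow_zero, mul_one]
      rw [← mul_assoc, coord_v_mul_u_pow, smul_mul_assoc, mul_assoc, ← pow_succ']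
      exact Submodule.smul_mem _ _ (u_pow_mem_span q c _ _)
    · have : k.toNat = 0 := by omega
      simp only [mon, this, pow_zero, one_mul]
      rw [← mul_assoc, coord_v_mul_w_pow, smul_mul_assoc, mul_assoc, ← pow_succ']
      exact Submodule.smul_mem _ _ (w_pow_mem_span q c _ _)
  | zero => rw [mul_zero]; exact zero_mem _
  | add x y _ _ hx hy => rw [mul_add]; exact add_mem hx hy
  | smul r x _ hx => rw [mul_smul_comm]; exact Submodule.smul_mem _ _ hx

theorem u_mul_mem_span (c : 𝕜) {a : Hyp q c} (ha : a ∈ Submodule.span 𝕜 (Set.range (mon q c))) :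
    coord q c (u 𝕜) * a ∈ Submodule.span 𝕜 (Set.range (mon q c)) := by
  induction ha using Submodule.span_induction with
  | mem x hx =>
    obtain ⟨⟨k, j⟩, rfl⟩ := hx
    rcases le_or_gt 0 k with hk | hk
    · have : (-k).toNat = 0 := by omega
      simp only [mon, this, pow_zero, mul_one]
      rw [← mul_assoc, ← pow_succ']
      exact u_pow_mem_span q c _ _
    · have : k.toNat = 0 := by omega
      obtain ⟨n, hn⟩ : ∃ n, (-k).toNat = n + 1 := ⟨(-k).toNat - 1, by omega⟩
      simp only [mon, this, hn, pow_zero, one_mul]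
      obtain ⟨α, β, β', -, h⟩ := coord_mul_coord q c
      rw [pow_succ', ← mul_assoc, ← mul_assoc, h, mul_assoc, add_mul, smul_mul_assoc,
        smul_mul_assoc, one_mul, mul_assoc]
      have := w_pow_mem_span q c n j
      exact add_mem (Submodule.smul_mem _ _ this)
        (Submodule.smul_mem _ _ (v_mul_mem_span q c (v_mul_mem_span q c this)))
  | zero => rw [mul_zero]; exact zero_mem _
  | add x y _ _ hx hy => rw [mul_add]; exact add_mem hx hy
  | smul r x _ hx => rw [mul_smul_comm]; exact Submodule.smul_mem _ _ hx

theorem w_mul_mem_span (c : 𝕜) {a : Hyp q c} (ha : a ∈ Submodule.span 𝕜 (Set.range (mon q c))) :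
    coord q c (w 𝕜) * a ∈ Submodule.span 𝕜 (Set.range (mon q c)) := by
  induction ha using Submodule.span_induction with
  | mem x hx =>
    obtain ⟨⟨k, j⟩, rfl⟩ := hx
    rcases le_or_gt k 0 with hk | hk
    · have : k.toNat = 0 := by omega
      simp only [mon, this, pow_zero, one_mul]
      rw [← mul_assoc, ← pow_succ']
      exact w_pow_mem_span q c _ _
    · have : (-k).toNat = 0 := by omega
      obtain ⟨n, hn⟩ : ∃ n, k.toNat = n + 1 := ⟨k.toNat - 1, by omega⟩
      simp only [mon, this, hn, pow_zero, mul_one]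
      obtain ⟨α, β, β', h, -⟩ := coord_mul_coord q c
      rw [pow_succ', ← mul_assoc, ← mul_assoc, h, mul_assoc, add_mul, smul_mul_assoc,
        smul_mul_assoc, one_mul, mul_assoc]
      have := u_pow_mem_span q c n j
      exact add_mem (Submodule.smul_mem _ _ this)
        (Submodule.smul_mem _ _ (v_mul_mem_span q c (v_mul_mem_span q c this)))
  | zero => rw [mul_zero]; exact zero_mem _
  | add x y _ _ hx hy => rw [mul_add]; exact add_mem hx hy
  | smul r x _ hx => rw [mul_smul_comm]; exact Submodule.smul_mem _ _ hx

theorem span_mon (c : 𝕜) : Submodule.span 𝕜 (Set.range (mon q c)) = ⊤ := by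
  rw [eq_top_iff]
  rintro a -
  obtain ⟨t, rfl⟩ := proj_surjective q c a
  induction t using tensorAlgebra_induction_left with
  | h1 => simpa using u_pow_mem_span q c 0 0
  | hsmul r t ht => rw [map_smul]; exact Submodule.smul_mem _ _ ht
  | hadd s t hs ht => rw [map_add]; exact add_mem hs ht
  | hmul x t ht =>
    rw [map_mul, proj_ι, vec_eq x, map_add, map_add, map_smul, map_smul, map_smul, add_mul,
      add_mul, smul_mul_assoc, smul_mul_assoc, smul_mul_assoc]
    exact add_mem (add_mem (Submodule.smul_mem _ _ (u_mul_mem_span q c ht))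
      (Submodule.smul_mem _ _ (v_mul_mem_span q c ht)))
      (Submodule.smul_mem _ _ (w_mul_mem_span q c ht))

/-- The images of the monomials have different leading positions `(|k| + j, k)`. -/
theorem hasLead_orbit_mon (c : 𝕜) (p : ℤ × ℕ) :
    HasLead (|p.1| + p.2) p.1 (orbit q c (mon q c p)) := by
  have h0 : q ≠ 0 := hq.ne_zero
  have h1 := IsGeneric.sq_add_one_ne q
  have hs := IsGeneric.add_inv_ne q
  have hz : ∀ i : ℤ, q ^ i ≠ 0 := fun i => zpow_ne_zero _ h0
  have hV : ∀ j : ℕ, HasLead (j : ℤ) 0 (orbit q c (coord q c (v 𝕜) ^ j)) := by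
    intro j
    induction j with
    | zero =>
      rw [pow_zero, orbit_one]
      refine ⟨by simp [latSingle_apply], fun i k' h => ?_⟩
      rw [latSingle_apply] at h
      split_ifs at h with h'
      · exact ⟨h'.2, by simp [h'.1]⟩
      · exact absurd rfl h
    | succ j ih =>
      rw [pow_succ', orbit_mul, hypRep_coord, mulV₃_v]
      have : HasLead ((j : ℤ) + 1) (0 - 0) (mulV q c (orbit q c (coord q c (v 𝕜) ^ j))) :=
        ih.hop_add_hop q (b := 0) (f := fun a b => -(q + q⁻¹) * (b * q / a))
          (fun i k => mul_ne_zero (neg_ne_zero.mpr hs) (div_ne_zero (mul_ne_zero (hz _) h0) (hz _)))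
      simpa using! this
  have hW : ∀ n j : ℕ, HasLead (n + j : ℤ) (-n)
      (orbit q c (coord q c (w 𝕜) ^ n * coord q c (v 𝕜) ^ j)) := by
    intro n j
    induction n with
    | zero => simpa using hV j
    | succ n ih =>
      rw [pow_succ', mul_assoc, orbit_mul, hypRep_coord, mulV₃_w, mulW]
      rw [show ((n + 1 : ℕ) + j : ℤ) = n + j + 1 by push_cast; ring,
        show (-(n + 1 : ℕ) : ℤ) = -n - 1 by push_cast; ring]
      exact ih.hop_add_hop q (b := 1) (f := fun _ _ => -1) (fun i k => by simp)
  have hU : ∀ n j : ℕ, HasLead (n + j : ℤ) n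
      (orbit q c (coord q c (u 𝕜) ^ n * coord q c (v 𝕜) ^ j)) := by
    intro n j
    induction n with
    | zero => simpa using hV j
    | succ n ih =>
      rw [pow_succ', mul_assoc, orbit_mul, hypRep_coord, mulV₃_u, mulU]
      rw [show ((n + 1 : ℕ) + j : ℤ) = n + j + 1 by push_cast; ring,
        show ((n + 1 : ℕ) : ℤ) = n - -1 by push_cast; ring]
      exact ih.hop_add_hop q (b := -1) (f := fun a b => b ^ 2 / a ^ 2)
        (fun i k => div_ne_zero (pow_ne_zero _ (hz _)) (pow_ne_zero _ (hz _)))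
  obtain ⟨k, j⟩ := p
  rcases le_total 0 k with hk | hk
  · lift k to ℕ using hk
    simpa [mon] using hU k j
  · obtain ⟨n, rfl⟩ : ∃ n : ℕ, k = -(n : ℤ) := ⟨(-k).toNat, by omega⟩
    simpa [mon] using hW n j

/-- The quantum hyperboloid embeds in the lattice, because the images of the spanning monomials are
linearly independent. -/
theorem orbit_injective (c : 𝕜) : Function.Injective (orbit q c) := by
  rw [← LinearMap.ker_eq_bot, LinearMap.ker_eq_bot']
  intro a ha
  have hmem : a ∈ Submodule.span 𝕜 (Set.range (mon q c)) := by rw [span_mon]; trivial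
  obtain ⟨l, rfl⟩ := (Finsupp.mem_span_range_iff_exists_finsupp).mp hmem
  suffices l = 0 by subst this; simp
  by_contra hl
  obtain ⟨p, hp, hmax⟩ := Finset.exists_max_image l.support (fun p => |p.1| + (p.2 : ℤ))
    (Finsupp.support_nonempty_iff.mpr hl)
  rw [Finsupp.sum, map_sum] at ha
  have hval := congrFun (congrFun ha (|p.1| + p.2)) p.1
  rw [Finset.sum_apply, Finset.sum_apply, Finset.sum_eq_single p] at hval
  · simp only [map_smul, Pi.smul_apply, smul_eq_mul, Pi.zero_apply, mul_eq_zero] at hval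
    rcases hval with h | h
    · exact (Finsupp.mem_support_iff.mp hp) h
    · exact (hasLead_orbit_mon q c p).1 h
  · intro p' hp' hne
    rw [map_smul, Pi.smul_apply, Pi.smul_apply, smul_eq_mul]
    apply mul_eq_zero_of_right
    by_contra h
    obtain ⟨h1, h2⟩ := (hasLead_orbit_mon q c p').2 _ _ h
    have h3 := hmax p' hp'
    apply hne
    ext
    · exact h1.symm
    · rw [← h1] at h2 h3
      omega
  · intro h; exact absurd hp h

/-- The quantum hyperboloid is spanned by its components. -/
theorem iSup_component (c : 𝕜) : ⨆ n : ℕ, component q c n = ⊤ := by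
  rw [eq_top_iff]
  rintro a -
  have h : orbit q c a ∈ (⨆ n : ℕ, component q c n).map (orbit q c) := by
    rw [Submodule.map_iSup]
    refine (iSup_le fun i => ?_ : ⨆ i : ℤ, row 𝕜 i ≤ _) (orbit_mem_iSup_row q c a)
    rcases lt_or_ge i 0 with hi | hi
    · intro m hm
      have : m = 0 := by
        ext i' k
        by_contra h
        have := (hm i' k h).2
        have := abs_nonneg k
        omega
      rw [this]; exact zero_mem _
    · lift i to ℕ using hi
      rw [← map_orbit_component q c]
      exact le_iSup (fun n => (component q c n).map (orbit q c)) i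
  obtain ⟨b, hb, hab⟩ := h
  rwa [← orbit_injective q c hab]

end

/-! ### Braided Lie brackets -/

section
variable {𝕜 : Type*} [Field 𝕜] (q : 𝕜) [hq : IsGeneric q]

/-- The braided Lie bracket on `V` is unique up to a factor. -/
theorem IsBraidedBracket.exists_eq {B : V 𝕜 ⊗[𝕜] V 𝕜 →ₗ[𝕜] V 𝕜} (hB : IsBraidedBracket q B) :
    ∃ g : 𝕜, g ≠ 0 ∧ ∀ x z : V 𝕜, qad B x z =
      ![g * (q + q⁻¹) * (q⁻¹ ^ 2 * (x 1 * z 0) - x 0 * z 1),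
        g * (q⁻¹ ^ 2 * (x 0 * z 2) - q⁻¹ * (q + q⁻¹) * (q - q⁻¹) * (x 1 * z 1) -
          q⁻¹ ^ 2 * (x 2 * z 0)),
        g * (q + q⁻¹) * (q⁻¹ ^ 2 * (x 2 * z 1) - x 1 * z 2)] := by
  have h0 : q ≠ 0 := hq.ne_zero
  have hs := IsGeneric.add_inv_ne q
  have h1 := IsGeneric.sq_sub_one_ne q
  have h1' := IsGeneric.sq_add_one_ne q
  have h2 : q ^ 4 - 1 ≠ 0 := sub_ne_zero.mpr (hq.pow_ne_one 4 (by norm_num))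
  have h6 : q ^ 6 - 1 ≠ 0 := sub_ne_zero.mpr (hq.pow_ne_one 6 (by norm_num))
  have hK : ∀ x y, B (spinOne q (Uq.of q .K) x ⊗ₜ spinOne q (Uq.of q .K) y) =
      spinOne q (Uq.of q .K) (B (x ⊗ₜ y)) := fun x y => by
    rw [← hB.equivariant, tensorRep_K]
  have hX : ∀ x y, B (spinOne q (Uq.of q .X) x ⊗ₜ y) +
      B (spinOne q (Uq.of q .Kinv) x ⊗ₜ spinOne q (Uq.of q .X) y) =
      spinOne q (Uq.of q .X) (B (x ⊗ₜ y)) := fun x y => by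
    rw [← hB.equivariant, tensorRep_X, map_add]
  have hY : ∀ x y, B (x ⊗ₜ spinOne q (Uq.of q .Y) y) +
      B (spinOne q (Uq.of q .Y) x ⊗ₜ spinOne q (Uq.of q .K) y) =
      spinOne q (Uq.of q .Y) (B (x ⊗ₜ y)) := fun x y => by
    rw [← hB.equivariant, tensorRep_Y, map_add]
  -- the bracket preserves weights
  have huu : B (u 𝕜 ⊗ₜ u 𝕜) = 0 := by
    have h := hK (u 𝕜) (u 𝕜)
    rw [spinOne_K_u, spinOne_K, TensorProduct.tmul_smul, ← TensorProduct.smul_tmul', smul_smul,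
      map_smul] at h
    have e0 := congrFun h 0
    have e1 := congrFun h 1
    have e2 := congrFun h 2
    simp only [Pi.smul_apply, smul_eq_mul, Matrix.cons_val_zero, Matrix.cons_val_one,
      Matrix.cons_val] at e0 e1 e2
    ext i
    fin_cases i
    · change B (u 𝕜 ⊗ₜ u 𝕜) 0 = 0
      refine (mul_eq_zero.mp (?_ : q ^ 2 * (q ^ 2 - 1) * _ = 0)).resolve_left
        (mul_ne_zero (pow_ne_zero 2 h0) h1)
      linear_combination e0
    · change B (u 𝕜 ⊗ₜ u 𝕜) 1 = 0
      refine (mul_eq_zero.mp (?_ : (q ^ 4 - 1) * _ = 0)).resolve_left h2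
      linear_combination e1
    · change B (u 𝕜 ⊗ₜ u 𝕜) 2 = 0
      refine (mul_eq_zero.mp (?_ : (q ^ 6 - 1) * _ = 0)).resolve_left h6
      field_simp at e2
      linear_combination e2
  obtain ⟨y, huv⟩ : ∃ y : 𝕜, B (u 𝕜 ⊗ₜ v 𝕜) = y • u 𝕜 := by
    have h := hK (u 𝕜) (v 𝕜)
    rw [spinOne_K_u, spinOne_K_v, spinOne_K, ← TensorProduct.smul_tmul', map_smul] at h
    have e1 := congrFun h 1
    have e2 := congrFun h 2
    simp only [Pi.smul_apply, smul_eq_mul, Matrix.cons_val_zero, Matrix.cons_val_one,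
      Matrix.cons_val] at e1 e2
    refine ⟨B (u 𝕜 ⊗ₜ v 𝕜) 0, ?_⟩
    ext i
    fin_cases i
    · simp
    · simp only [Pi.smul_apply, smul_eq_mul]
      simp
      refine (mul_eq_zero.mp (?_ : (q ^ 2 - 1) * _ = 0)).resolve_left h1
      linear_combination e1
    · simp
      refine (mul_eq_zero.mp (?_ : (q ^ 4 - 1) * _ = 0)).resolve_left h2
      field_simp at e2
      linear_combination e2
  obtain ⟨a, huw⟩ : ∃ a : 𝕜, B (u 𝕜 ⊗ₜ w 𝕜) = a • v 𝕜 := by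
    have h := hK (u 𝕜) (w 𝕜)
    rw [spinOne_K_u, spinOne_K_w, spinOne_K, TensorProduct.tmul_smul, ← TensorProduct.smul_tmul',
      smul_smul, map_smul] at h
    have e0 := congrFun h 0
    have e2 := congrFun h 2
    simp only [Pi.smul_apply, smul_eq_mul, Matrix.cons_val_zero, Matrix.cons_val_one,
      Matrix.cons_val] at e0 e2
    refine ⟨B (u 𝕜 ⊗ₜ w 𝕜) 1, ?_⟩
    ext i
    fin_cases i
    · simp
      refine (mul_eq_zero.mp (?_ : (q ^ 2 - 1) * _ = 0)).resolve_left h1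
      field_simp at e0
      linear_combination -e0
    · simp
    · simp
      refine (mul_eq_zero.mp (?_ : (q ^ 2 - 1) * _ = 0)).resolve_left h1
      field_simp at e2
      linear_combination e2
  have hvu : B (v 𝕜 ⊗ₜ u 𝕜) = (-q⁻¹ ^ 2 * y) • u 𝕜 := by
    have h := hY (u 𝕜) (u 𝕜)
    rw [spinOne_Y_u, spinOne_K_u, huu, map_zero, TensorProduct.tmul_neg, TensorProduct.neg_tmul,
      TensorProduct.tmul_smul, map_neg, map_neg, map_smul, huv] at h
    have : B (v 𝕜 ⊗ₜ u 𝕜) = -q⁻¹ ^ 2 • (y • u 𝕜) +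
        (-q⁻¹ ^ 2) • (-(y • u 𝕜) + -(q ^ 2 • B (v 𝕜 ⊗ₜ u 𝕜))) := by
      match_scalars <;> field_simp
      ring
    rw [this, h]; module
  have ha : a = -q⁻¹ ^ 2 * y / (q + q⁻¹) := by
    have h := hX (u 𝕜) (w 𝕜)
    rw [spinOne_X_u, spinOne_X_w, spinOne_Kinv_u, huw, map_smul, spinOne_X_v,
      TensorProduct.zero_tmul, map_zero, zero_add, ← TensorProduct.smul_tmul', map_smul, huv] at h
    have e0 := congrFun h 0
    simp at e0
    rw [eq_div_iff hs]
    simp only [inv_pow]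
    linear_combination e0
  have hvv : B (v 𝕜 ⊗ₜ v 𝕜) = ((q + q⁻¹) * a + y) • v 𝕜 := by
    have h := hY (u 𝕜) (v 𝕜)
    rw [spinOne_Y_u, spinOne_Y_v, spinOne_K_v, huv, map_smul, spinOne_Y_u, TensorProduct.tmul_smul,
      map_smul, huw, TensorProduct.neg_tmul, map_neg] at h
    have : B (v 𝕜 ⊗ₜ v 𝕜) = (q + q⁻¹) • (a • v 𝕜) -
      ((q + q⁻¹) • (a • v 𝕜) + -(B (v 𝕜 ⊗ₜ v 𝕜))) := by abel
    rw [this, h]; module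
  have hwu : B (w 𝕜 ⊗ₜ u 𝕜) = (q⁻¹ ^ 2 * y / (q + q⁻¹)) • v 𝕜 := by
    have h := hY (v 𝕜) (u 𝕜)
    rw [spinOne_Y_u, spinOne_Y_v, spinOne_K_u, hvu, map_smul, spinOne_Y_u, TensorProduct.tmul_smul,
      map_smul, ← TensorProduct.smul_tmul', map_smul, TensorProduct.tmul_neg, map_neg, hvv] at h
    have : B (w 𝕜 ⊗ₜ u 𝕜) = (q⁻¹ ^ 2 / (q + q⁻¹)) • ((-(((q + q⁻¹) * a + y) • v 𝕜) +
      q ^ 2 • (q + q⁻¹) • B (w 𝕜 ⊗ₜ u 𝕜)) + ((q + q⁻¹) * a + y) • v 𝕜) := by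
      rw [neg_add_cancel_comm, smul_smul, smul_smul,
        show q⁻¹ ^ 2 / (q + q⁻¹) * q ^ 2 * (q + q⁻¹) = 1 by field_simp, one_smul]
    rw [this, h, ha]
    match_scalars
    field_simp
    ring
  have hvw : B (v 𝕜 ⊗ₜ w 𝕜) = y • w 𝕜 := by
    have h := hY (u 𝕜) (w 𝕜)
    rw [spinOne_Y_u, spinOne_Y_w, spinOne_K_w, huw, map_smul, spinOne_Y_v, TensorProduct.tmul_smul,
      TensorProduct.tmul_zero, map_zero, zero_add, map_smul, TensorProduct.neg_tmul, map_neg] at h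
    have : B (v 𝕜 ⊗ₜ w 𝕜) = -q ^ 2 • (q⁻¹ ^ 2 • (-B (v 𝕜 ⊗ₜ w 𝕜))) := by
      match_scalars; field_simp
    rw [this, h, ha]
    match_scalars
    field_simp
  have hwv : B (w 𝕜 ⊗ₜ v 𝕜) = (-q⁻¹ ^ 2 * y) • w 𝕜 := by
    have h := hY (w 𝕜) (u 𝕜)
    rw [spinOne_Y_u, spinOne_Y_w, spinOne_K_u, hwu, map_smul, spinOne_Y_v, TensorProduct.zero_tmul,
      map_zero, add_zero, TensorProduct.tmul_neg, map_neg] at h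
    rw [← neg_neg (B (w 𝕜 ⊗ₜ v 𝕜)), h]
    match_scalars
    field_simp
  have hww : B (w 𝕜 ⊗ₜ w 𝕜) = 0 := by
    have h := hY (v 𝕜) (w 𝕜)
    rw [spinOne_Y_w, spinOne_Y_v, spinOne_K_w, hvw, map_smul, spinOne_Y_w, TensorProduct.tmul_smul,
      TensorProduct.tmul_zero, map_zero, zero_add, map_smul, ← TensorProduct.smul_tmul', map_smul,
      smul_zero] at h
    have := (smul_eq_zero.mp h).resolve_left (pow_ne_zero 2 (inv_ne_zero h0))
    exact (smul_eq_zero.mp this).resolve_left hs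
  have hform : ∀ x z : V 𝕜, qad B x z =
      ![-y / (q + q⁻¹) * (q + q⁻¹) * (q⁻¹ ^ 2 * (x 1 * z 0) - x 0 * z 1),
        -y / (q + q⁻¹) * (q⁻¹ ^ 2 * (x 0 * z 2) - q⁻¹ * (q + q⁻¹) * (q - q⁻¹) * (x 1 * z 1) -
          q⁻¹ ^ 2 * (x 2 * z 0)),
        -y / (q + q⁻¹) * (q + q⁻¹) * (q⁻¹ ^ 2 * (x 2 * z 1) - x 1 * z 2)] := by
    intro x z
    rw [qad, TensorProduct.curry_apply, vec_eq x, vec_eq z]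
    simp only [TensorProduct.add_tmul, TensorProduct.tmul_add, TensorProduct.tmul_smul,
      ← TensorProduct.smul_tmul', map_add, map_smul, huu, huv, huw, hvu, hvv, hvw, hwu, hwv, hww,
      ha]
    ext i
    fin_cases i
    · simp; field_simp; ring
    · simp; field_simp; ring
    · simp; field_simp; ring
  refine ⟨-y / (q + q⁻¹), ?_, hform⟩
  intro hg
  apply hB.ne_zero
  apply TensorProduct.ext'
  intro x z
  have := hform x z
  rw [hg, qad, TensorProduct.curry_apply] at this
  rw [this]
  ext i
  fin_cases i <;> simp

/-- The constant for which the `q`-adjoint operators are a representation. -/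
theorem isRep_qad_iff {B : V 𝕜 ⊗[𝕜] V 𝕜 →ₗ[𝕜] V 𝕜} {g : 𝕜} (hg : g ≠ 0)
    (hB : ∀ x z : V 𝕜, qad B x z =
      ![g * (q + q⁻¹) * (q⁻¹ ^ 2 * (x 1 * z 0) - x 0 * z 1),
        g * (q⁻¹ ^ 2 * (x 0 * z 2) - q⁻¹ * (q + q⁻¹) * (q - q⁻¹) * (x 1 * z 1) -
          q⁻¹ ^ 2 * (x 2 * z 0)),
        g * (q + q⁻¹) * (q⁻¹ ^ 2 * (x 2 * z 1) - x 1 * z 2)]) (ħ : 𝕜) :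
    IsRep q ħ (qad B) ↔ ħ = -g * (q ^ 3 + q⁻¹ ^ 3) := by
  have h0 : q ≠ 0 := hq.ne_zero
  have hs := IsGeneric.add_inv_ne q
  have h1 := IsGeneric.sq_add_one_ne q
  rw [isRep_iff]
  constructor
  · intro h
    have e := congrFun (LinearMap.congr_fun h.rel_u (v 𝕜)) 0
    simp [hB] at e
    have h2 : g * (q + q⁻¹) ≠ 0 := mul_ne_zero hg hs
    apply mul_left_cancel₀ h2
    field_simp at e ⊢
    linear_combination e
  · rintro rfl
    constructor <;>
    · ext1 z
      ext i
      fin_cases i <;> simp [hB] <;> field_simp <;> ring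

end

/-! ### The `q`-adjoint operators on the hyperboloid -/

section
variable {𝕜 : Type*} [Field 𝕜] (q : 𝕜) [hq : IsGeneric q]

theorem adU_mem_row (ħ : 𝕜) {i : ℤ} {m : Lat 𝕜} (hm : m ∈ row 𝕜 i) : adU q ħ m ∈ row 𝕜 i := by
  have h0 : q ≠ 0 := hq.ne_zero
  refine hop_mem_row q (by ring) (fun k hk hf => ?_) hm
  have h1 : k ≠ i + 1 := by
    have ha : q ^ i ≠ 0 := zpow_ne_zero _ h0
    rintro rfl; apply hf; rw [zpow_add₀ h0, zpow_one, div_self (mul_ne_zero ha h0)]; simp [br]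
  rw [abs_le] at *; omega

theorem adV_mem_row (ħ : 𝕜) {i : ℤ} {m : Lat 𝕜} (hm : m ∈ row 𝕜 i) : adV q ħ m ∈ row 𝕜 i :=
  hop_mem_row q (by ring) (fun k hk _ => by simpa using hk) hm

theorem adW_mem_row (ħ : 𝕜) {i : ℤ} {m : Lat 𝕜} (hm : m ∈ row 𝕜 i) : adW q ħ m ∈ row 𝕜 i := by
  have h0 : q ≠ 0 := hq.ne_zero
  refine hop_mem_row q (by ring) (fun k hk hf => ?_) hm
  have h1 : k ≠ -i - 1 := by
    rintro rfl; apply hf; rw [zpow_sub₀ h0, zpow_neg, zpow_one]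
    have ha : q ^ i ≠ 0 := zpow_ne_zero _ h0
    rw [show q ^ i * ((q ^ i)⁻¹ / q) * q = 1 by field_simp]; simp [br]
  rw [abs_le] at *; omega

theorem exists_orbit_eq (c : 𝕜) {f : Module.End 𝕜 (Lat 𝕜)}
    (hf : ∀ i : ℤ, ∀ m ∈ row 𝕜 i, f m ∈ row 𝕜 i) (a : Hyp q c) :
    ∃ b, orbit q c b = f (orbit q c a) := by
  have ha : a ∈ ⨆ n : ℕ, component q c n := by rw [iSup_component]; trivial
  induction ha using Submodule.iSup_induction' with
  | mem n a ha =>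
    have h := hf n (orbit q c a) (by rw [← map_orbit_component q c]; exact ⟨a, ha, rfl⟩)
    rw [← map_orbit_component q c] at h
    obtain ⟨b, -, hb⟩ := h
    exact ⟨b, hb⟩
  | zero => exact ⟨0, by simp⟩
  | add a b _ _ ha hb =>
    obtain ⟨a', ha'⟩ := ha
    obtain ⟨b', hb'⟩ := hb
    exact ⟨a' + b', by rw [map_add, map_add, map_add, ha', hb']⟩

/-- The operator on the hyperboloid corresponding to an operator on `Lat 𝕜` that preserves all
rows. -/
noncomputable def pull (c : 𝕜) (f : Module.End 𝕜 (Lat 𝕜))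
    (hf : ∀ i : ℤ, ∀ m ∈ row 𝕜 i, f m ∈ row 𝕜 i) : Module.End 𝕜 (Hyp q c) :=
  (LinearEquiv.ofInjective (orbit q c) (orbit_injective q c)).symm.toLinearMap ∘ₗ
    (f ∘ₗ orbit q c).codRestrict (LinearMap.range (orbit q c)) (exists_orbit_eq q c hf)

theorem orbit_pull (c : 𝕜) (f : Module.End 𝕜 (Lat 𝕜))
    (hf : ∀ i : ℤ, ∀ m ∈ row 𝕜 i, f m ∈ row 𝕜 i) (a : Hyp q c) :
    orbit q c (pull q c f hf a) = f (orbit q c a) := by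
  have := LinearEquiv.ofInjective_symm_apply (f := orbit q c) (h := orbit_injective q c)
    ((f ∘ₗ orbit q c).codRestrict (LinearMap.range (orbit q c)) (exists_orbit_eq q c hf) a)
  exact this

/-- The `q`-adjoint operators, extended to the hyperboloid. -/
noncomputable def hypAd (ħ c : 𝕜) : V 𝕜 →ₗ[𝕜] Module.End 𝕜 (Hyp q c) :=
  (LinearMap.proj 0 : V 𝕜 →ₗ[𝕜] 𝕜).smulRight (pull q c (adU q ħ) fun _ _ => adU_mem_row q ħ) +
  (LinearMap.proj 1 : V 𝕜 →ₗ[𝕜] 𝕜).smulRight (pull q c (adV q ħ) fun _ _ => adV_mem_row q ħ) +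
  (LinearMap.proj 2 : V 𝕜 →ₗ[𝕜] 𝕜).smulRight (pull q c (adW q ħ) fun _ _ => adW_mem_row q ħ)

theorem orbit_hypAd (ħ c : 𝕜) (x : V 𝕜) (a : Hyp q c) : orbit q c (hypAd q ħ c x a) =
    x 0 • adU q ħ (orbit q c a) + x 1 • adV q ħ (orbit q c a) + x 2 • adW q ħ (orbit q c a) := by
  simp [hypAd, orbit_pull]

theorem orbit_hypAd_u (ħ c : 𝕜) (a : Hyp q c) :
    orbit q c (hypAd q ħ c (u 𝕜) a) = adU q ħ (orbit q c a) := by simp [orbit_hypAd]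
theorem orbit_hypAd_v (ħ c : 𝕜) (a : Hyp q c) :
    orbit q c (hypAd q ħ c (v 𝕜) a) = adV q ħ (orbit q c a) := by simp [orbit_hypAd]
theorem orbit_hypAd_w (ħ c : 𝕜) (a : Hyp q c) :
    orbit q c (hypAd q ħ c (w 𝕜) a) = adW q ħ (orbit q c a) := by simp [orbit_hypAd]

theorem orbit_coord_mul (c : 𝕜) (x : V 𝕜) (a : Hyp q c) :
    orbit q c (coord q c x * a) = mulV₃ q c x (orbit q c a) := by
  rw [orbit_mul, hypRep_coord]

theorem isRep_hypAd (ħ c : 𝕜) : IsRep q ħ (hypAd q ħ c) := by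
  rw [isRep_iff]
  have h := envRel_ad q ħ
  constructor
  · ext1 a
    apply orbit_injective q c
    have := LinearMap.congr_fun h.rel_u (orbit q c a)
    simpa [orbit_hypAd_u, orbit_hypAd_v, orbit_hypAd_w] using this
  · ext1 a
    apply orbit_injective q c
    have := LinearMap.congr_fun h.rel_v (orbit q c a)
    simpa [orbit_hypAd_u, orbit_hypAd_v, orbit_hypAd_w] using this
  · ext1 a
    apply orbit_injective q c
    have := LinearMap.congr_fun h.rel_w (orbit q c a)
    simpa [orbit_hypAd_u, orbit_hypAd_v, orbit_hypAd_w] using this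

theorem coord_mul_hypAd (ħ c : 𝕜) (a : Hyp q c) :
    (q ^ 3 + q) • (coord q c (u 𝕜) * hypAd q ħ c (w 𝕜) a) +
      coord q c (v 𝕜) * hypAd q ħ c (v 𝕜) a +
      (q + q⁻¹) • (coord q c (w 𝕜) * hypAd q ħ c (u 𝕜) a) = 0 := by
  apply orbit_injective q c
  have := LinearMap.congr_fun (mul_ad_v₀ q c ħ) (orbit q c a)
  simpa [orbit_hypAd_u, orbit_hypAd_v, orbit_hypAd_w, orbit_coord_mul] using this

theorem hypAd_mem_component (ħ c : 𝕜) (n : ℕ) (x : V 𝕜) {a : Hyp q c}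
    (ha : a ∈ component q c n) : hypAd q ħ c x a ∈ component q c n := by
  have h : orbit q c a ∈ row 𝕜 n := by rw [← map_orbit_component q c]; exact ⟨a, ha, rfl⟩
  have h2 : orbit q c (hypAd q ħ c x a) ∈ row 𝕜 n := by
    rw [orbit_hypAd]
    exact add_mem (add_mem (Submodule.smul_mem _ _ (adU_mem_row q ħ h))
      (Submodule.smul_mem _ _ (adV_mem_row q ħ h))) (Submodule.smul_mem _ _ (adW_mem_row q ħ h))
  rw [← map_orbit_component q c] at h2
  obtain ⟨b, hb, hab⟩ := h2
  rwa [← orbit_injective q c hab]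

theorem hypAd_one (ħ c : 𝕜) (x : V 𝕜) : hypAd q ħ c x 1 = 0 := by
  have h0 : q ≠ 0 := hq.ne_zero
  apply orbit_injective q c
  rw [orbit_hypAd, orbit_one, map_zero]
  have hU : adU q ħ (latSingle 0 0) = 0 := by
    ext i k
    simp only [adU, hop_apply, latSingle_apply, Pi.zero_apply]
    split_ifs with h
    · obtain rfl : i = 0 := by omega
      obtain rfl : k = 1 := by omega
      simp [br, h0]
    · simp
  have hV : adV q ħ (latSingle 0 0) = 0 := by
    ext i k
    simp only [adV, hop_apply, latSingle_apply, Pi.zero_apply]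
    split_ifs with h
    · obtain rfl : i = 0 := by omega
      obtain rfl : k = 0 := by omega
      simp
    · simp
  have hW : adW q ħ (latSingle 0 0) = 0 := by
    ext i k
    simp only [adW, hop_apply, latSingle_apply, Pi.zero_apply]
    split_ifs with h
    · obtain rfl : i = 0 := by omega
      obtain rfl : k = -1 := by omega
      simp [br, h0]
    · simp
  simp [hU, hV, hW]

theorem orbit_coord (c : 𝕜) (z : V 𝕜) : orbit q c (coord q c z) =
    z 0 • latSingle 1 1 - ((q + q⁻¹) * z 1) • latSingle 1 0 - z 2 • latSingle 1 (-1) := by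
  have h0 : q ≠ 0 := hq.ne_zero
  have hU : mulU q c (latSingle 0 0) = latSingle 1 1 := by
    have := orbit_u_pow q c 1
    rwa [pow_one, ← mul_one (coord q c (u 𝕜)), orbit_coord_mul, mulV₃_u, orbit_one] at this
  have hV : mulV q c (latSingle 0 0) = -(q + q⁻¹) • latSingle 1 0 := by
    ext i k
    simp only [mulV, hop_apply, LinearMap.add_apply, Pi.add_apply, latSingle_apply, Pi.smul_apply]
    by_cases h1 : i = 1 ∧ k = 0
    · obtain ⟨rfl, rfl⟩ := h1; simp [h0]
    · rw [if_neg (by omega), if_neg h1]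
      split_ifs with h
      · obtain rfl : i = -1 := by omega
        obtain rfl : k = 0 := by omega
        simp [h0]
      · simp
  have hW : mulW q c (latSingle 0 0) = -latSingle 1 (-1) := by
    ext i k
    simp only [mulW, hop_apply, LinearMap.add_apply, Pi.add_apply, latSingle_apply, Pi.neg_apply]
    by_cases h1 : i = 1 ∧ k = -1
    · obtain ⟨rfl, rfl⟩ := h1; simp
    · rw [if_neg (by omega), if_neg h1]
      split_ifs with h
      · obtain rfl : i = -1 := by omega
        obtain rfl : k = -1 := by omega
        have hz : (q ^ (-1 : ℤ)) ^ 2 * (q ^ (-1 : ℤ)) ^ 2 * q ^ 4 - 1 = 0 := by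
          rw [zpow_neg_one]; field_simp; simp
        rw [hz]; simp
      · simp
  rw [← mul_one (coord q c z), orbit_coord_mul, orbit_one, mulV₃_apply]
  simp only [LinearMap.add_apply, LinearMap.smul_apply, hU, hV, hW]
  module

/-- On `V`, the operators are the `q`-adjoint ones. -/
theorem hypAd_coord {B : V 𝕜 ⊗[𝕜] V 𝕜 →ₗ[𝕜] V 𝕜} {g : 𝕜}
    (hB : ∀ x z : V 𝕜, qad B x z =
      ![g * (q + q⁻¹) * (q⁻¹ ^ 2 * (x 1 * z 0) - x 0 * z 1),
        g * (q⁻¹ ^ 2 * (x 0 * z 2) - q⁻¹ * (q + q⁻¹) * (q - q⁻¹) * (x 1 * z 1) -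
          q⁻¹ ^ 2 * (x 2 * z 0)),
        g * (q + q⁻¹) * (q⁻¹ ^ 2 * (x 2 * z 1) - x 1 * z 2)]) (c : 𝕜) (x z : V 𝕜) :
    hypAd q (-g * (q ^ 3 + q⁻¹ ^ 3)) c x (coord q c z) = coord q c (qad B x z) := by
  have h0 : q ≠ 0 := hq.ne_zero
  have hs := IsGeneric.sq_add_one_ne q
  have hd := IsGeneric.sub_inv_ne q
  have hd2 := IsGeneric.sq_sub_one_ne q
  have h6 := IsGeneric.pow_four_mul_sq_add_one_ne q 1
  rw [zpow_one] at h6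
  have h6' : q ^ 6 + 1 ≠ 0 := by rwa [← pow_add] at h6
  have hc : cas q (-g * (q ^ 3 + q⁻¹ ^ 3)) (q ^ (1 : ℤ)) = g := by
    rw [cas, zpow_one, ← pow_add]; field_simp
  apply orbit_injective q c
  rw [orbit_hypAd, orbit_coord, orbit_coord, hB]
  ext i k
  simp only [adU, adV, adW, hop_apply, Pi.add_apply, Pi.sub_apply, Pi.smul_apply, latSingle_apply,
    smul_eq_mul, Matrix.cons_val_zero, Matrix.cons_val_one, Matrix.cons_val, add_zero]
  by_cases hi : i = 1
  · subst hi
    rw [hc]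
    by_cases h1 : k = 1
    · subst h1
      norm_num [br]
      field_simp
      ring
    by_cases h2 : k = 0
    · subst h2
      norm_num [br]
      field_simp
      ring
    by_cases h3 : k = -1
    · subst h3
      norm_num [br]
      field_simp
      ring
    by_cases h4 : k = 2
    · subst h4
      have hb : br q (q ^ (1 : ℤ) * q / q ^ (2 : ℤ)) = 0 := by
        rw [zpow_one, zpow_ofNat, show q * q / q ^ 2 = 1 by field_simp]; simp [br]
      simp only [hb]
      norm_num
    by_cases h5 : k = -2
    · subst h5
      have hb : br q (q ^ (1 : ℤ) * q ^ (-2 : ℤ) * q) = 0 := by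
        rw [zpow_one, zpow_neg, zpow_ofNat, show q * (q ^ 2)⁻¹ * q = 1 by field_simp]; simp [br]
      simp only [hb]
      norm_num
    have e1 : k + -1 ≠ 1 := by omega
    have e2 : k + -1 ≠ 0 := by omega
    have e3 : k + -1 ≠ -1 := by omega
    have e4 : k + 1 ≠ 1 := by omega
    have e5 : k + 1 ≠ 0 := by omega
    have e6 : k + 1 ≠ -1 := by omega
    simp only [h1, h2, h3, e1, e2, e3, e4, e5, e6, and_false, if_false]
    simp
  · simp [hi]

/-! ### Anchors -/

theorem mkQ_tmul {c : 𝕜} (a : Hyp q c) (x : V 𝕜) :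
    (tangentRelations q c).mkQ (a ⊗ₜ[𝕜] x) = a • field q c x := by
  rw [field, LinearMap.comp_apply, LinearMap.restrictScalars_apply, TensorProduct.mk_apply,
    ← map_smul, TensorProduct.smul_tmul', smul_eq_mul, mul_one]

/-- An anchor is determined by its operators. -/
theorem anchor_ext {c : 𝕜} {β β' : Tangent q c ⊗[𝕜] Hyp q c →ₗ[𝕜] Hyp q c}
    (h : ∀ (a : Hyp q c) (ξ : Tangent q c) (f : Hyp q c), β ((a • ξ) ⊗ₜ f) = a * β (ξ ⊗ₜ f))
    (h' : ∀ (a : Hyp q c) (ξ : Tangent q c) (f : Hyp q c), β' ((a • ξ) ⊗ₜ f) = a * β' (ξ ⊗ₜ f))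
    (hβ : ∀ x f, op q β x f = op q β' x f) : β = β' := by
  apply TensorProduct.ext'
  intro ξ f
  obtain ⟨t, rfl⟩ := (tangentRelations q c).mkQ_surjective ξ
  induction t with
  | zero => simp
  | add x y hx hy => rw [map_add, TensorProduct.add_tmul, map_add, map_add, hx, hy]
  | tmul a x =>
    rw [mkQ_tmul, h, h']
    congr 1
    exact hβ x f

/-- Operators annihilated by contraction with `v₀` extend to the tangent module. -/
theorem exists_anchor (c : 𝕜) (ρ : V 𝕜 →ₗ[𝕜] Module.End 𝕜 (Hyp q c))
    (hρ : ∀ a : Hyp q c, (q ^ 3 + q) • (coord q c (u 𝕜) * ρ (w 𝕜) a) +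
      coord q c (v 𝕜) * ρ (v 𝕜) a + (q + q⁻¹) • (coord q c (w 𝕜) * ρ (u 𝕜) a) = 0) :
    ∃ β : Tangent q c ⊗[𝕜] Hyp q c →ₗ[𝕜] Hyp q c,
      (∀ (a : Hyp q c) (ξ : Tangent q c) (f : Hyp q c), β ((a • ξ) ⊗ₜ f) = a * β (ξ ⊗ₜ f)) ∧
      op q β = ρ := by
  let φ₀ : Hyp q c →ₗ[Hyp q c] V 𝕜 →ₗ[𝕜] (Hyp q c →ₗ[𝕜] Hyp q c) :=
    LinearMap.toSpanSingleton (Hyp q c) _ ρ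
  let φ : Hyp q c ⊗[𝕜] V 𝕜 →ₗ[Hyp q c] (Hyp q c →ₗ[𝕜] Hyp q c) :=
    TensorProduct.AlgebraTensorModule.lift φ₀
  have hφ : ∀ a x f, φ (a ⊗ₜ x) f = a * ρ x f := fun a x f => rfl
  have hker : tangentRelations q c ≤ LinearMap.ker φ := by
    rw [tangentRelations, Submodule.span_singleton_le_iff_mem, LinearMap.mem_ker]
    ext1 f
    have := hρ f
    simpa only [v₀, map_add, map_smul, LinearMap.map_smul_of_tower, LinearMap.rTensor_tmul,
      LinearMap.add_apply, LinearMap.smul_apply, hφ, LinearMap.zero_apply] using this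
  let ψ : Tangent q c →ₗ[Hyp q c] (Hyp q c →ₗ[𝕜] Hyp q c) := (tangentRelations q c).liftQ φ hker
  refine ⟨TensorProduct.lift (ψ.restrictScalars 𝕜), ?_, ?_⟩
  · intro a ξ f
    simp only [TensorProduct.lift.tmul, LinearMap.restrictScalars_apply, map_smul]
    rfl
  · refine LinearMap.ext fun x => LinearMap.ext fun f => ?_
    simp only [op, LinearMap.comp_apply, TensorProduct.curry_apply, TensorProduct.lift.tmul]
    have : ψ (field q c x) f = φ (1 ⊗ₜ x) f := rfl
    exact this.trans (by rw [hφ, one_mul])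

end

/-! ### Eigenvectors of a twist -/

section
variable {K W : Type*} [Field K] [AddCommGroup W] [Module K W]

theorem exists_eigenvector_mem [IsAlgClosed K] [FiniteDimensional K W] (S : Submodule K W)
    (hS : S ≠ ⊥) (f : Module.End K W) (hf : ∀ x ∈ S, f x ∈ S) :
    ∃ x ∈ S, x ≠ 0 ∧ ∃ μ : K, f x = μ • x := by
  have : Nontrivial S := Submodule.nontrivial_iff_ne_bot.mpr hS
  obtain ⟨μ, hμ⟩ := Module.End.exists_eigenvalue (f.restrict hf)
  obtain ⟨x, hx⟩ := hμ.exists_hasEigenvector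
  refine ⟨x, x.2, fun h => hx.2 (Subtype.ext h), μ, ?_⟩
  have := congrArg Subtype.val hx.apply_eq_smul
  simpa using this

/-- An endomorphism whose only eigenvalue is `0` is nilpotent. -/
theorem isNilpotent_of_eigenvalue_eq_zero [IsAlgClosed K] [FiniteDimensional K W]
    (f : Module.End K W) (h : ∀ μ, f.HasEigenvalue μ → μ = 0) : IsNilpotent f := by
  have htop := Module.End.iSup_maxGenEigenspace_eq_top f
  have h0 : f.maxGenEigenspace 0 = ⊤ := by
    rw [eq_top_iff, ← htop]
    refine iSup_le fun μ => ?_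
    by_cases hμ : μ = 0
    · rw [hμ]
    · have : f.maxGenEigenspace μ = ⊥ := by
        by_contra hne
        apply hμ
        apply h
        have := Module.End.hasUnifEigenvalue_iff_hasUnifEigenvalue_one (f := f) (μ := μ)
          (k := ⊤) (by simp)
        exact this.mp hne
      rw [this]; exact bot_le
  rw [Module.End.maxGenEigenspace_eq, Module.End.genEigenspace_nat] at h0
  refine ⟨_, LinearMap.ker_eq_top.mp (by simpa using h0)⟩

theorem ker_pow_eq_bot {f : Module.End K W} (h : ∀ x, f x = 0 → x = 0) (n : ℕ) (x : W)
    (hx : (f ^ n) x = 0) : x = 0 := by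
  induction n generalizing x with
  | zero => simpa using hx
  | succ n ih => rw [pow_succ, Module.End.mul_apply] at hx; exact h _ (ih _ hx)

/-- A map that intertwines a nilpotent operator with an injective one vanishes. -/
theorem eq_zero_of_intertwines_isNilpotent [IsAlgClosed K] [FiniteDimensional K W]
    {f g h : Module.End K W}
    (hf : IsNilpotent f) (hg : g * f = h * g) (hh : ∀ x, h x = 0 → x = 0) : g = 0 := by
  obtain ⟨n, hn⟩ := hf
  have : ∀ n, g * f ^ n = h ^ n * g := by
    intro n
    induction n with
    | zero => simp
    | succ n ih => rw [pow_succ', ← mul_assoc, hg, mul_assoc, ih, ← mul_assoc, ← pow_succ']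
  have h2 := this n
  rw [hn, mul_zero] at h2
  ext1 x
  exact ker_pow_eq_bot hh n _ (LinearMap.congr_fun h2.symm x)

variable (q ħ : K)

/-- If the operators `E T`, `D T`, `F T` satisfy the relations of the enveloping algebra of
`sl(2)_q` with constant `ħ ≠ 0`, where `E`, `D`, `F` behave like the operators of an irreducible
module with highest weight vector `e` and lowest weight vector `f`, then `T` vanishes or
has `e` or `f` as an eigenvector. -/
theorem twist_spectral [hq : IsGeneric q] [IsAlgClosed K] [FiniteDimensional K W]
    {E D F T : Module.End K W}
    {e f : W} {d d' : K} (hħ : ħ ≠ 0) (hr : EnvRel q ħ (E * T) (D * T) (F * T))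
    (hcommon : ∀ (n : W) (α β : K), E n = α • D n → F n = β • D n → D n = 0)
    (htop : ∀ n, E n = 0 → ∃ a : K, n = a • e) (hbot : ∀ n, F n = 0 → ∃ a : K, n = a • f)
    (hinter : ∀ n, E n = 0 → F n = 0 → n = 0) (hDe : D e = d • e) (hDf : D f = d' • f) :
    T = 0 ∨ (∃ τ : K, τ ≠ 0 ∧ T e = τ • e) ∨ (∃ τ : K, τ ≠ 0 ∧ T f = τ • f) := by
  obtain ⟨r1, r2, r3⟩ := hr
  have h0 : q ≠ 0 := hq.ne_zero
  have hq2 := IsGeneric.sq_sub_one_ne q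
  have hs := IsGeneric.pow_three_add_ne q
  obtain ⟨t, ht⟩ : ∃ t, t = ħ / (q ^ 2 - 1) := ⟨_, rfl⟩
  have ht' : (q ^ 2 - 1) * t = ħ := by rw [ht]; field_simp
  have ht0 : t ≠ 0 := by rw [ht]; exact div_ne_zero hħ hq2
  -- `E T` and `F T` multiply the eigenvalues of `P = D T - t` by `q²` and `q⁻²`
  set A := E * T
  set V := D * T with hV
  set C := F * T
  obtain ⟨P, hP⟩ : ∃ P, P = V - t • (1 : Module.End K W) := ⟨_, rfl⟩
  have hVP : V = P + t • 1 := by rw [hP]; abel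
  have hPA : P * A = q ^ 2 • (A * P) := by
    rw [hP, sub_mul, mul_sub, smul_sub, smul_mul_assoc, one_mul, mul_smul_comm, mul_one]
    have : V * A = q ^ 2 • (A * V) - ħ • A := by rw [← r1]; abel
    rw [this, ← ht']; module
  have hCP : C * P = q ^ 2 • (P * C) := by
    rw [hP, sub_mul, mul_sub, smul_sub, smul_mul_assoc, one_mul, mul_smul_comm, mul_one]
    have : C * V = q ^ 2 • (V * C) - ħ • C := by rw [eq_add_of_sub_eq r3]; module
    rw [this, ← ht']; module
  have hAC : (q ^ 3 + q) • (A * C - C * A) = (q ^ 2 - 1) • (V * P) := by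
    have : (q ^ 3 + q) • (A * C - C * A) = -ħ • V - (1 - q ^ 2) • (V * V) := by rw [← r2]; abel
    rw [this, hP, mul_sub, mul_smul_comm, mul_one, ← ht']; module
  -- on the kernel of `P` the operators `E T`, `F T` commute and `D T` is the scalar `t`; a common
  -- eigenvector would contradict `hcommon`
  have hPinj : ∀ x, P x = 0 → x = 0 := by
    by_contra hne
    push Not at hne
    obtain ⟨x₀, hx₀, hx₀'⟩ := hne
    have hPA' : ∀ x, P x = 0 → P (A x) = 0 := fun x hx => by
      have := LinearMap.congr_fun hPA x
      simpa [hx] using this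
    have hPC' : ∀ x, P x = 0 → P (C x) = 0 := fun x hx => by
      have := LinearMap.congr_fun hCP x
      rw [Module.End.mul_apply, hx, map_zero, LinearMap.smul_apply, Module.End.mul_apply] at this
      exact (smul_eq_zero.mp this.symm).resolve_left (pow_ne_zero 2 h0)
    have hcomm : ∀ x, P x = 0 → A (C x) = C (A x) := fun x hx => by
      have := LinearMap.congr_fun hAC x
      simp [hx, hs] at this
      exact sub_eq_zero.mp this
    obtain ⟨x₁, hx₁, hx₁', α, hα⟩ := exists_eigenvector_mem (LinearMap.ker P)
      (fun h => hx₀' (by have : x₀ ∈ LinearMap.ker P := hx₀; rw [h] at this; simpa using this)) A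
      (fun x hx => hPA' x hx)
    obtain ⟨x, hx, hx', β, hβ⟩ := exists_eigenvector_mem
      (LinearMap.ker P ⊓ LinearMap.ker (A - α • (1 : Module.End K W)))
      (fun h => hx₁' (by
        have : x₁ ∈ LinearMap.ker P ⊓ LinearMap.ker (A - α • (1 : Module.End K W)) :=
          ⟨hx₁, by simp [hα]⟩
        rw [h] at this; simpa using this)) C
      (fun x hx => ⟨hPC' x hx.1, by
        have h1 := hcomm x hx.1
        have h2 : A x = α • x := by simpa [sub_eq_zero] using hx.2
        simp [h1, h2]⟩)
    have hAx : A x = α • x := by simpa [sub_eq_zero] using hx.2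
    have hVx : V x = t • x := by
      have : P x = 0 := hx.1
      rw [hVP]; simp [this]
    have key : D (T x) = 0 := by
      have e1 : D (T x) = t • x := hVx
      refine hcommon (T x) (α / t) (β / t) ?_ ?_
      · rw [e1, smul_smul, div_mul_cancel₀ _ ht0]; exact hAx
      · rw [e1, smul_smul, div_mul_cancel₀ _ ht0]; exact hβ
    have : t • x = 0 := by rw [← hVx]; exact key
    exact hx' ((smul_eq_zero.mp this).resolve_left ht0)
  by_cases hall : ∀ μ, P.HasEigenvalue μ → μ = -t
  · left
    -- `D T` is nilpotent, so that `E T` and `F T` vanish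
    have hVx : ∀ (μ : K) (x : W), x ≠ 0 → V x = μ • x → μ = 0 := by
      intro μ x hx h
      have : P.HasEigenvalue (μ - t) := by
        refine Module.End.hasEigenvalue_of_hasEigenvector (x := x) ⟨?_, hx⟩
        rw [Module.End.mem_eigenspace_iff, hP]; simp [h, sub_smul]
      simpa using hall _ this
    have hnil : IsNilpotent V := by
      refine isNilpotent_of_eigenvalue_eq_zero V fun μ hμ => ?_
      obtain ⟨x, hx⟩ := hμ.exists_hasEigenvector
      exact hVx μ x hx.2 hx.apply_eq_smul
    have hA0 : A = 0 := by
      refine eq_zero_of_intertwines_isNilpotent (f := V) (h := (q ^ 2)⁻¹ • (V + ħ • 1)) hnil ?_ ?_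
      · have : V * A + ħ • A = q ^ 2 • (A * V) := by rw [← r1]; abel
        rw [smul_mul_assoc, add_mul, smul_mul_assoc, one_mul, this, smul_smul,
          inv_mul_cancel₀ (pow_ne_zero 2 h0), one_smul]
      · intro x hx
        by_contra hne
        have h1 : V x = -ħ • x := by
          have := (smul_eq_zero.mp hx).resolve_left (inv_ne_zero (pow_ne_zero 2 h0))
          rw [neg_smul]; exact eq_neg_of_add_eq_zero_left (by simpa using this)
        have := hVx _ x hne h1
        exact hħ (by simpa using this)
    have hC0 : C = 0 := by
      refine eq_zero_of_intertwines_isNilpotent (f := V) (h := q ^ 2 • V - ħ • 1) hnil ?_ ?_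
      · rw [sub_mul, smul_mul_assoc, smul_mul_assoc, one_mul]
        have : C * V = q ^ 2 • (V * C) - ħ • C := by
          rw [eq_add_of_sub_eq r3]; module
        exact this
      · intro x hx
        by_contra hne
        have h1 : V x = (ħ / q ^ 2) • x := by
          have h2 : q ^ 2 • V x = ħ • x := by simpa [sub_eq_zero] using hx
          rw [div_eq_inv_mul, ← smul_smul, ← h2, smul_smul, inv_mul_cancel₀ (pow_ne_zero 2 h0),
            one_smul]
        have := hVx _ x hne h1
        exact div_ne_zero hħ (pow_ne_zero 2 h0) this
    ext1 x
    exact hinter _ (LinearMap.congr_fun hA0 x) (LinearMap.congr_fun hC0 x)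
  · right
    push Not at hall
    obtain ⟨μ, hμ, hμt⟩ := hall
    have hμ0 : μ ≠ 0 := by
      rintro rfl
      obtain ⟨x, hx⟩ := hμ.exists_hasEigenvector
      exact hx.2 (hPinj x (by simpa using hx.apply_eq_smul))
    have hinj : ∀ m n : ℕ, q ^ (2 * m) = q ^ (2 * n) → m = n := by
      have : ∀ m n : ℕ, m < n → q ^ (2 * m) ≠ q ^ (2 * n) := by
        intro m n hmn h
        apply hq.pow_ne_one (2 * n - 2 * m) (by omega)
        have h1 : q ^ (2 * n) = q ^ (2 * m) * q ^ (2 * n - 2 * m) := by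
          rw [← pow_add]; congr 1; omega
        rw [h1] at h
        exact (mul_eq_left₀ (pow_ne_zero _ h0)).mp h.symm
      intro m n h
      rcases lt_trichotomy m n with h1 | h1 | h1
      · exact absurd h (this m n h1)
      · exact h1
      · exact absurd h.symm (this n m h1)
    have hfin : {ν | P.HasEigenvalue ν}.Finite := Module.End.finite_hasEigenvalue P
    -- since `μ ≠ 0` and `q` is not a root of unity, the string of eigenvalues through `μ` is
    -- finite; these are its upper and lower ends
    obtain ⟨N, hN, hN'⟩ : ∃ N : ℕ, P.HasEigenvalue (q ^ (2 * N) * μ) ∧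
        ¬ P.HasEigenvalue (q ^ (2 * (N + 1)) * μ) := by
      by_contra hcon
      push Not at hcon
      have : ∀ N : ℕ, P.HasEigenvalue (q ^ (2 * N) * μ) := by
        intro N
        induction N with
        | zero => simpa using hμ
        | succ N ih => exact hcon N ih
      exact Set.infinite_of_injective_forall_mem (f := fun N : ℕ => q ^ (2 * N) * μ)
        (fun m n h => hinj m n (mul_right_cancel₀ hμ0 h)) this hfin
    obtain ⟨M, hM, hM'⟩ : ∃ M : ℕ, P.HasEigenvalue ((q ^ (2 * M))⁻¹ * μ) ∧
        ¬ P.HasEigenvalue ((q ^ (2 * (M + 1)))⁻¹ * μ) := by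
      by_contra hcon
      push Not at hcon
      have : ∀ N : ℕ, P.HasEigenvalue ((q ^ (2 * N))⁻¹ * μ) := by
        intro N
        induction N with
        | zero => simpa using hμ
        | succ N ih => exact hcon N ih
      exact Set.infinite_of_injective_forall_mem (f := fun N : ℕ => (q ^ (2 * N))⁻¹ * μ)
        (fun m n h => hinj m n (inv_injective (mul_right_cancel₀ hμ0 h))) this hfin
    -- an extremal eigenvalue different from `-t` gives an eigenvector of `T`
    have fin : ∀ (ν : K) (x y : W) (δ : K), ν ≠ -t → x ≠ 0 → P x = ν • x → D y = δ • y →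
        (∃ a : K, T x = a • y) → ∃ τ : K, τ ≠ 0 ∧ T y = τ • y := by
      rintro ν x y δ hν hx hPx hDy ⟨a, ha⟩
      have h1 : V x = (ν + t) • x := by rw [hVP]; simp [hPx, add_smul]
      have h2 : V x = (a * δ) • y := by
        rw [hV, Module.End.mul_apply, ha, map_smul, hDy, smul_smul]
      have hνt : ν + t ≠ 0 := fun h => hν (eq_neg_of_add_eq_zero_left h)
      have haδ : a * δ ≠ 0 := by
        intro h
        rw [h1, h, zero_smul] at h2
        exact hx ((smul_eq_zero.mp h2).resolve_left hνt)
      have hy : y = ((a * δ)⁻¹ * (ν + t)) • x := by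
        rw [← smul_smul, ← h1, h2, smul_smul, inv_mul_cancel₀ haδ, one_smul]
      refine ⟨(a * δ)⁻¹ * (ν + t) * a, mul_ne_zero (mul_ne_zero (inv_ne_zero haδ) hνt)
        (left_ne_zero_of_mul haδ), ?_⟩
      nth_rewrite 1 [hy]
      rw [map_smul, ha, smul_smul]
    by_cases hNt : q ^ (2 * N) * μ = -t
    · right
      have hMt : (q ^ (2 * M))⁻¹ * μ ≠ -t := by
        intro h
        rw [← hNt] at h
        have h1 := mul_right_cancel₀ hμ0 h
        have h2 : q ^ (2 * (N + M)) = q ^ (2 * 0) := by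
          rw [mul_add, pow_add, ← h1, inv_mul_cancel₀ (pow_ne_zero _ h0)]; simp
        have h3 := hinj _ _ h2
        obtain rfl : N = 0 := by omega
        exact hμt (by simpa using hNt)
      obtain ⟨x, hx⟩ := hM.exists_hasEigenvector
      have hPx := hx.apply_eq_smul
      refine fin _ x f d' hMt hx.2 hPx hDf (hbot _ ?_)
      by_contra hne
      apply hM'
      refine Module.End.hasEigenvalue_of_hasEigenvector (x := C x) ⟨?_, hne⟩
      rw [Module.End.mem_eigenspace_iff]
      have h2 : P (C x) = (q ^ 2)⁻¹ • (q ^ 2 • P * C) x := by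
        rw [smul_mul_assoc, LinearMap.smul_apply, smul_smul,
          inv_mul_cancel₀ (pow_ne_zero 2 h0), one_smul]
        rfl
      rw [h2, smul_mul_assoc, ← hCP, Module.End.mul_apply, hPx, map_smul, smul_smul]
      congr 1
      rw [mul_add, pow_add, mul_inv, mul_one]; ring
    · left
      obtain ⟨x, hx⟩ := hN.exists_hasEigenvector
      have hPx := hx.apply_eq_smul
      refine fin _ x e d hNt hx.2 hPx hDe (htop _ ?_)
      by_contra hne
      apply hN'
      refine Module.End.hasEigenvalue_of_hasEigenvector (x := A x) ⟨?_, hne⟩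
      rw [Module.End.mem_eigenspace_iff]
      rw [← Module.End.mul_apply, hPA, LinearMap.smul_apply, Module.End.mul_apply, hPx, map_smul,
        smul_smul]
      congr 1
      ring

end

/-! ### Twists of a ladder of operators -/

section
variable {K W : Type*} [Field K] [AddCommGroup W] [Module K W]

/-- The operators `E`, `D`, `F` raise, preserve and lower the vectors of the basis `e`, as the
generators of `sl(2)_q` do in an irreducible module; `e 0` is the highest weight vector. -/
structure IsLadder {n : ℕ} (e : Module.Basis (Fin (n + 1)) K W) (E D F : Module.End K W)
    (ε φ : Fin n → K) (d : Fin (n + 1) → K) : Prop where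
  E_zero : E (e 0) = 0
  E_succ : ∀ j, E (e j.succ) = ε j • e j.castSucc
  F_castSucc : ∀ j, F (e j.castSucc) = φ j • e j.succ
  F_last : F (e (Fin.last n)) = 0
  D_apply : ∀ j, D (e j) = d j • e j
  ε_ne_zero : ∀ j, ε j ≠ 0
  φ_ne_zero : ∀ j, φ j ≠ 0

namespace IsLadder

section
variable {n : ℕ} {e : Module.Basis (Fin (n + 1)) K W} {E D F : Module.End K W}
  {ε φ : Fin n → K} {d : Fin (n + 1) → K} (h : IsLadder e E D F ε φ d)
include h

/-- The ladder read from the lowest weight vector. -/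
theorem rev : IsLadder (e.reindex Fin.revPerm) F D E (fun j => φ j.rev) (fun j => ε j.rev)
    (fun j => d j.rev) where
  E_zero := by simp [h.F_last]
  E_succ j := by simp [Fin.rev_succ, Fin.rev_castSucc, h.F_castSucc]
  F_castSucc j := by simp [Fin.rev_succ, Fin.rev_castSucc, h.E_succ]
  F_last := by simp [h.E_zero]
  D_apply j := by simp [h.D_apply]
  ε_ne_zero j := h.φ_ne_zero _
  φ_ne_zero j := h.ε_ne_zero _

theorem baseChange (L : Type*) [Field L] [Algebra K L] :
    IsLadder (e.baseChange L) (E.baseChange L) (D.baseChange L) (F.baseChange L)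
      (fun j => algebraMap K L (ε j)) (fun j => algebraMap K L (φ j))
      (fun j => algebraMap K L (d j)) where
  E_zero := by simp [h.E_zero]
  E_succ j := by simp [h.E_succ]
  F_castSucc j := by simp [h.F_castSucc]
  F_last := by simp [h.F_last]
  D_apply j := by simp [h.D_apply]
  ε_ne_zero j := by simpa using h.ε_ne_zero j
  φ_ne_zero j := by simpa using h.φ_ne_zero j

theorem repr_E_castSucc (x : W) (j : Fin n) : e.repr (E x) j.castSucc = ε j * e.repr x j.succ := by
  have : (e.coord j.castSucc) ∘ₗ E = ε j • e.coord j.succ := by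
    refine e.ext fun i => ?_
    refine Fin.cases ?_ (fun i => ?_) i
    · simp [h.E_zero]
    · simp only [LinearMap.comp_apply, h.E_succ, LinearMap.smul_apply, map_smul,
        Module.Basis.coord_apply, Module.Basis.repr_self, Finsupp.single_apply, smul_eq_mul,
        Fin.castSucc_inj, Fin.succ_inj]
      split_ifs with hij
      · rw [hij]
      · simp
  simpa using LinearMap.congr_fun this x

theorem repr_E_last (x : W) : e.repr (E x) (Fin.last n) = 0 := by
  have : (e.coord (Fin.last n)) ∘ₗ E = 0 := by
    refine e.ext fun i => ?_
    refine Fin.cases ?_ (fun i => ?_) i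
    · simp [h.E_zero]
    · simp [h.E_succ, Fin.castSucc_ne_last]
  simpa using LinearMap.congr_fun this x

theorem repr_F_succ (x : W) (j : Fin n) : e.repr (F x) j.succ = φ j * e.repr x j.castSucc := by
  have := h.rev.repr_E_castSucc x j.rev
  simpa [Fin.rev_succ, Fin.rev_castSucc] using this

theorem repr_F_zero (x : W) : e.repr (F x) 0 = 0 := by
  have := h.rev.repr_E_last x
  simpa using this

theorem repr_D (x : W) (j : Fin (n + 1)) : e.repr (D x) j = d j * e.repr x j := by
  have : (e.coord j) ∘ₗ D = d j • e.coord j := by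
    refine e.ext fun i => ?_
    simp only [LinearMap.comp_apply, h.D_apply, LinearMap.smul_apply, map_smul,
      Module.Basis.coord_apply, Module.Basis.repr_self, Finsupp.single_apply, smul_eq_mul]
    split_ifs with hij
    · rw [hij]
    · simp
  simpa using LinearMap.congr_fun this x

theorem repr_succ_of_E_eq_zero {x : W} (hx : E x = 0) (j : Fin n) : e.repr x j.succ = 0 := by
  have := h.repr_E_castSucc x j
  rw [hx, map_zero, Finsupp.zero_apply] at this
  exact (mul_eq_zero.mp this.symm).resolve_left (h.ε_ne_zero j)

theorem repr_castSucc_of_F_eq_zero {x : W} (hx : F x = 0) (j : Fin n) :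
    e.repr x j.castSucc = 0 := by
  have := h.repr_F_succ x j
  rw [hx, map_zero, Finsupp.zero_apply] at this
  exact (mul_eq_zero.mp this.symm).resolve_left (h.φ_ne_zero j)

theorem exists_smul_of_E_eq_zero {x : W} (hx : E x = 0) : ∃ a : K, x = a • e 0 := by
  refine ⟨e.repr x 0, ?_⟩
  nth_rewrite 1 [← e.sum_repr x]
  rw [Fin.sum_univ_succ]
  simp [h.repr_succ_of_E_eq_zero hx]

theorem exists_smul_of_F_eq_zero {x : W} (hx : F x = 0) : ∃ a : K, x = a • e (Fin.last n) := by
  simpa using h.rev.exists_smul_of_E_eq_zero hx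

theorem eq_zero_of_E_F_eq_zero (hn : n ≠ 0) {x : W} (hE : E x = 0) (hF : F x = 0) : x = 0 := by
  obtain ⟨m, rfl⟩ := Nat.exists_eq_succ_of_ne_zero hn
  obtain ⟨a, rfl⟩ := h.exists_smul_of_E_eq_zero hE
  have := h.repr_castSucc_of_F_eq_zero hF 0
  simp at this
  simp [this]

/-- No vector outside the kernel of `D` is a common eigenvector of `E` and `F` relative to `D`. -/
theorem D_eq_zero_of_common (hn : n ≠ 0) {x : W} {α β : K} (hE : E x = α • D x)
    (hF : F x = β • D x) : D x = 0 := by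
  rw [← e.repr.map_eq_zero_iff]
  ext j
  rw [Finsupp.zero_apply]
  by_cases hβ : β = 0
  · rw [hβ, zero_smul] at hF
    by_cases hα : α = 0
    · rw [hα, zero_smul] at hE
      rw [h.eq_zero_of_E_F_eq_zero hn hE hF]; simp
    · refine Fin.lastCases ?_ (fun j => ?_) j
      · have := h.repr_E_last x
        rw [hE, map_smul, Finsupp.smul_apply] at this
        exact (smul_eq_zero.mp this).resolve_left hα
      · rw [h.repr_D, h.repr_castSucc_of_F_eq_zero hF, mul_zero]
  · induction j using Fin.induction with
    | zero =>
      have := h.repr_F_zero x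
      rw [hF, map_smul, Finsupp.smul_apply] at this
      exact (smul_eq_zero.mp this).resolve_left hβ
    | succ j ih =>
      have := h.repr_E_castSucc x j
      rw [hE, map_smul, Finsupp.smul_apply, ih, smul_zero] at this
      rw [h.repr_D, (mul_eq_zero.mp this.symm).resolve_left (h.ε_ne_zero j), mul_zero]

end

/-- The highest or the lowest weight vector of a ladder of length at least two is an
eigenvector of any nonzero twist. -/
theorem exists_eigenvector {n : ℕ} {e : Module.Basis (Fin (n + 1)) K W} {E D F : Module.End K W}
    {ε φ : Fin n → K} {d : Fin (n + 1) → K} (h : IsLadder e E D F ε φ d) (hn : n ≠ 0)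
    {q ħ : K} [IsGeneric q] (hħ : ħ ≠ 0) {T : Module.End K W}
    (hr : EnvRel q ħ (E * T) (D * T) (F * T)) :
    T = 0 ∨ (∃ τ : K, τ ≠ 0 ∧ T (e 0) = τ • e 0) ∨
      (∃ τ : K, τ ≠ 0 ∧ T (e (Fin.last n)) = τ • e (Fin.last n)) := by
  let L := AlgebraicClosure K
  have : Module.Finite K W := Module.Finite.of_basis e
  have hgen : IsGeneric (algebraMap K L q) :=
    ⟨by simpa using IsGeneric.ne_zero (q := q), fun m hm hq => by
      rw [← map_pow, ← map_one (algebraMap K L)] at hq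
      exact IsGeneric.pow_ne_one m hm ((algebraMap K L).injective hq)⟩
  have hL := h.baseChange L
  have smul_eq : ∀ (a : K) (f : Module.End K W),
      (a • f).baseChange L = algebraMap K L a • f.baseChange L := fun a f => by
    rw [LinearMap.baseChange_smul, algebraMap_smul]
  have hr' : EnvRel (algebraMap K L q) (algebraMap K L ħ) (E.baseChange L * T.baseChange L)
      (D.baseChange L * T.baseChange L) (F.baseChange L * T.baseChange L) := by
    obtain ⟨h1, h2, h3⟩ := hr
    constructor
    · have := congrArg (LinearMap.baseChange L) h1
      simpa [smul_eq, LinearMap.baseChange_sub, LinearMap.baseChange_add, LinearMap.baseChange_mul,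
        -neg_smul] using this
    · have := congrArg (LinearMap.baseChange L) h2
      simpa [smul_eq, LinearMap.baseChange_sub, LinearMap.baseChange_add, LinearMap.baseChange_mul,
        -neg_smul] using this
    · have := congrArg (LinearMap.baseChange L) h3
      simpa [smul_eq, LinearMap.baseChange_sub, LinearMap.baseChange_add, LinearMap.baseChange_mul,
        -neg_smul] using this
  -- an eigenvector after base change that comes from `K` has its eigenvalue in `K`
  have descend : ∀ j, (∃ τ : L, τ ≠ 0 ∧ T.baseChange L (e.baseChange L j) =
      τ • e.baseChange L j) → ∃ τ : K, τ ≠ 0 ∧ T (e j) = τ • e j := by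
    rintro j ⟨τ, hτ, hj⟩
    have hc : ∀ i, algebraMap K L (e.repr (T (e j)) i) =
        τ * algebraMap K L (Finsupp.single j 1 i) := fun i => by
      have := congrArg (fun x => (e.baseChange L).repr x i) hj
      simpa [Algebra.smul_def] using! this
    refine ⟨e.repr (T (e j)) j, fun h0 => hτ ?_, ?_⟩
    · simpa [h0] using (hc j).symm
    · apply e.repr.injective
      ext i
      by_cases hij : j = i
      · subst hij; simp
      · have := hc i
        rw [Finsupp.single_eq_of_ne (Ne.symm hij), map_zero, mul_zero] at this
        simp [hij, (map_eq_zero _).mp this]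
  have key := twist_spectral (algebraMap K L q) (algebraMap K L ħ) (by simpa using hħ) hr'
    (fun x α β => hL.D_eq_zero_of_common hn) (fun x => hL.exists_smul_of_E_eq_zero)
    (fun x => hL.exists_smul_of_F_eq_zero) (fun x => hL.eq_zero_of_E_F_eq_zero hn)
    (hL.D_apply 0) (hL.D_apply (Fin.last n))
  refine key.imp (fun h0 => ?_) (Or.imp (descend _) (descend _))
  refine e.ext fun j => e.repr.injective ?_
  ext i
  have := congrArg (fun x => (e.baseChange L).repr x i)
    (LinearMap.congr_fun h0 (e.baseChange L j))
  simpa using! this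

/-- If a twist preserves the line of a vector of the ladder, it preserves the line of the next
one, and two of the relations determine the scalar. -/
theorem exists_apply_succ {n : ℕ} {e : Module.Basis (Fin (n + 1)) K W}
    {E D F T : Module.End K W} {ε φ : Fin n → K} {d : Fin (n + 1) → K}
    (h : IsLadder e E D F ε φ d) {p₁ p₂ p₃ a b c : K} (hp : p₁ ≠ 0) (ha : a ≠ 0) (hd : d 0 ≠ 0)
    (s₁ : p₁ • (D * T * (F * T)) - p₂ • (F * T * (D * T)) = p₃ • (F * T))
    (s₂ : a • (E * T * (F * T) - F * T * (E * T)) + b • (D * T * (D * T)) = c • (D * T))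
    {j : Fin n} {t κ : K} (ht : t ≠ 0) (hT : T (e j.castSucc) = t • e j.castSucc)
    (hκ : F (T (E (e j.castSucc))) = κ • e j.castSucc) :
    ∃ t', T (e j.succ) = t' • e j.succ ∧ p₁ * (d j.succ * t') = p₂ * (t * d j.castSucc) + p₃ ∧
      a * (φ j * ε j * t') - a * κ + b * (t * d j.castSucc ^ 2) = c * d j.castSucc := by
  have hφ := h.φ_ne_zero j
  have e₁ : ∀ i, p₁ * (d i * e.repr (T (e j.succ)) i) =
      (p₂ * (t * d j.castSucc) + p₃) * e.repr (e j.succ) i := fun i => by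
    have := congrArg (fun f : Module.End K W => e.repr (f (e j.castSucc)) i) s₁
    simp only [LinearMap.smul_apply, LinearMap.sub_apply, Module.End.mul_apply, hT, h.F_castSucc,
      h.D_apply, map_smul, map_sub, Finsupp.sub_apply, Finsupp.smul_apply, smul_eq_mul,
      h.repr_D] at this
    apply mul_left_cancel₀ (mul_ne_zero ht hφ)
    linear_combination this
  have e₂ : ∀ i : Fin n, a * (φ j * (ε i * e.repr (T (e j.succ)) i.succ)) =
      (a * κ - b * (t * d j.castSucc ^ 2) + c * d j.castSucc) *
        e.repr (e j.castSucc) i.castSucc := fun i => by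
    have := congrArg (fun f : Module.End K W => e.repr (f (e j.castSucc)) i.castSucc) s₂
    simp only [LinearMap.smul_apply, LinearMap.sub_apply, LinearMap.add_apply,
      Module.End.mul_apply, hT, h.F_castSucc, h.D_apply, map_smul, map_sub, map_add, hκ,
      Finsupp.sub_apply, Finsupp.add_apply, Finsupp.smul_apply, smul_eq_mul,
      h.repr_E_castSucc] at this
    apply mul_left_cancel₀ ht
    linear_combination this
  refine ⟨e.repr (T (e j.succ)) j.succ, ?_, ?_, ?_⟩
  · apply e.repr.injective
    ext i
    rw [map_smul, Finsupp.smul_apply, smul_eq_mul, Module.Basis.repr_self]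
    by_cases hi : i = j.succ
    · rw [hi, Finsupp.single_eq_same, mul_one]
    · rw [Finsupp.single_eq_of_ne hi, mul_zero]
      induction i using Fin.cases with
      | zero =>
        have := e₁ 0
        rw [Module.Basis.repr_self, Finsupp.single_eq_of_ne hi, mul_zero] at this
        simpa [hp, hd] using this
      | succ i =>
        have := e₂ i
        rw [Module.Basis.repr_self, Finsupp.single_eq_of_ne, mul_zero] at this
        · simpa [ha, hφ, h.ε_ne_zero i] using this
        · simpa using hi
  · simpa using e₁ j.succ
  · have := e₂ j
    simp only [Module.Basis.repr_self, Finsupp.single_eq_same, mul_one] at this ⊢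
    linear_combination this

/-- If a twist multiplies the highest weight vector by a nonzero scalar, it is the identity: the
first two scalars solve a homogeneous linear system, and the others follow. -/
theorem eq_one_of_apply_zero {n : ℕ} {e : Module.Basis (Fin (n + 2)) K W}
    {E D F T : Module.End K W} {ε φ : Fin (n + 1) → K} {d : Fin (n + 2) → K}
    (h : IsLadder e E D F ε φ d) {p₁ p₂ p₃ a b c τ : K} (hp : p₁ ≠ 0) (ha : a ≠ 0)
    (hd : d 0 ≠ 0) (hdet : p₁ * d 1 * b * d 0 + p₂ * a * φ 0 * ε 0 ≠ 0)
    (r₁ : p₁ • (D * F) - p₂ • (F * D) = p₃ • F)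
    (r₂ : a • (E * F - F * E) + b • (D * D) = c • D)
    (s₁ : p₁ • (D * T * (F * T)) - p₂ • (F * T * (D * T)) = p₃ • (F * T))
    (s₂ : a • (E * T * (F * T) - F * T * (E * T)) + b • (D * T * (D * T)) = c • (D * T))
    (hτ : τ ≠ 0) (hT : T (e 0) = τ • e 0) : T = 1 := by
  have one : ∀ (j : Fin (n + 1)) (κ : K), F (E (e j.castSucc)) = κ • e j.castSucc →
      p₁ * d j.succ = p₂ * d j.castSucc + p₃ ∧
      a * (φ j * ε j) - a * κ + b * d j.castSucc ^ 2 = c * d j.castSucc := fun j κ hκ => by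
    obtain ⟨t, ht, h1, h2⟩ := h.exists_apply_succ (T := 1) (t := 1) hp ha hd (by simpa using r₁)
      (by simpa using r₂) one_ne_zero (by simp) hκ
    have ht' : t = 1 := by
      have := congrArg (fun x => e.repr x j.succ) ht
      simpa using this.symm
    subst ht'
    exact ⟨by linear_combination h1, by linear_combination h2⟩
  have key : ∀ (m : ℕ) (hm : m < n + 1), T (e ⟨m, by omega⟩) = e ⟨m, by omega⟩ ∧
      T (e ⟨m + 1, by omega⟩) = e ⟨m + 1, by omega⟩ := by
    intro m hm
    induction m with
    | zero =>
      have hE : E (e (Fin.castSucc 0)) = 0 := h.E_zero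
      obtain ⟨t, ht, h1, h2⟩ := h.exists_apply_succ (j := 0) (κ := 0) hp ha hd s₁ s₂ hτ hT
        (by rw [hE]; simp)
      obtain ⟨h3, h4⟩ := one 0 0 (by rw [hE]; simp)
      simp only [Fin.castSucc_zero, Fin.succ_zero_eq_one] at h1 h2 h3 h4
      have hτ1 : τ = 1 := by
        have : (p₁ * d 1 * b * d 0 + p₂ * a * φ 0 * ε 0) * (d 0 * (τ - 1)) = 0 := by
          linear_combination p₁ * d 1 * (h2 - h4) - a * (φ 0 * ε 0) * (h1 - h3)
        have := (mul_eq_zero.mp this).resolve_left hdet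
        exact sub_eq_zero.mp ((mul_eq_zero.mp this).resolve_left hd)
      subst hτ1
      have ht1 : t = 1 := by
        have : a * (φ 0 * ε 0) * (t - 1) = 0 := by linear_combination h2 - h4
        exact sub_eq_zero.mp ((mul_eq_zero.mp this).resolve_left
          (mul_ne_zero ha (mul_ne_zero (h.φ_ne_zero 0) (h.ε_ne_zero 0))))
      subst ht1
      rw [one_smul] at hT ht
      exact ⟨hT, ht⟩
    | succ m ih =>
      obtain ⟨i1, i2⟩ := ih (by omega)
      refine ⟨i2, ?_⟩
      have hE : E (e (Fin.castSucc ⟨m + 1, hm⟩)) = ε ⟨m, by omega⟩ • e ⟨m, by omega⟩ :=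
        h.E_succ ⟨m, by omega⟩
      have hF : F (e ⟨m, by omega⟩) = φ ⟨m, by omega⟩ • e (Fin.castSucc ⟨m + 1, hm⟩) :=
        h.F_castSucc ⟨m, by omega⟩
      obtain ⟨t, ht, h1, h2⟩ := h.exists_apply_succ (j := ⟨m + 1, hm⟩) (t := 1) hp ha hd s₁ s₂
        one_ne_zero (by rw [one_smul]; exact i2)
        (by rw [hE, map_smul, i1, map_smul, hF, smul_smul])
      obtain ⟨h3, h4⟩ := one ⟨m + 1, hm⟩ _ (by rw [hE, map_smul, hF, smul_smul])
      have ht1 : t = 1 := by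
        have : a * (φ ⟨m + 1, hm⟩ * ε ⟨m + 1, hm⟩) * (t - 1) = 0 := by linear_combination h2 - h4
        exact sub_eq_zero.mp ((mul_eq_zero.mp this).resolve_left
          (mul_ne_zero ha (mul_ne_zero (h.φ_ne_zero _) (h.ε_ne_zero _))))
      subst ht1
      rw [one_smul] at ht
      exact ht
  refine e.ext fun j => ?_
  rw [Module.End.one_apply]
  obtain ⟨m, hm⟩ := j
  rcases Nat.lt_or_ge m (n + 1) with h1 | h1
  · exact (key m h1).1
  · obtain rfl : m = n + 1 := by omega
    exact (key n (by omega)).2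

/-- The operators of a ladder satisfying the relations of the enveloping algebra of `sl(2)_q`
admit no nontrivial twist. -/
theorem eq_zero_or_eq_one {n : ℕ} {e : Module.Basis (Fin (n + 2)) K W}
    {E D F T : Module.End K W} {ε φ : Fin (n + 1) → K} {d : Fin (n + 2) → K}
    (h : IsLadder e E D F ε φ d) {q ħ : K} [hq : IsGeneric q] (hħ : ħ ≠ 0)
    (hr : EnvRel q ħ E D F) (hr' : EnvRel q ħ (E * T) (D * T) (F * T)) (hd : d 0 ≠ 0)
    (hd' : d (Fin.last (n + 1)) ≠ 0)
    (hdet : q ^ 2 * d 1 * (1 - q ^ 2) * d 0 + (q ^ 3 + q) * φ 0 * ε 0 ≠ 0)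
    (hdet' : -d (Fin.last n).castSucc * (1 - q ^ 2) * d (Fin.last (n + 1)) +
      q ^ 2 * (q ^ 3 + q) * ε (Fin.last n) * φ (Fin.last n) ≠ 0) :
    T = 0 ∨ T = 1 := by
  have h0 : q ≠ 0 := hq.ne_zero
  have hs := IsGeneric.pow_three_add_ne q
  refine (h.exists_eigenvector (by omega) hħ hr').imp_right ?_
  rintro (⟨τ, hτ, hT⟩ | ⟨τ, hτ, hT⟩)
  · refine h.eq_one_of_apply_zero (p₁ := q ^ 2) (p₂ := 1) (p₃ := ħ) (a := q ^ 3 + q)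
      (b := 1 - q ^ 2) (c := -ħ) (pow_ne_zero 2 h0) hs hd ?_ ?_ hr.rel_v ?_ hr'.rel_v hτ hT
    · simpa using hdet
    · rw [show ħ • F = -(-ħ • F) by module, ← hr.rel_w]; module
    · rw [show ħ • (F * T) = -(-ħ • (F * T)) by module, ← hr'.rel_w]; module
  · have h1 : (Fin.rev (1 : Fin (n + 2))) = (Fin.last n).castSucc := by
      rw [← Fin.succ_zero_eq_one, Fin.rev_succ, Fin.rev_zero]
    refine h.rev.eq_one_of_apply_zero (p₁ := -1) (p₂ := -q ^ 2) (p₃ := ħ) (a := -(q ^ 3 + q))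
      (b := 1 - q ^ 2) (c := -ħ) (by simp) (neg_ne_zero.mpr hs) ?_ ?_ ?_ ?_ ?_ ?_ hτ
      (by simpa using hT)
    · simpa using hd'
    · simp only [h1, Fin.rev_zero]
      convert hdet' using 1
      ring
    · rw [← hr.rel_u]; module
    · rw [← hr.rel_v]; module
    · rw [← hr'.rel_u]; module
    · rw [← hr'.rel_v]; module

end IsLadder
end

/-! ### The rows as ladders -/

section
variable {𝕜 : Type*} [Field 𝕜] (q : 𝕜)

theorem row_ext {i : ℤ} {m m' : Lat 𝕜} (hm : m ∈ row 𝕜 i) (hm' : m' ∈ row 𝕜 i)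
    (h : ∀ k, |k| ≤ i → m i k = m' i k) : m = m' := by
  rw [eq_sum_of_mem_row hm, eq_sum_of_mem_row hm']
  refine Finset.sum_congr rfl fun k hk => ?_
  rw [h k (abs_le.mpr (Finset.mem_Icc.mp hk))]

/-- The coordinates of an element of a row, from the highest weight down. -/
def rowCoord (n : ℕ) (i : ℤ) : row 𝕜 i →ₗ[𝕜] (Fin (n + 1) → 𝕜) where
  toFun m j := m.1 i (i - j)
  map_add' _ _ := rfl
  map_smul' _ _ := rfl

theorem rowCoord_apply (n : ℕ) (i : ℤ) (m : row 𝕜 i) (j : Fin (n + 1)) :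
    rowCoord n i m j = m.1 i (i - j) := rfl

/-- The coordinates of an element of a row, as an equivalence. -/
noncomputable def rowEquiv {n : ℕ} {i : ℤ} (h : 2 * i = n) :
    row 𝕜 i ≃ₗ[𝕜] (Fin (n + 1) → 𝕜) :=
  LinearEquiv.ofBijective (rowCoord n i) (by
    constructor
    · intro m m' hm
      refine Subtype.ext (row_ext m.2 m'.2 fun k hk => ?_)
      rw [abs_le] at hk
      have := congrFun hm ⟨(i - k).toNat, by omega⟩
      simp only [rowCoord_apply] at this
      rwa [show i - ((i - k).toNat : ℤ) = k by omega] at this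
    · intro x
      refine ⟨⟨fun i' k => if hk : i' = i ∧ |k| ≤ i then
        x ⟨(i - k).toNat, by have := abs_le.mp hk.2; omega⟩ else 0, fun i' k hne => ?_⟩, ?_⟩
      · by_contra hk
        exact hne (dif_neg hk)
      · ext j
        have hj : |i - (j : ℤ)| ≤ i := by rw [abs_le]; have := j.2; omega
        rw [rowCoord_apply]
        refine (dif_pos ⟨rfl, hj⟩).trans ?_
        congr 1
        ext
        simp)

theorem rowEquiv_apply {n : ℕ} {i : ℤ} (h : 2 * i = n) (m : row 𝕜 i) (j : Fin (n + 1)) :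
    rowEquiv h m j = m.1 i (i - j) := rfl

/-- The basis of a row, starting with the highest weight. -/
noncomputable def rowBasis {n : ℕ} {i : ℤ} (h : 2 * i = n) :
    Module.Basis (Fin (n + 1)) 𝕜 (row 𝕜 i) := Module.Basis.ofEquivFun (rowEquiv h)

theorem coe_rowBasis {n : ℕ} {i : ℤ} (h : 2 * i = n) (j : Fin (n + 1)) :
    (rowBasis (𝕜 := 𝕜) h j : Lat 𝕜) = latSingle i (i - j) := by
  have hj : |i - (j : ℤ)| ≤ i := by rw [abs_le]; have := j.2; omega
  have : rowBasis (𝕜 := 𝕜) h j = ⟨latSingle i (i - j), latSingle_mem_row hj⟩ := by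
    rw [rowBasis, Module.Basis.coe_ofEquivFun, LinearEquiv.symm_apply_eq]
    ext l
    rw [rowEquiv_apply]
    simp only
    rw [latSingle_apply, Pi.single_apply]
    refine if_congr ?_ rfl rfl
    rw [Fin.ext_iff]; omega
  rw [this]

theorem hop_latSingle (f : 𝕜 → 𝕜 → 𝕜) (b i k : ℤ) :
    hop q f 0 b (latSingle i k) = f (q ^ i) (q ^ (k - b)) • latSingle i (k - b) := by
  ext i' k'
  rw [hop_apply, Pi.smul_apply, Pi.smul_apply, latSingle_apply, latSingle_apply, smul_eq_mul]
  by_cases h : i' = i ∧ k' = k - b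
  · obtain ⟨rfl, rfl⟩ := h
    simp
  · rw [if_neg (by omega), if_neg h, mul_zero, mul_zero]

variable [hq : IsGeneric q] (ħ : 𝕜)

/-- The operator `adU` on a row. -/
noncomputable def rowU (i : ℤ) : Module.End 𝕜 (row 𝕜 i) :=
  (adU q ħ).restrict fun _ => adU_mem_row q ħ
/-- The operator `adV` on a row. -/
noncomputable def rowV (i : ℤ) : Module.End 𝕜 (row 𝕜 i) :=
  (adV q ħ).restrict fun _ => adV_mem_row q ħ
/-- The operator `adW` on a row. -/
noncomputable def rowW (i : ℤ) : Module.End 𝕜 (row 𝕜 i) :=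
  (adW q ħ).restrict fun _ => adW_mem_row q ħ

/-- The matrix entry of `adU` in the row of the basis vector at `(i, k)`. -/
noncomputable def entU (i k : ℤ) : 𝕜 :=
  cas q ħ (q ^ i) * ((q ^ k) ^ 2 / q ^ 2 * br q (q ^ i * q / q ^ k))
/-- The matrix entry of `adV` in the row of the basis vector at `(i, k)`. -/
noncomputable def entV (i k : ℤ) : 𝕜 :=
  cas q ħ (q ^ i) * (q⁻¹ * ((q + q⁻¹) * (q ^ k) ^ 2 - (q ^ i) ^ 2 * q - ((q ^ i) ^ 2 * q)⁻¹) /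
    (q - q⁻¹))
/-- The matrix entry of `adW` in the row of the basis vector at `(i, k)`. -/
noncomputable def entW (i k : ℤ) : 𝕜 :=
  cas q ħ (q ^ i) * (br q (q ^ i * q ^ k * q) / q ^ 2)

variable {ħ}

theorem cas_ne_zero (hħ : ħ ≠ 0) (i : ℤ) : cas q ħ (q ^ i) ≠ 0 := fun h => hħ (by
  rw [cas_spec q ħ i, h]; simp)

theorem entU_ne_zero (hħ : ħ ≠ 0) {i k : ℤ} (h : k ≠ i + 1) : entU q ħ i k ≠ 0 := by
  have h0 : q ≠ 0 := hq.ne_zero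
  refine mul_ne_zero (cas_ne_zero q hħ i) (mul_ne_zero
    (div_ne_zero (pow_ne_zero 2 (zpow_ne_zero k h0)) (pow_ne_zero 2 h0)) ?_)
  rw [← zpow_add_one₀ h0, ← zpow_sub₀ h0]
  exact br_zpow_ne_zero q (by omega)

theorem entW_ne_zero (hħ : ħ ≠ 0) {i k : ℤ} (h : k ≠ -i - 1) : entW q ħ i k ≠ 0 := by
  have h0 : q ≠ 0 := hq.ne_zero
  refine mul_ne_zero (cas_ne_zero q hħ i) (div_ne_zero ?_ (pow_ne_zero 2 h0))
  rw [← zpow_add₀ h0, ← zpow_add_one₀ h0]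
  exact br_zpow_ne_zero q (by omega)

theorem entV_top (i : ℤ) :
    entV q ħ i i = cas q ħ (q ^ i) * (br q (q ^ (2 * i)) / q ^ 2) := by
  have h0 : q ≠ 0 := hq.ne_zero
  have h1 := IsGeneric.sub_inv_ne q
  have h2 := IsGeneric.sq_sub_one_ne q
  have ha : q ^ i ≠ 0 := zpow_ne_zero _ h0
  rw [entV, br, mul_comm 2 i, zpow_mul, zpow_ofNat]
  field_simp
  ring

theorem entV_bot (i : ℤ) : entV q ħ i (-i) = -cas q ħ (q ^ i) * br q (q ^ (2 * i)) := by
  have h0 : q ≠ 0 := hq.ne_zero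
  have h1 := IsGeneric.sub_inv_ne q
  have h2 := IsGeneric.sq_sub_one_ne q
  have ha : q ^ i ≠ 0 := zpow_ne_zero _ h0
  rw [entV, br, mul_comm 2 i, zpow_mul, zpow_ofNat, zpow_neg]
  field_simp
  ring

theorem entV_top_ne_zero (hħ : ħ ≠ 0) {i : ℤ} (hi : i ≠ 0) : entV q ħ i i ≠ 0 := by
  rw [entV_top]
  exact mul_ne_zero (cas_ne_zero q hħ i)
    (div_ne_zero (br_zpow_ne_zero q (by omega)) (pow_ne_zero 2 hq.ne_zero))

theorem entV_bot_ne_zero (hħ : ħ ≠ 0) {i : ℤ} (hi : i ≠ 0) : entV q ħ i (-i) ≠ 0 := by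
  rw [entV_bot]
  exact mul_ne_zero (neg_ne_zero.mpr (cas_ne_zero q hħ i)) (br_zpow_ne_zero q (by omega))

/-- The determinant deciding the twists with the highest weight vector as eigenvector. -/
theorem ent_det_top (hħ : ħ ≠ 0) {i : ℤ} (hi : i ≠ 0) :
    q ^ 2 * entV q ħ i (i - 1) * (1 - q ^ 2) * entV q ħ i i +
      (q ^ 3 + q) * entW q ħ i (i - 1) * entU q ħ i i ≠ 0 := by
  have h0 : q ≠ 0 := hq.ne_zero
  have h1 := IsGeneric.sub_inv_ne q
  have h2 := IsGeneric.sq_sub_one_ne q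
  have ha : q ^ i ≠ 0 := zpow_ne_zero _ h0
  have hb := br_zpow_ne_zero q (n := 2 * i) (by omega)
  have e : q ^ 2 * entV q ħ i (i - 1) * (1 - q ^ 2) * entV q ħ i i +
      (q ^ 3 + q) * entW q ħ i (i - 1) * entU q ħ i i =
      cas q ħ (q ^ i) ^ 2 * br q (q ^ (2 * i)) *
        (((q ^ i) ^ 4 * q ^ 2 + 1) / ((q ^ i) ^ 2 * q)) := by
    rw [entV_top, entV, entU, entW, zpow_sub_one₀ h0, mul_div_cancel_left₀ _ ha,
      show q ^ i * (q ^ i * q⁻¹) * q = q ^ (2 * i) by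
        rw [mul_comm 2 i, zpow_mul, zpow_ofNat]; field_simp]
    generalize br q (q ^ (2 * i)) = B
    rw [br]
    field_simp
    ring
  rw [e]
  exact mul_ne_zero (mul_ne_zero (pow_ne_zero 2 (cas_ne_zero q hħ i)) hb)
    (div_ne_zero (IsGeneric.pow_four_mul_sq_add_one_ne q i) (mul_ne_zero (pow_ne_zero 2 ha) h0))

/-- The determinant deciding the twists with the lowest weight vector as eigenvector. -/
theorem ent_det_bot (hħ : ħ ≠ 0) {i : ℤ} (hi : i ≠ 0) :
    -entV q ħ i (-i + 1) * (1 - q ^ 2) * entV q ħ i (-i) +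
      q ^ 2 * (q ^ 3 + q) * entU q ħ i (-i + 1) * entW q ħ i (-i) ≠ 0 := by
  have h0 : q ≠ 0 := hq.ne_zero
  have h1 := IsGeneric.sub_inv_ne q
  have h2 := IsGeneric.sq_sub_one_ne q
  have ha : q ^ i ≠ 0 := zpow_ne_zero _ h0
  have hb := br_zpow_ne_zero q (n := 2 * i) (by omega)
  have e : -entV q ħ i (-i + 1) * (1 - q ^ 2) * entV q ħ i (-i) +
      q ^ 2 * (q ^ 3 + q) * entU q ħ i (-i + 1) * entW q ħ i (-i) =
      cas q ħ (q ^ i) ^ 2 * br q (q ^ (2 * i)) *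
        (((q ^ i) ^ 4 * q ^ 2 + 1) / ((q ^ i) ^ 2 * q)) := by
    rw [entV_bot, entV, entU, entW, zpow_add_one₀ h0, zpow_neg, mul_inv_cancel₀ ha, one_mul,
      show q ^ i * q / ((q ^ i)⁻¹ * q) = q ^ (2 * i) by
        rw [mul_comm 2 i, zpow_mul, zpow_ofNat]; field_simp]
    generalize br q (q ^ (2 * i)) = B
    rw [br]
    field_simp
    ring
  rw [e]
  exact mul_ne_zero (mul_ne_zero (pow_ne_zero 2 (cas_ne_zero q hħ i)) hb)
    (div_ne_zero (IsGeneric.pow_four_mul_sq_add_one_ne q i) (mul_ne_zero (pow_ne_zero 2 ha) h0))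

theorem isLadder_row (hħ : ħ ≠ 0) {n : ℕ} {i : ℤ} (h : 2 * i = n) :
    IsLadder (rowBasis (𝕜 := 𝕜) h) (rowU q ħ i) (rowV q ħ i) (rowW q ħ i)
      (fun j => entU q ħ i (i - j)) (fun j => entW q ħ i (i - j - 1))
      (fun j => entV q ħ i (i - j)) := by
  have hU : ∀ k, adU q ħ (latSingle i k) = entU q ħ i (k + 1) • latSingle i (k + 1) := fun k => by
    simpa using! hop_latSingle q _ (-1) i k
  have hV : ∀ k, adV q ħ (latSingle i k) = entV q ħ i k • latSingle i k := fun k => by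
    simpa using! hop_latSingle q _ 0 i k
  have hW : ∀ k, adW q ħ (latSingle i k) = entW q ħ i (k - 1) • latSingle i (k - 1) := fun k =>
    hop_latSingle q _ 1 i k
  constructor
  · have := adU_mem_row q ħ (rowBasis (𝕜 := 𝕜) h 0).2
    refine Subtype.ext (row_ext this (zero_mem _) fun k hk => ?_)
    change adU q ħ (rowBasis (𝕜 := 𝕜) h 0) i k = 0
    rw [coe_rowBasis, hU, Pi.smul_apply, Pi.smul_apply, latSingle_apply, if_neg]
    · simp
    · rw [abs_le] at hk; simp; omega
  · intro j
    refine Subtype.ext ?_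
    change adU q ħ (rowBasis (𝕜 := 𝕜) h j.succ) =
      entU q ħ i (i - j) • (rowBasis (𝕜 := 𝕜) h j.castSucc : Lat 𝕜)
    rw [coe_rowBasis, coe_rowBasis, hU,
      show i - (j.succ : ℕ) + 1 = i - (j.castSucc : ℕ) by simp; ring]
    rfl
  · intro j
    refine Subtype.ext ?_
    change adW q ħ (rowBasis (𝕜 := 𝕜) h j.castSucc) =
      entW q ħ i (i - j - 1) • (rowBasis (𝕜 := 𝕜) h j.succ : Lat 𝕜)
    rw [coe_rowBasis, coe_rowBasis, hW]
    simp [sub_sub]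
  · have := adW_mem_row q ħ (rowBasis (𝕜 := 𝕜) h (Fin.last n)).2
    refine Subtype.ext (row_ext this (zero_mem _) fun k hk => ?_)
    change adW q ħ (rowBasis (𝕜 := 𝕜) h (Fin.last n)) i k = 0
    rw [coe_rowBasis, hW, Pi.smul_apply, Pi.smul_apply, latSingle_apply, if_neg]
    · simp
    · rw [abs_le] at hk; simp; omega
  · intro j
    refine Subtype.ext ?_
    change adV q ħ (rowBasis (𝕜 := 𝕜) h j) =
      entV q ħ i (i - j) • (rowBasis (𝕜 := 𝕜) h j : Lat 𝕜)
    rw [coe_rowBasis, hV]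
  · exact fun j => entU_ne_zero q hħ (by omega)
  · exact fun j => entW_ne_zero q hħ (by have := j.2; omega)

theorem envRel_row (i : ℤ) : EnvRel q ħ (rowU q ħ i) (rowV q ħ i) (rowW q ħ i) := by
  obtain ⟨h1, h2, h3⟩ := envRel_ad q ħ
  constructor
  · ext1 m; exact Subtype.ext (LinearMap.congr_fun h1 m.1)
  · ext1 m; exact Subtype.ext (LinearMap.congr_fun h2 m.1)
  · ext1 m; exact Subtype.ext (LinearMap.congr_fun h3 m.1)

/-- The operators on a row of positive index admit no nontrivial twist. -/
theorem twist_row (hħ : ħ ≠ 0) {i : ℤ} (hi : 0 < i) {T : Module.End 𝕜 (row 𝕜 i)}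
    (hT : EnvRel q ħ (rowU q ħ i * T) (rowV q ħ i * T) (rowW q ħ i * T)) : T = 0 ∨ T = 1 := by
  obtain ⟨n, hn⟩ : ∃ n : ℕ, 2 * i = (n + 1 : ℕ) := ⟨(2 * i - 1).toNat, by omega⟩
  have h := isLadder_row q hħ hn
  have e1 : i - ((Fin.last n).castSucc : Fin (n + 2)) = -i + 1 := by simp; omega
  have e2 : i - ((Fin.last (n + 1)) : Fin (n + 2)) = -i := by simp; omega
  have e3 : i - (Fin.last n : Fin (n + 1)) = -i + 1 := by simp; omega
  refine h.eq_zero_or_eq_one hħ (envRel_row q i) hT ?_ ?_ ?_ ?_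
  · simpa using entV_top_ne_zero q hħ hi.ne'
  · simpa only [e2] using entV_bot_ne_zero q hħ hi.ne'
  · simpa using ent_det_top q hħ hi.ne'
  · simpa only [e1, e2, e3, add_sub_cancel_right] using ent_det_bot q hħ hi.ne'

end

/-! ### Uniqueness of the operators on a component -/

section
variable {𝕜 : Type*} [Field 𝕜] (q : 𝕜) {ħ c : 𝕜}

theorem adU_apply (m : Lat 𝕜) (i k : ℤ) : adU q ħ m i k = entU q ħ i k * m i (k - 1) := by
  rw [adU, hop_apply, add_zero]; rfl

theorem adV_apply (m : Lat 𝕜) (i k : ℤ) : adV q ħ m i k = entV q ħ i k * m i k := by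
  rw [adV, hop_apply, add_zero, add_zero]; rfl

theorem adW_apply (m : Lat 𝕜) (i k : ℤ) : adW q ħ m i k = entW q ħ i k * m i (k + 1) := by
  rw [adW, hop_apply, add_zero]; rfl

variable [hq : IsGeneric q]

theorem kap_ne_zero (hc : c ≠ 0) (i : ℤ) : kap q c (q ^ i) ≠ 0 := fun h => hc (by
  rw [kap_spec q c i, h]; simp)

/-- The components in rows `i + 1` and `i - 1` of the relation obtained by contraction of the
multiplication operators with a triple of elements of row `i`. -/
theorem syzygy_row (hc : c ≠ 0) {i : ℤ} {a b d : Lat 𝕜} (ha : a ∈ row 𝕜 i) (hb : b ∈ row 𝕜 i)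
    (hd : d ∈ row 𝕜 i)
    (h : (q ^ 3 + q) • mulU q c d + mulV q c b + (q + q⁻¹) • mulW q c a = 0) (k : ℤ) :
    (q ^ k) ^ 2 * d i (k - 1) = q ^ k * q ^ i * b i k + (q ^ i) ^ 2 * a i (k + 1) ∧
    q ^ 2 * q ^ i * q ^ k * ((q ^ i) ^ 2 - (q ^ k) ^ 2) * b i k =
      ((q ^ 2 + 1) * (q ^ i) ^ 2 * (q ^ k) ^ 2 - q ^ 2 * (q ^ i) ^ 4 - 1) * a i (k + 1) := by
  have h0 : q ≠ 0 := hq.ne_zero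
  have hA : q ^ i ≠ 0 := zpow_ne_zero _ h0
  have hB : q ^ k ≠ 0 := zpow_ne_zero _ h0
  have hs := IsGeneric.add_inv_ne q
  have hs' := IsGeneric.sq_add_one_ne q
  have h4 := IsGeneric.pow_four_mul_sq_sub_one_ne q i
  have out : ∀ {m : Lat 𝕜}, m ∈ row 𝕜 i → ∀ i' k', i' ≠ i → m i' k' = 0 := fun hm i' k' hi => by
    by_contra hne
    exact hi (hm _ _ hne).1
  -- row `i + 1` is reached by the parts of the multiplication operators raising the spin
  have e₁ : (q ^ k) ^ 2 * d i (k - 1) = q ^ k * q ^ i * b i k + (q ^ i) ^ 2 * a i (k + 1) := by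
    have := congrFun (congrFun h (i + 1)) k
    simp only [mulU, mulV, mulW, LinearMap.add_apply, Pi.add_apply, Pi.smul_apply, hop_apply,
      smul_eq_mul, add_sub_cancel_right, add_zero, out ha (i + 1 + 1) _ (by omega),
      out hb (i + 1 + 1) _ (by omega), out hd (i + 1 + 1) _ (by omega), mul_zero,
      zpow_add_one₀ h0, Pi.zero_apply, ← sub_eq_add_neg] at this
    field_simp at this
    apply mul_left_cancel₀ hs'
    linear_combination this
  refine ⟨e₁, ?_⟩
  -- row `i - 1` is reached by the other parts, which do not vanish since `c ≠ 0`
  have := congrFun (congrFun h (i - 1)) k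
  have hκ := kap_ne_zero q hc (i - 1)
  simp only [mulU, mulV, mulW, LinearMap.add_apply, Pi.add_apply, Pi.smul_apply, hop_apply,
    smul_eq_mul, sub_add_cancel, add_zero, out ha (i - 1 - 1) _ (by omega),
    out hb (i - 1 - 1) _ (by omega), out hd (i - 1 - 1) _ (by omega), mul_zero, zero_add,
    Pi.zero_apply, ← sub_eq_add_neg] at this
  generalize kap q c (q ^ (i - 1)) = κ at *
  rw [zpow_sub_one₀ h0] at this
  generalize q ^ i = A at *
  generalize q ^ k = B at *
  generalize d i (k - 1) = d' at *
  generalize b i k = b' at *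
  generalize a i (k + 1) = a' at *
  apply mul_left_cancel₀ h4
  field_simp at this
  have hX := (mul_eq_zero.mp (this.trans (mul_zero _))).resolve_left (mul_ne_zero hs' hκ)
  linear_combination hX - q ^ 2 * A ^ 2 * (A ^ 2 - B ^ 2) * (q ^ 2 * A ^ 2 - B ^ 2) * e₁

/-- A triple of elements of a row annihilated by contraction with the multiplication operators is
obtained by applying `adU`, `adV`, `adW` to a single element. -/
theorem exists_eq_ad (hc : c ≠ 0) (hħ : ħ ≠ 0) {i : ℤ} (hi : 0 < i) {a b d : Lat 𝕜}
    (ha : a ∈ row 𝕜 i) (hb : b ∈ row 𝕜 i) (hd : d ∈ row 𝕜 i)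
    (h : (q ^ 3 + q) • mulU q c d + mulV q c b + (q + q⁻¹) • mulW q c a = 0) :
    ∃ t ∈ row 𝕜 i, adU q ħ t = a ∧ adV q ħ t = b ∧ adW q ħ t = d := by
  have h0 : q ≠ 0 := hq.ne_zero
  have hsub := IsGeneric.sub_inv_ne q
  have hz : ∀ k : ℤ, q ^ k ≠ 0 := fun k => zpow_ne_zero _ h0
  have out : ∀ {m : Lat 𝕜}, m ∈ row 𝕜 i → ∀ k, i < |k| → m i k = 0 := fun hm k hk => by
    by_contra hne
    exact absurd (hm _ _ hne).2 (by omega)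
  have hsyz := syzygy_row q hc ha hb hd h
  -- `adU t = a` determines `t` except at the highest weight, where `adV t = b` does
  let t : Lat 𝕜 := fun i' k => if i' = i ∧ |k| ≤ i then
    if k = i then b i i / entV q ħ i i else a i (k + 1) / entU q ħ i (k + 1) else 0
  have ht : t ∈ row 𝕜 i := fun i' k hne => by
    by_contra hk
    exact hne (if_neg hk)
  have ht' : ∀ k, |k| ≤ i →
      t i k = if k = i then b i i / entV q ħ i i else a i (k + 1) / entU q ħ i (k + 1) :=
    fun k hk => if_pos ⟨rfl, hk⟩
  have hU : ∀ k, |k| ≤ i → entU q ħ i (k + 1) * t i k = a i (k + 1) := fun k hk => by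
    rw [ht' k hk]
    split_ifs with hki
    · subst hki
      have : entU q ħ k (k + 1) = 0 := by
        rw [entU, zpow_add_one₀ h0, div_self (mul_ne_zero (hz k) h0)]; simp [br]
      rw [this, zero_mul, out ha _ (by rw [abs_of_pos (by omega)]; omega)]
    · exact mul_div_cancel₀ _ (entU_ne_zero q hħ (by omega))
  have hV : ∀ k, |k| ≤ i → entV q ħ i k * t i k = b i k := fun k hk => by
    by_cases hki : k = i
    · rw [ht' k hk, if_pos hki, hki]
      exact mul_div_cancel₀ _ (entV_top_ne_zero q hħ hi.ne')
    · have h2 := (hsyz k).2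
      have hne : (q ^ i) ^ 2 - (q ^ k) ^ 2 ≠ 0 := by
        rw [sub_ne_zero, ← zpow_natCast, ← zpow_natCast, ← zpow_mul, ← zpow_mul]
        intro he
        have := IsGeneric.zpow_injective q he
        push_cast at this; omega
      rw [← hU k hk, entU, zpow_add_one₀ h0, br] at h2
      rw [entV]
      have hA := hz i
      have hB := hz k
      generalize q ^ i = A at *
      generalize q ^ k = B at *
      apply mul_left_cancel₀ (mul_ne_zero (mul_ne_zero (mul_ne_zero (pow_ne_zero 2 h0) hA) hB) hne)
      rw [h2]
      field_simp
  have hW : ∀ k, |k| ≤ i → entW q ħ i (k - 1) * t i k = d i (k - 1) := fun k hk => by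
    have h1 := (hsyz k).1
    rw [← hU k hk, ← hV k hk, entU, entV, zpow_add_one₀ h0, br] at h1
    rw [entW, zpow_sub_one₀ h0, br]
    have hA := hz i
    have hB := hz k
    generalize q ^ i = A at *
    generalize q ^ k = B at *
    apply mul_left_cancel₀ (pow_ne_zero 2 hB)
    rw [h1]
    field_simp
    ring
  refine ⟨t, ht, row_ext (adU_mem_row q ħ ht) ha fun k hk => ?_,
    row_ext (adV_mem_row q ħ ht) hb fun k hk => ?_,
    row_ext (adW_mem_row q ħ ht) hd fun k hk => ?_⟩
  · rw [adU_apply]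
    by_cases hk1 : |k - 1| ≤ i
    · simpa using hU (k - 1) hk1
    · rw [out ht _ (by omega), mul_zero]
      obtain rfl : k = -i := by rw [abs_le] at *; omega
      have h1 := (hsyz (-i - 1)).1
      have habs : i < |-i - 1| := by rw [abs_of_neg (by omega)]; omega
      have habs' : i < |-i - 1 - 1| := by rw [abs_of_neg (by omega)]; omega
      rw [out hd _ habs', out hb _ habs, mul_zero, mul_zero, zero_add, sub_add_cancel] at h1
      exact ((mul_eq_zero.mp h1.symm).resolve_left (pow_ne_zero 2 (hz _))).symm
  · rw [adV_apply, hV k hk]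
  · rw [adW_apply]
    by_cases hk1 : |k + 1| ≤ i
    · simpa using hW (k + 1) hk1
    · rw [out ht _ (by omega), mul_zero]
      obtain rfl : k = i := by rw [abs_le] at *; omega
      have h1 := (hsyz (k + 1)).1
      have habs : k < |k + 1| := by rw [abs_of_pos (by omega)]; omega
      have habs' : k < |k + 1 + 1| := by rw [abs_of_pos (by omega)]; omega
      rw [out ha _ habs', out hb _ habs, mul_zero, mul_zero, zero_add, add_sub_cancel_right] at h1
      exact ((mul_eq_zero.mp h1).resolve_left (pow_ne_zero 2 (hz _))).symm

/-- The operators of an anchor contract to zero with the multiplication operators through `v₀`. -/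
theorem op_syzygy {β : Tangent q c ⊗[𝕜] Hyp q c →ₗ[𝕜] Hyp q c}
    (h : ∀ (a : Hyp q c) (ξ : Tangent q c) (f : Hyp q c), β ((a • ξ) ⊗ₜ f) = a * β (ξ ⊗ₜ f))
    (f : Hyp q c) : (q ^ 3 + q) • (coord q c (u 𝕜) * op q β (w 𝕜) f) +
      coord q c (v 𝕜) * op q β (v 𝕜) f + (q + q⁻¹) • (coord q c (w 𝕜) * op q β (u 𝕜) f) = 0 := by
  have e : ∀ x y : V 𝕜, coord q c x * op q β y f =
      β ((tangentRelations q c).mkQ (coord q c x ⊗ₜ[𝕜] y) ⊗ₜ f) := fun x y => by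
    rw [mkQ_tmul, h]; rfl
  have hv : (tangentRelations q c).mkQ ((coord q c).rTensor (V 𝕜) (v₀ q)) = 0 :=
    (Submodule.Quotient.mk_eq_zero _).mpr (Submodule.mem_span_singleton_self _)
  have := congrArg (fun ξ => β (ξ ⊗ₜ f)) hv
  simp only [v₀, map_add, map_smul, LinearMap.map_smul_of_tower, LinearMap.rTensor_tmul,
    TensorProduct.add_tmul, TensorProduct.zero_tmul, map_zero] at this
  rw [e, e, e]
  simpa only [← TensorProduct.smul_tmul', map_smul] using this

/-- The identification of a component of the hyperboloid with a row. -/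
noncomputable def componentEquiv (c : 𝕜) (n : ℕ) : component q c n ≃ₗ[𝕜] row 𝕜 n :=
  (Submodule.equivMapOfInjective (orbit q c) (orbit_injective q c) (component q c n)).trans
    (LinearEquiv.ofEq _ _ (map_orbit_component q c n))

/-- On a component of positive index, the operators of an anchor are twists of the `q`-adjoint ones,
hence equal to them. -/
theorem op_eq_hypAd_of_mem (hc : c ≠ 0) (hħ : ħ ≠ 0)
    {β : Tangent q c ⊗[𝕜] Hyp q c →ₗ[𝕜] Hyp q c}
    (h : ∀ (a : Hyp q c) (ξ : Tangent q c) (f : Hyp q c), β ((a • ξ) ⊗ₜ f) = a * β (ξ ⊗ₜ f))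
    (hrep : IsRep q ħ (op q β)) (hpres : PreservesComponents q β)
    (hne : NonzeroOnComponents q β) {n : ℕ} (hn : 1 ≤ n) (x : V 𝕜) {f : Hyp q c}
    (hf : f ∈ component q c n) : op q β x f = hypAd q ħ c x f := by
  have hn' : (0 : ℤ) < n := by omega
  let J := componentEquiv q c n
  let S : V 𝕜 → Module.End 𝕜 (component q c n) := fun x =>
    (op q β x).restrict fun f hf => hpres n x f hf
  let R : V 𝕜 → Module.End 𝕜 (row 𝕜 n) := fun x => J.conjAlgEquiv 𝕜 (S x)
  have hR : ∀ x (g : component q c n), (R x (J g) : Lat 𝕜) = orbit q c (op q β x g) := fun x g => by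
    simp only [R, LinearEquiv.conjAlgEquiv_apply_apply, LinearEquiv.symm_apply_apply]
    rfl
  have hS : EnvRel q ħ (S (u 𝕜)) (S (v 𝕜)) (S (w 𝕜)) := by
    obtain ⟨h1, h2, h3⟩ := (isRep_iff q ħ _).mp hrep
    constructor
    · exact LinearMap.ext fun g => Subtype.ext (LinearMap.congr_fun h1 g.1)
    · exact LinearMap.ext fun g => Subtype.ext (LinearMap.congr_fun h2 g.1)
    · exact LinearMap.ext fun g => Subtype.ext (LinearMap.congr_fun h3 g.1)
  have hRrel : EnvRel q ħ (R (u 𝕜)) (R (v 𝕜)) (R (w 𝕜)) :=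
    hS.map q (J.conjAlgEquiv 𝕜).toAlgHom
  -- the operators are obtained from the standard ones by a common twist
  obtain ⟨k, hk⟩ : ∃ k : ℕ, 2 * (n : ℤ) = (k + 1 : ℕ) := ⟨2 * n - 1, by omega⟩
  let Ψ := (rowU q ħ n).prod ((rowV q ħ n).prod (rowW q ħ n))
  obtain ⟨L, hL⟩ := Ψ.exists_leftInverse_of_injective (LinearMap.ker_eq_bot'.mpr fun m hm => by
    have h1 : rowU q ħ n m = 0 := congrArg Prod.fst hm
    have h2 : rowW q ħ n m = 0 := congrArg (fun p => p.2.2) hm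
    exact (isLadder_row q hħ hk).eq_zero_of_E_F_eq_zero (by omega) h1 h2)
  let T := L ∘ₗ (R (u 𝕜)).prod ((R (v 𝕜)).prod (R (w 𝕜)))
  have hT : ∀ m, rowU q ħ n (T m) = R (u 𝕜) m ∧ rowV q ħ n (T m) = R (v 𝕜) m ∧
      rowW q ħ n (T m) = R (w 𝕜) m := fun m => by
    obtain ⟨g, rfl⟩ := J.surjective m
    have hsyz := congrArg (orbit q c) (op_syzygy q h g)
    rw [map_add, map_add, map_smul, map_smul, orbit_coord_mul, orbit_coord_mul, orbit_coord_mul,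
      mulV₃_u, mulV₃_v, mulV₃_w, map_zero, ← hR, ← hR, ← hR] at hsyz
    obtain ⟨t, ht, h1, h2, h3⟩ := exists_eq_ad q hc hħ hn' (R (u 𝕜) (J g)).2 (R (v 𝕜) (J g)).2
      (R (w 𝕜) (J g)).2 hsyz
    have hΨ : Ψ ⟨t, ht⟩ = (R (u 𝕜) (J g), R (v 𝕜) (J g), R (w 𝕜) (J g)) :=
      Prod.ext (Subtype.ext h1) (Prod.ext (Subtype.ext h2) (Subtype.ext h3))
    have hTt : T (J g) = ⟨t, ht⟩ := by
      change L (R (u 𝕜) (J g), R (v 𝕜) (J g), R (w 𝕜) (J g)) = _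
      rw [← hΨ]
      exact LinearMap.congr_fun hL _
    rw [hTt]
    exact ⟨Subtype.ext h1, Subtype.ext h2, Subtype.ext h3⟩
  have eU : rowU q ħ n * T = R (u 𝕜) := LinearMap.ext fun m => (hT m).1
  have eV : rowV q ħ n * T = R (v 𝕜) := LinearMap.ext fun m => (hT m).2.1
  have eW : rowW q ħ n * T = R (w 𝕜) := LinearMap.ext fun m => (hT m).2.2
  have op_eq : ∀ x g, op q β x g = x 0 • op q β (u 𝕜) g + x 1 • op q β (v 𝕜) g +
      x 2 • op q β (w 𝕜) g := fun x g => by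
    conv_lhs => rw [vec_eq x]
    simp
  apply orbit_injective q c
  rw [orbit_hypAd, op_eq, map_add, map_add, map_smul, map_smul, map_smul]
  rcases twist_row q hħ hn' (T := T) (by rw [eU, eV, eW]; exact hRrel) with h0 | h1
  · exfalso
    obtain ⟨y, g, hg, hyg⟩ := hne n hn
    apply hyg
    apply orbit_injective q c
    rw [h0, mul_zero] at eU eV eW
    rw [op_eq, map_add, map_add, map_smul, map_smul, map_smul, ← hR _ ⟨g, hg⟩, ← hR _ ⟨g, hg⟩,
      ← hR _ ⟨g, hg⟩, ← eU, ← eV, ← eW]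
    simp
  · rw [h1, mul_one] at eU eV eW
    rw [← hR _ ⟨f, hf⟩, ← hR _ ⟨f, hf⟩, ← hR _ ⟨f, hf⟩, ← eU, ← eV, ← eW]
    rfl

theorem exists_eq_smul_one {f : Hyp q c} (hf : f ∈ component q c 0) : ∃ a : 𝕜, f = a • 1 := by
  have h : orbit q c f ∈ row 𝕜 (0 : ℕ) := by rw [← map_orbit_component q c]; exact ⟨f, hf, rfl⟩
  refine ⟨orbit q c f 0 0, orbit_injective q c ?_⟩
  rw [map_smul, orbit_one]
  refine row_ext h (Submodule.smul_mem _ _ (latSingle_mem_row (by simp))) fun k hk => ?_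
  obtain rfl : k = 0 := by simpa using hk
  simp [latSingle_apply]

theorem exists_hypAd_ne_zero (hħ : ħ ≠ 0) {n : ℕ} (hn : 1 ≤ n) :
    ∃ x : V 𝕜, ∃ f ∈ component q c n, hypAd q ħ c x f ≠ 0 := by
  have hmem : latSingle (𝕜 := 𝕜) n n ∈ row 𝕜 n := latSingle_mem_row (by simp)
  rw [← map_orbit_component q c] at hmem
  obtain ⟨f, hf, hfn⟩ := hmem
  refine ⟨v 𝕜, f, hf, fun h => entV_top_ne_zero q hħ (i := n) (by omega) ?_⟩
  have := congrFun (congrFun (congrArg (orbit q c) h) n) n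
  rw [orbit_hypAd_v, hfn, adV_apply, latSingle_apply] at this
  simpa using this

theorem op_eq_hypAd (hc : c ≠ 0) (hħ : ħ ≠ 0) {B : V 𝕜 ⊗[𝕜] V 𝕜 →ₗ[𝕜] V 𝕜}
    {β : Tangent q c ⊗[𝕜] Hyp q c →ₗ[𝕜] Hyp q c} (hβ : IsQuantumAnchor q B ħ β)
    (hpres : PreservesComponents q β) (hne : NonzeroOnComponents q β) :
    op q β = hypAd q ħ c := by
  refine LinearMap.ext fun x => LinearMap.ext fun f => ?_
  have hf : f ∈ ⨆ n : ℕ, component q c n := by rw [iSup_component]; trivial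
  induction hf using Submodule.iSup_induction' with
  | mem n f hf =>
    rcases Nat.eq_zero_or_pos n with rfl | hn
    · obtain ⟨a, rfl⟩ := exists_eq_smul_one q hf
      rw [map_smul, map_smul, hβ.op_one, hypAd_one]
    · exact op_eq_hypAd_of_mem q hc hħ hβ.smul_compat hβ.isRep hpres hne hn x hf
  | zero => simp
  | add f g _ _ hf hg => rw [map_add, map_add, hf, hg]

end

end QuantumAnchor

theorem mainTheorem2 {𝕜 : Type*} [RCLike 𝕜] (q : 𝕜) [QuantumAnchor.IsGeneric q]
    (c : 𝕜) (hc : c ≠ 0)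
    (B : TensorProduct 𝕜 (QuantumAnchor.V 𝕜) (QuantumAnchor.V 𝕜) →ₗ[𝕜] QuantumAnchor.V 𝕜)
    (hB : QuantumAnchor.IsBraidedBracket q B) :
    (∃ ħ : 𝕜, ħ ≠ 0 ∧ QuantumAnchor.IsRep q ħ (QuantumAnchor.qad B)) ∧
    ∀ ħ : 𝕜, QuantumAnchor.IsRep q ħ (QuantumAnchor.qad B) →
      ∃! β : TensorProduct 𝕜 (QuantumAnchor.Tangent q c) (QuantumAnchor.Hyp q c) →ₗ[𝕜]
          QuantumAnchor.Hyp q c,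
        QuantumAnchor.IsQuantumAnchor q B ħ β ∧
        QuantumAnchor.PreservesComponents q β ∧
        QuantumAnchor.NonzeroOnComponents q β := by
  open QuantumAnchor in
  obtain ⟨g, hg, hgB⟩ := hB.exists_eq
  have h0 : q ≠ 0 := IsGeneric.ne_zero
  have hħ : -g * (q ^ 3 + q⁻¹ ^ 3) ≠ 0 := by
    have h6 := IsGeneric.pow_four_mul_sq_add_one_ne q 1
    rw [zpow_one, ← pow_add] at h6
    refine mul_ne_zero (neg_ne_zero.mpr hg) fun h => h6 ?_
    field_simp at h
    linear_combination h
  have hrep := isRep_qad_iff q hg hgB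
  refine ⟨⟨_, hħ, (hrep _).mpr rfl⟩, fun ħ h => ?_⟩
  obtain rfl := (hrep ħ).mp h
  obtain ⟨β, hβ, hβop⟩ := exists_anchor q c (hypAd q (-g * (q ^ 3 + q⁻¹ ^ 3)) c)
    (coord_mul_hypAd q _ c)
  refine ⟨β, ⟨⟨hβ, hβop ▸ isRep_hypAd q _ c, fun x => by rw [hβop, hypAd_one],
    fun x z => by rw [hβop, hypAd_coord q hgB]⟩, fun i x f hf => ?_, fun i hi => ?_⟩, ?_⟩
  · rw [hβop]
    exact hypAd_mem_component q _ c i x hf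
  · rw [hβop]
    exact exists_hypAd_ne_zero q hħ hi
  · rintro β' ⟨h', hpres, hne⟩
    refine anchor_ext q h'.smul_compat hβ fun x f => ?_
    rw [hβop, op_eq_hypAd q hc hħ h' hpres hne]
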